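/- Consider the following process on the vertex set $V_n=\{1,\dots,n\}$. It starts with the empty graph. In each round, Builder is offered a spanning tree $T$ of $K_n$, chosen uniformly at random and independently of the previous rounds; he selects an edge of $T$ and adds it to his graph (if it is not yet present). A strategy $\sigma\in\mathcal S_n$ (for $n\ge 2$) is a function that maps each pair $(F,T)$, where $F$ is the current edge set and $T$ is the offered spanning tree, to an edge $\sigma(F,T)\in E(T)$. For a family $\mathcal P$ of graphs on $V_n$, let $\tau(\sigma,\mathcal P)$ be the first $i\ge 0$ such that the graph built after $i$ rounds belongs to $\mathcal P$. For a finite graph $H$ with $|H|\ge 1$ vertices, let $\mathcal P_H$ be the family of graphs on $V_n$ that contain $\lfloor n/|H|\rfloor$ pairwise vertex-disjoint copies of $H$ (an $H$-factor). Call $H$ central if it has a vertex all of whose incident edges are bridges of $H$. An event holds whp if its probability tends to $1$ as $n\to\infty$. Theorem. (i) For every fixed tree $H$ and every function $\omega=\omega(n)\to\infty$, there are strategies $\sigma=\sigma_n\in\mathcal S_n$ such that whp $$\tau(\sigma,\mathcal P_H)\le \frac{n(|H|-1)}{|H|}+\omega n^{3/4}.$$ (ii) For every fixed central graph $H$ there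 are a constant $C_H>0$ and strategies $\sigma=\sigma_n\in\mathcal S_n$ such that whp $\tau(\sigma,\mathcal P_H)\le C_H n$. (iii) For every $r\ge 3$ there is a connected central graph $H$ that contains $K_r$ as a subgraph and has the following property: for every function $\omega=\omega(n)\to\infty$ there are strategies $\sigma=\sigma_n\in\mathcal S_n$ such that whp $$\tau(\sigma,\mathcal P_H)\le \frac{n|E(H)|}{|H|}+\omega n^{3/4}.$$ This matches the trivial lower bound: there is a constant $C$, depending only on $H$, such that $\tau(\sigma,\mathcal P_H)\ge \frac{n|E(H)|}{|H|}-C$ always holds, for all $n$ and all $\sigma\in\mathcal S_n$. -/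

import Mathlib

open MeasureTheory ProbabilityTheory Filter Topology

namespace USTSR

/-- The spanning trees of the complete graph on the vertex set `Fin n`. -/
abbrev SpanningTree (n : ℕ) : Type := {T : SimpleGraph (Fin n) // T.IsTree}

/-- The discrete σ-algebra on the finite set of spanning trees. -/
instance (n : ℕ) : MeasurableSpace (SpanningTree n) := ⊤

/-- A strategy of Builder on `n` vertices: given the graph `F` built so far and the spanning tree
`T` offered in the present round, it selects an edge of `T`. (For `n = 1` the only tree has no
edge, so that there is nothing to select; this is why the condition is imposed for `2 ≤ n`.) -/
structure Strategy (n : ℕ) where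
  select : SimpleGraph (Fin n) → SpanningTree n → Sym2 (Fin n)
  select_mem : 2 ≤ n → ∀ (F : SimpleGraph (Fin n)) (T : SpanningTree n),
    select F T ∈ T.1.edgeSet

/-- The graph built by Builder after `i` rounds if he follows the strategy `σ` and is offered the
spanning trees `T 0, T 1, T 2, …` in successive rounds. -/
def builtGraph {n : ℕ} (σ : Strategy n) : ℕ → (ℕ → SpanningTree n) → SimpleGraph (Fin n)
  | 0, _ => ⊥
  | i + 1, T => builtGraph σ i T ⊔ SimpleGraph.fromEdgeSet {σ.select (builtGraph σ i T) (T i)}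

/-- The law of the sequence of offered trees: independent uniform spanning trees of the complete
graph on `n` vertices (a probability measure as soon as `1 ≤ n`). -/
noncomputable def treeLaw (n : ℕ) : Measure (ℕ → SpanningTree n) :=
  Measure.infinitePi fun _ : ℕ => uniformOn (Set.univ : Set (SpanningTree n))

/-- The first round `τ(σ, P)` after which the built graph has the property `P`
(`⊤` if there is none). -/
noncomputable def hittingTime {n : ℕ} (σ : Strategy n) (P : Set (SimpleGraph (Fin n)))
    (T : ℕ → SpanningTree n) : WithTop ℕ :=
  hittingAfter (builtGraph σ) P 0 T

/-- The graphs on `n` vertices that contain an `H`-factor, that is, `⌊n / |H|⌋` pairwise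
vertex-disjoint copies of `H` as (not necessarily induced) subgraphs. -/
def containsFactor {V : Type*} [Fintype V] (H : SimpleGraph V) (n : ℕ) :
    Set (SimpleGraph (Fin n)) :=
  {G | ∃ f : Fin (n / Fintype.card V) → SimpleGraph.Copy H G,
    Pairwise fun i j => Disjoint (Set.range (f i)) (Set.range (f j))}

/-- A graph is central if it has a vertex (a witness) all of whose edges are bridges. -/
def IsCentral {V : Type*} (H : SimpleGraph V) : Prop :=
  ∃ v : V, ∀ e ∈ H.incidenceSet v, H.IsBridge e

/-- With high probability as `n → ∞`, Builder, following the strategies `σ n`, obtains an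
`H`-factor on `n` vertices after at most `b n` rounds. -/
def BuildsFactorWhp {V : Type*} [Fintype V] (H : SimpleGraph V) (σ : ∀ n, Strategy n)
    (b : ℕ → ℝ) : Prop :=
  Tendsto
    (fun n => treeLaw n {T | ∃ i : ℕ, hittingTime (σ n) (containsFactor H n) T = i ∧ (i : ℝ) ≤ b n})
    atTop (𝓝 1)

end USTSR

/-!
A uniform spanning tree of the complete graph on `n` vertices has an edge in a given set `S` of
edges with probability at least `|S| / (n + |S|)`: in a tree that avoids `S`, every edge `uv` of `S`
can replace an edge `uw` of the tree, and at most `n` of these exchanges lead to the same tree,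
since the new tree has only one edge in `S` and the exchange is undone by naming `w`
(`card_avoid_mul_le`, `le_treeMean_hits`). The mean waiting time for an edge of `S` is thus at most
`1 + n / |S|`.

All strategies are greedy with respect to a potential `Ψ` on graphs, an upper bound for the expected
number of rounds that remain. If every graph without a factor admits a set `S` of edges each of
which decreases `Ψ` by at least `1 + n / |S|` (`Progress`), or if `Ψ` merely decreases by `1` in the
mean, then `Ψ ⊥` bounds the expected hitting time. Since a factor has a fixed number of edges and
one edge is added in each round, the excess of the hitting time over that number is nonnegative,
and Markov's inequality for the excess turns a starting value `n |E(H)| / |H| + O(n ^ (3/4))` into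
the bound with error term `ω n ^ (3/4)` (`failProb_le_of_drift`). If only `Ψ ⊥ = O(n)` is known, an
exponential tail bound takes its place (`failProb_le_of_progress`).

*Matchings.* A perfect matching between two classes of `N` vertices, where `N` is linear in `n`, is
built with `O(n ^ (3/4))` wasted rounds (`matchCost_progress`, `waste_le`). While `a` vertices of
each class are unmatched, there are `a ^ 2` edges that enlarge the matching, and the waiting times
`1 + n / a ^ 2` waste `O(n ^ (3/4))` rounds until `a` is about `n ^ (1/4)`. The remaining vertices
are matched one by one: about `√n` edges are collected from an unmatched vertex to matched ones,
which gives about `√n` augmenting paths that lack a single edge.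

*Bridges.* If the copies of the vertices of `H` are placed in classes, all edges of `H` other than
some bridges are realized inside rows, and the bridges are realized by arbitrary perfect matchings
between the classes, then there is a factor, because matchings along bridges can be composed without
conflict (`exists_potential_of_isBridge`, `mem_containsFactor`). For a tree all edges are bridges.
For a central graph `H` with central vertex `v`, the copies of `H - v` are built first; more than
`n / |H|` disjoint cells fit in, so that there are always linearly many useful edges until
`n / |H|` cells are complete, which takes linear time. Then the edges at `v`, which are bridges, are
built as matchings.

*Optimal time.* A clique cannot be completed everywhere without waste, since useful edges
become scarce. The graph in `exists_optimal_central` is made so that this never happens. A hub is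
joined to `s` leaves and to the components of many cells on `r` vertices, and for every `j` there
are `m j` cells that contain the first `j` edges of the clique, where `m` decreases rapidly. While
cells of level `i` are raised to level `i + 1`, at least `(m i - m (i + 1)) N` cells are at level
`i`, where `N = n / |H|`, so that a useful edge in a cell is offered with a constant probability. In
all other rounds an edge between the hubs and the leaves is built; there are quadratically many
candidates as long as linearly many leaves are missing. If `s` is large, the leaves outlast the
cells. An exponential term in the potential (`stageCost`) accounts for the unlikely event that they
do not (`firstStage_drift`).
-/

namespace USTSR

/-! ### Exchanges of edges in spanning trees -/

open scoped Classical in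
/-- Exchanging an edge of a tree: if `u` and `v` are not adjacent in the tree `T`, some edge `uw`
at `u` can be replaced by `uv`; here `w` is the neighbour of `u` on the path to `v`. -/
lemma exists_isTree_swap {n : ℕ} {T : SimpleGraph (Fin n)} (hT : T.IsTree) {u v : Fin n}
    (huv : u ≠ v) (hadj : ¬ T.Adj u v) :
    ∃ w, T.Adj u w ∧ (T.deleteEdges {s(u, w)} ⊔ SimpleGraph.edge u v).IsTree := by
  obtain ⟨p, hp⟩ := (hT.existsUnique_path u v).exists
  cases p with
  | nil => exact absurd rfl huv
  | @cons _ w _ h q =>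
    refine ⟨w, h, ?_⟩
    rw [SimpleGraph.Walk.cons_isPath_iff] at hp
    have hwv : (T.deleteEdges {s(u, w)} ⊔ SimpleGraph.edge u v).Reachable w v := by
      have h1 : (T.deleteEdges {s(u, w)}).Reachable w v := by
        refine ⟨q.toDeleteEdge s(u, w) ?_⟩
        intro hmem
        exact hp.2 (q.fst_mem_support_of_mem_edges hmem)
      exact h1.mono le_sup_left
    have huv' : (T.deleteEdges {s(u, w)} ⊔ SimpleGraph.edge u v).Adj u v := by
      rw [SimpleGraph.sup_adj]; right; simp [SimpleGraph.edge_adj, huv]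
    rw [SimpleGraph.isTree_iff_connected_and_card]
    have hT' := SimpleGraph.isTree_iff_connected_and_card.1 hT
    constructor
    · have := hT'.1.nonempty
      refine SimpleGraph.Connected.mk ?_
      intro a b
      obtain ⟨pw⟩ := hT'.1.preconnected a b
      induction pw with
      | nil => exact SimpleGraph.Reachable.refl _
      | @cons a c b hac _ ih =>
        refine SimpleGraph.Reachable.trans ?_ ih
        by_cases he : s(a, c) = s(u, w)
        · have huw : (T.deleteEdges {s(u, w)} ⊔ SimpleGraph.edge u v).Reachable u w :=
            huv'.reachable.trans hwv.symm
          rcases Sym2.eq_iff.1 he with ⟨rfl, rfl⟩ | ⟨rfl, rfl⟩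
          · exact huw
          · exact huw.symm
        · apply SimpleGraph.Adj.reachable
          rw [SimpleGraph.sup_adj]; left
          simp [SimpleGraph.deleteEdges_adj, hac]
          simpa using he
    · rw [← hT'.2]
      congr 1
      have e1 : (T.deleteEdges {s(u, w)} ⊔ SimpleGraph.edge u v).edgeSet
          = insert s(u, v) (T.edgeSet \ {s(u, w)}) := by
        rw [SimpleGraph.edgeSet_sup, SimpleGraph.edgeSet_deleteEdges, SimpleGraph.edgeSet_edge_of_ne huv]
        rw [Set.union_comm]; rfl
      change Set.ncard _ = Set.ncard _
      rw [e1, Set.ncard_insert_of_notMem (by simp [hadj]), Set.ncard_sdiff_singleton_add_one (by simpa using h)]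

/-- The spanning trees of a finite complete graph form a finite type. -/
noncomputable instance (n : ℕ) : Fintype (SpanningTree n) := Fintype.ofFinite _

open scoped Classical in
/-- Double counting of the exchanges `T ↦ T - uw + uv` with `uv ∈ S`: a set `S` of edges of the
complete graph is avoided by at most `n / |S|` times as many spanning trees as it is hit by. -/
lemma card_avoid_mul_le {n : ℕ} (S : Finset (Sym2 (Fin n))) (hS : ∀ e ∈ S, ¬ e.IsDiag) :
    (Finset.univ.filter fun T : SpanningTree n => ∀ e ∈ S, e ∉ T.1.edgeSet).card * S.card ≤
      n * (Finset.univ.filter fun T : SpanningTree n => ∃ e ∈ S, e ∈ T.1.edgeSet).card := by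
  -- the ends of an edge, in a fixed order
  have hout : ∀ e : Sym2 (Fin n), s((Quot.out e).1, (Quot.out e).2) = e := fun e => Quot.out_eq e
  have key : ∀ x : SpanningTree n × Sym2 (Fin n), ∃ y : Fin n × SpanningTree n,
      (∀ e ∈ S, e ∉ x.1.1.edgeSet) → x.2 ∈ S →
        y.2.1.edgeSet = insert x.2 (x.1.1.edgeSet \ {s((Quot.out x.2).1, y.1)}) ∧
        s((Quot.out x.2).1, y.1) ∈ x.1.1.edgeSet := by
    rintro ⟨T, e⟩
    by_cases h : (∀ e ∈ S, e ∉ T.1.edgeSet) ∧ e ∈ S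
    · have hne : (Quot.out e).1 ≠ (Quot.out e).2 := by
        intro h'
        apply hS e h.2
        rw [← hout e]; exact h'
      have hna : ¬ T.1.Adj (Quot.out e).1 (Quot.out e).2 := by
        have := h.1 e h.2
        rw [← hout e] at this
        exact this
      obtain ⟨w, hw, ht⟩ := exists_isTree_swap T.2 hne hna
      refine ⟨(w, ⟨_, ht⟩), fun _ _ => ⟨?_, hw⟩⟩
      simp only
      rw [SimpleGraph.edgeSet_sup, SimpleGraph.edgeSet_deleteEdges,
        SimpleGraph.edgeSet_edge_of_ne hne, hout, Set.union_comm]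
      rfl
    · have := T.2.connected.nonempty
      exact ⟨(Classical.arbitrary _, T), fun h1 h2 => absurd ⟨h1, h2⟩ h⟩
  choose f hf using key
  have := Finset.card_le_card_of_injOn
    (s := (Finset.univ.filter fun T : SpanningTree n => ∀ e ∈ S, e ∉ T.1.edgeSet) ×ˢ S)
    (t := (Finset.univ : Finset (Fin n)) ×ˢ
      (Finset.univ.filter fun T : SpanningTree n => ∃ e ∈ S, e ∈ T.1.edgeSet)) f ?_ ?_
  · simpa [Finset.card_product] using this
  · rintro ⟨T, e⟩ hx
    simp only [Finset.coe_product, Finset.coe_filter, Set.mem_prod, Finset.mem_univ, true_and,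
      Set.mem_ofPred_eq, Finset.mem_coe, Finset.coe_univ, Set.mem_univ] at hx ⊢
    obtain ⟨h1, -⟩ := hf (T, e) hx.1 hx.2
    exact ⟨e, hx.2, by rw [h1]; exact Set.mem_insert _ _⟩
  · rintro ⟨T, e⟩ hx ⟨T', e'⟩ hx' heq
    simp only [Finset.coe_product, Finset.coe_filter, Set.mem_prod, Finset.mem_univ, true_and,
      Set.mem_ofPred_eq, Finset.mem_coe] at hx hx'
    obtain ⟨h1, h2⟩ := hf (T, e) hx.1 hx.2
    obtain ⟨h1', h2'⟩ := hf (T', e') hx'.1 hx'.2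
    rw [← heq] at h1' h2'
    simp only at h1 h2 h1' h2'
    -- the new tree contains exactly one edge of `S`
    have hee : e = e' := by
      have h3 : e ∈ (f (T, e)).2.1.edgeSet := by rw [h1]; exact Set.mem_insert _ _
      rw [h1'] at h3
      rcases h3 with h3 | h3
      · exact h3
      · exact absurd h3.1 (hx'.1 e hx.2)
    subst hee
    have hTT : T.1.edgeSet = T'.1.edgeSet := by
      have r : ∀ (A : Set (Sym2 (Fin n))) (g : Sym2 (Fin n)), e ∉ A → g ∈ A →
          A = insert g ((insert e (A \ {g})) \ {e}) := by
        intro A g heA hgA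
        rw [Set.insert_sdiff_of_mem _ (Set.mem_singleton e),
          Set.sdiff_singleton_eq_self (fun h => heA h.1), Set.insert_sdiff_singleton,
          Set.insert_eq_of_mem hgA]
      rw [r _ _ (hx.1 e hx.2) h2, r _ _ (hx'.1 e hx.2) h2', ← h1, ← h1']
    have : T = T' := Subtype.ext (SimpleGraph.edgeSet_inj.1 hTT)
    rw [this]

/-! ### The law of the built graph -/

/-- The graph obtained from `F` by adding the edge `e` (nothing is added if `e` is a loop). -/
abbrev addEdge {n : ℕ} (F : SimpleGraph (Fin n)) (e : Sym2 (Fin n)) : SimpleGraph (Fin n) :=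
  F ⊔ SimpleGraph.fromEdgeSet {e}

lemma ncard_edgeSet_addEdge_le {n : ℕ} (F : SimpleGraph (Fin n)) (e : Sym2 (Fin n)) :
    (addEdge F e).edgeSet.ncard ≤ F.edgeSet.ncard + 1 := by
  have : (addEdge F e).edgeSet ⊆ insert e F.edgeSet := by
    rw [SimpleGraph.edgeSet_sup, SimpleGraph.edgeSet_fromEdgeSet]
    rintro e (he | he)
    · exact Set.mem_insert_of_mem _ he
    · exact Or.inl he.1
  exact (Set.ncard_le_ncard this (Set.toFinite _)).trans (Set.ncard_insert_le _ _)

/-- The mean of a function of a uniform spanning tree. -/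
noncomputable def treeMean {n : ℕ} (f : SpanningTree n → ℝ) : ℝ :=
  (∑ T, f T) / Fintype.card (SpanningTree n)

lemma spanningTree_nonempty {n : ℕ} (hn : 1 ≤ n) : Nonempty (SpanningTree n) := by
  have : Nonempty (Fin n) := ⟨⟨0, hn⟩⟩
  obtain ⟨T, -, hT⟩ := (SimpleGraph.connected_top (V := Fin n)).exists_isTree_le
  exact ⟨⟨T, hT⟩⟩

lemma card_spanningTree_pos {n : ℕ} (hn : 1 ≤ n) :
    (0 : ℝ) < Fintype.card (SpanningTree n) := by
  have := spanningTree_nonempty hn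
  exact_mod_cast Fintype.card_pos

lemma treeMean_mono {n : ℕ} {f g : SpanningTree n → ℝ} (h : ∀ T, f T ≤ g T) :
    treeMean f ≤ treeMean g := by
  unfold treeMean
  gcongr
  exact h _

lemma treeMean_const {n : ℕ} (hn : 1 ≤ n) (c : ℝ) :
    treeMean (fun _ : SpanningTree n => c) = c := by
  have := card_spanningTree_pos hn
  unfold treeMean
  rw [Finset.sum_const, nsmul_eq_mul, Finset.card_univ]
  field_simp

lemma treeMean_mul {n : ℕ} (c : ℝ) (f : SpanningTree n → ℝ) :
    treeMean (fun T => c * f T) = c * treeMean f := by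
  unfold treeMean
  rw [← Finset.mul_sum, mul_div_assoc]

lemma treeMean_add {n : ℕ} (f g : SpanningTree n → ℝ) :
    treeMean (fun T => f T + g T) = treeMean f + treeMean g := by
  unfold treeMean
  rw [Finset.sum_add_distrib, add_div]

lemma treeMean_sub {n : ℕ} (f g : SpanningTree n → ℝ) :
    treeMean (fun T => f T - g T) = treeMean f - treeMean g := by
  unfold treeMean
  rw [Finset.sum_sub_distrib, sub_div]

open scoped Classical in
/-- The probability that Builder, starting from the graph `F` and following `σ`, does not have a
graph in `P` after exactly `s` further rounds. -/
noncomputable def failProb {n : ℕ} (σ : Strategy n) (P : Set (SimpleGraph (Fin n))) :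
    ℕ → SimpleGraph (Fin n) → ℝ
  | 0, F => if F ∈ P then 0 else 1
  | s + 1, F => treeMean fun T => failProb σ P s (addEdge F (σ.select F T))

lemma failProb_nonneg {n : ℕ} (σ : Strategy n) (P : Set (SimpleGraph (Fin n))) (s : ℕ) :
    ∀ F, 0 ≤ failProb σ P s F := by
  induction s with
  | zero => intro F; unfold failProb; split_ifs <;> norm_num
  | succ s ih =>
    intro F
    unfold failProb treeMean
    exact div_nonneg (Finset.sum_nonneg fun T _ => ih _) (Nat.cast_nonneg _)

lemma failProb_of_mem {n : ℕ} (σ : Strategy n) {P : Set (SimpleGraph (Fin n))} (hP : IsUpperSet P)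
    (s : ℕ) : ∀ F ∈ P, failProb σ P s F = 0 := by
  induction s with
  | zero => intro F hF; unfold failProb; simp [hF]
  | succ s ih =>
    intro F hF
    unfold failProb treeMean
    rw [Finset.sum_eq_zero fun T _ => ih _ (hP le_sup_left hF), zero_div]

section Law

/-- The discrete σ-algebra on the finite set of graphs. -/
local instance (n : ℕ) : MeasurableSpace (SimpleGraph (Fin n)) := ⊤

lemma isProbabilityMeasure_uniform {n : ℕ} (hn : 1 ≤ n) :
    IsProbabilityMeasure (uniformOn (Set.univ : Set (SpanningTree n))) := by
  have := spanningTree_nonempty hn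
  exact isProbabilityMeasure_uniformOn Set.finite_univ Set.univ_nonempty

lemma integral_uniform {n : ℕ} (hn : 1 ≤ n) (f : SpanningTree n → ℝ) :
    ∫ T, f T ∂(uniformOn (Set.univ : Set (SpanningTree n))) = treeMean f := by
  have := isProbabilityMeasure_uniform hn
  rw [integral_fintype Integrable.of_finite]
  unfold treeMean
  rw [Finset.sum_div]
  refine Finset.sum_congr rfl fun T _ => ?_
  rw [measureReal_def, uniformOn_univ]
  simp [div_eq_inv_mul]

/-- The built graph depends on the trees of the past rounds only. -/
lemma exists_builtGraph_eq {n : ℕ} (σ : Strategy n) (i : ℕ) :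
    ∃ g : ((Finset.range i) → SpanningTree n) → SimpleGraph (Fin n),
      ∀ T, builtGraph σ i T = g fun j => T j := by
  induction i with
  | zero => exact ⟨fun _ => ⊥, fun T => rfl⟩
  | succ i ih =>
    obtain ⟨g, hg⟩ := ih
    refine ⟨fun t => addEdge (g fun j => t ⟨j, Finset.mem_range.2 (by
      have := Finset.mem_range.1 j.2; omega)⟩) (σ.select (g fun j => t ⟨j, Finset.mem_range.2 (by
      have := Finset.mem_range.1 j.2; omega)⟩) (t ⟨i, Finset.mem_range.2 (by omega)⟩)), ?_⟩
    intro T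
    change addEdge (builtGraph σ i T) _ = _
    rw [hg]

lemma measurable_builtGraph {n : ℕ} (σ : Strategy n) (i : ℕ) : Measurable (builtGraph σ i) := by
  obtain ⟨g, hg⟩ := exists_builtGraph_eq σ i
  have h : builtGraph σ i = g ∘ fun T j => T j := funext hg
  rw [h]
  refine (measurable_of_countable g).comp ?_
  exact measurable_pi_lambda _ fun j => measurable_pi_apply _

lemma indepFun_builtGraph {n : ℕ} (hn : 1 ≤ n) (σ : Strategy n) (i : ℕ) :
    IndepFun (builtGraph σ i) (fun T => T i) (treeLaw n) := by
  have := isProbabilityMeasure_uniform hn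
  obtain ⟨g, hg⟩ := exists_builtGraph_eq σ i
  have h : builtGraph σ i = g ∘ fun T j => T j := funext hg
  have h1 : iIndepFun (fun (j : ℕ) (T : ℕ → SpanningTree n) => T j) (treeLaw n) := by
    unfold treeLaw
    exact iIndepFun_infinitePi (P := fun _ : ℕ => uniformOn (Set.univ : Set (SpanningTree n)))
      (X := fun _ T => T) (fun _ => measurable_id)
  have h2 := h1.indepFun_finset (Finset.range i) {i} (by simp)
    (fun j => measurable_pi_apply j)
  rw [h]
  exact h2.comp (φ := g) (ψ := fun t => t ⟨i, by simp⟩) (measurable_of_countable g)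
    (measurable_of_countable _)

/-- The tree of round `i` may be averaged out separately, as it is independent of the graph built
before. -/
lemma integral_builtGraph {n : ℕ} (hn : 1 ≤ n) (σ : Strategy n) (i : ℕ)
    (f : SimpleGraph (Fin n) → SpanningTree n → ℝ) :
    ∫ T, f (builtGraph σ i T) (T i) ∂(treeLaw n) =
      ∫ T, treeMean (f (builtGraph σ i T)) ∂(treeLaw n) := by
  have := isProbabilityMeasure_uniform hn
  have hprob : IsProbabilityMeasure (treeLaw n) := by unfold treeLaw; infer_instance
  have hm := measurable_builtGraph σ i
  have hmi : Measurable fun T : ℕ → SpanningTree n => T i := measurable_pi_apply i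
  have h1 := (indepFun_iff_map_prod_eq_prod_map_map hm.aemeasurable hmi.aemeasurable).1
    (indepFun_builtGraph hn σ i)
  have h2 : (treeLaw n).map (fun T => T i) = uniformOn (Set.univ : Set (SpanningTree n)) := by
    unfold treeLaw
    exact Measure.infinitePi_map_eval (fun _ : ℕ => uniformOn (Set.univ : Set (SpanningTree n))) i
  have hp : IsProbabilityMeasure ((treeLaw n).map (builtGraph σ i)) :=
    Measure.isProbabilityMeasure_map hm.aemeasurable
  calc ∫ T, f (builtGraph σ i T) (T i) ∂(treeLaw n)
      = ∫ x, (fun x : SimpleGraph (Fin n) × SpanningTree n => f x.1 x.2) x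
          ∂((treeLaw n).map fun T => (builtGraph σ i T, T i)) := by
        rw [integral_map (hm.prodMk hmi).aemeasurable]
        exact (measurable_of_countable _).aestronglyMeasurable
    _ = ∫ F, treeMean (f F) ∂((treeLaw n).map (builtGraph σ i)) := by
        rw [h1, h2, integral_prod _ Integrable.of_finite]
        simp_rw [integral_uniform hn]
    _ = _ := by
        rw [integral_map hm.aemeasurable]
        exact (measurable_of_countable _).aestronglyMeasurable

/-- The recursion `failProb` computes the probability, under the law of the offered trees, that the
graph built after `t` rounds is not in `P`. -/
lemma treeLaw_real_eq_failProb {n : ℕ} (hn : 1 ≤ n) (σ : Strategy n)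
    (P : Set (SimpleGraph (Fin n))) (t : ℕ) :
    (treeLaw n).real {T | builtGraph σ t T ∉ P} = failProb σ P t ⊥ := by
  have := isProbabilityMeasure_uniform hn
  have hprob : IsProbabilityMeasure (treeLaw n) := by unfold treeLaw; infer_instance
  have h : ∀ s i, ∫ T, failProb σ P s (builtGraph σ i T) ∂(treeLaw n) =
      ∫ T, failProb σ P 0 (builtGraph σ (i + s) T) ∂(treeLaw n) := by
    intro s
    induction s with
    | zero => intro i; rfl
    | succ s ih =>
      intro i
      rw [show i + (s + 1) = (i + 1) + s by ring, ← ih]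
      exact (integral_builtGraph hn σ i
        fun F T => failProb σ P s (addEdge F (σ.select F T))).symm
  have h0 := h t 0
  simp only [zero_add] at h0
  have hb : ∀ T, builtGraph σ 0 T = ⊥ := fun T => rfl
  simp only [hb, integral_const, probReal_univ, one_smul] at h0
  rw [h0]
  have hms : MeasurableSet {T | builtGraph σ t T ∉ P} :=
    measurable_builtGraph σ t (MeasurableSpace.measurableSet_top (s := Pᶜ))
  rw [← integral_indicator_one hms]
  refine integral_congr_ae (Eventually.of_forall fun T => ?_)
  by_cases hT : builtGraph σ t T ∈ P <;> simp [failProb, hT, Set.indicator]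

end Law

/-- To prove that a factor is built with high probability, it suffices to bound `failProb`. -/
lemma buildsFactorWhp_of_failProb {V : Type*} [Fintype V] (H : SimpleGraph V)
    (σ : ∀ n, Strategy n) (b : ℕ → ℝ) (t : ℕ → ℕ) (ht : ∀ᶠ n in atTop, (t n : ℝ) ≤ b n)
    (h : Tendsto (fun n => failProb (σ n) (containsFactor H n) (t n) ⊥) atTop (𝓝 0)) :
    BuildsFactorWhp H σ b := by
  have h1 : Tendsto (fun n => ENNReal.ofReal (1 - failProb (σ n) (containsFactor H n) (t n) ⊥))
      atTop (𝓝 1) := by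
    have := (ENNReal.continuous_ofReal.tendsto 1).comp
      (by simpa using h.const_sub 1 : Tendsto (fun n =>
        1 - failProb (σ n) (containsFactor H n) (t n) ⊥) atTop (𝓝 1))
    simpa [Function.comp_def] using this
  refine tendsto_of_tendsto_of_tendsto_of_le_of_le' h1 tendsto_const_nhds ?_ ?_
  · filter_upwards [ht, eventually_ge_atTop 1] with n htn hn
    have := isProbabilityMeasure_uniform hn
    have hprob : IsProbabilityMeasure (treeLaw n) := by unfold treeLaw; infer_instance
    rw [← treeLaw_real_eq_failProb hn]
    have hms : MeasurableSet {T | builtGraph (σ n) (t n) T ∉ containsFactor H n} := by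
      let _ : MeasurableSpace (SimpleGraph (Fin n)) := ⊤
      exact measurable_builtGraph (σ n) (t n)
        (MeasurableSpace.measurableSet_top (s := (containsFactor H n)ᶜ))
    rw [← probReal_compl_eq_one_sub hms, ofReal_measureReal]
    refine measure_mono ?_
    intro T hT
    simp only [Set.mem_compl_iff, Set.mem_ofPred_eq, not_not] at hT
    have hle : hittingTime (σ n) (containsFactor H n) T ≤ (t n : ℕ) :=
      hittingAfter_le_of_mem (Nat.zero_le _) hT
    obtain ⟨i, hi⟩ := WithTop.ne_top_iff_exists.1 (ne_top_of_le_ne_top WithTop.coe_ne_top hle)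
    refine ⟨i, hi.symm, ?_⟩
    rw [← hi] at hle
    have : i ≤ t n := WithTop.coe_le_coe.1 hle
    exact le_trans (by exact_mod_cast this) htn
  · filter_upwards [eventually_ge_atTop 1] with n hn
    have := isProbabilityMeasure_uniform hn
    have hprob : IsProbabilityMeasure (treeLaw n) := by unfold treeLaw; infer_instance
    exact prob_le_one

/-! ### Greedy strategies and potentials -/

/-- An edge of `T` that is best for `Ψ`. For `n = 1` the tree has no edges, and any value will do. -/
lemma exists_greedy {n : ℕ} (Ψ : SimpleGraph (Fin n) → ℝ) (F : SimpleGraph (Fin n))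
    (T : SpanningTree n) :
    ∃ e : Sym2 (Fin n), (2 ≤ n → e ∈ T.1.edgeSet) ∧
      ∀ e' ∈ T.1.edgeSet, Ψ (addEdge F e) ≤ Ψ (addEdge F e') := by
  by_cases h : T.1.edgeSet.Nonempty
  · obtain ⟨e, he, hmin⟩ := Set.exists_min_image T.1.edgeSet (fun e => Ψ (addEdge F e))
      (Set.toFinite _) h
    exact ⟨e, fun _ => he, hmin⟩
  · obtain ⟨v⟩ := T.2.connected.nonempty
    refine ⟨s(v, v), fun hn => absurd ?_ h, fun e' he' => absurd ⟨e', he'⟩ h⟩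
    have : Nontrivial (Fin n) := Fin.nontrivial_iff_two_le.2 hn
    obtain ⟨w, hw⟩ := T.2.connected.preconnected.exists_adj_of_nontrivial v
    exact ⟨s(v, w), hw⟩

/-- The greedy strategy for a potential `Ψ`: in every round, an edge of the offered tree is added
for which the potential of the resulting graph is as small as possible. -/
noncomputable def greedy {n : ℕ} (Ψ : SimpleGraph (Fin n) → ℝ) : Strategy n where
  select F T := (exists_greedy Ψ F T).choose
  select_mem hn F T := (exists_greedy Ψ F T).choose_spec.1 hn

lemma greedy_le {n : ℕ} (Ψ : SimpleGraph (Fin n) → ℝ) (F : SimpleGraph (Fin n))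
    (T : SpanningTree n) {e : Sym2 (Fin n)} (he : e ∈ T.1.edgeSet) :
    Ψ (addEdge F ((greedy Ψ).select F T)) ≤ Ψ (addEdge F e) :=
  (exists_greedy Ψ F T).choose_spec.2 e he

lemma greedy_le_self {n : ℕ} {Ψ : SimpleGraph (Fin n) → ℝ} (hΨ : Antitone Ψ)
    (F : SimpleGraph (Fin n)) (T : SpanningTree n) :
    Ψ (addEdge F ((greedy Ψ).select F T)) ≤ Ψ F :=
  hΨ le_sup_left

open scoped Classical in
/-- The indicator of the event that the tree `T` has an edge in `S`. -/
noncomputable def hits {n : ℕ} (S : Finset (Sym2 (Fin n))) (T : SpanningTree n) : ℝ :=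
  if ∃ e ∈ S, e ∈ T.1.edgeSet then 1 else 0

lemma hits_le_one {n : ℕ} (S : Finset (Sym2 (Fin n))) (T : SpanningTree n) : hits S T ≤ 1 := by
  unfold hits; split_ifs <;> norm_num

/-- A uniform spanning tree hits a set `S` of edges with probability at least
`|S| / (n + |S|)`. -/
lemma le_treeMean_hits {n : ℕ} (hn : 1 ≤ n) (S : Finset (Sym2 (Fin n)))
    (hS : ∀ e ∈ S, ¬ e.IsDiag) :
    (S.card : ℝ) / (n + S.card) ≤ treeMean (hits S) := by
  classical
  have h1 := card_avoid_mul_le S hS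
  have hpos := card_spanningTree_pos hn
  set a := (Finset.univ.filter fun T : SpanningTree n => ∀ e ∈ S, e ∉ T.1.edgeSet).card with ha
  set b := (Finset.univ.filter fun T : SpanningTree n => ∃ e ∈ S, e ∈ T.1.edgeSet).card with hb
  have hab : b + a = Fintype.card (SpanningTree n) := by
    have := Finset.card_filter_add_card_filter_not (s := (Finset.univ : Finset (SpanningTree n)))
      (fun T : SpanningTree n => ∃ e ∈ S, e ∈ T.1.edgeSet)
    rw [Finset.card_univ] at this
    rw [← this, ha, hb]
    congr 2
    ext T
    simp
  have hm : treeMean (hits S) = b / Fintype.card (SpanningTree n) := by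
    unfold treeMean hits
    rw [Finset.sum_ite]
    simp [hb]
  rw [hm]
  have hn' : (0 : ℝ) < n := by exact_mod_cast hn
  rw [div_le_div_iff₀ (by positivity) hpos, ← hab]
  have h2 : (a : ℝ) * S.card ≤ n * b := by exact_mod_cast h1
  push_cast
  nlinarith

/-- One-step progress of a potential `Ψ` at `F`: there is a set `S` of edges each of which
decreases `Ψ` by at least `1 + n / |S|`, the mean waiting time for an edge of `S`; no such
decrease that is counted exceeds `B`. -/
def Progress {n : ℕ} (Ψ : SimpleGraph (Fin n) → ℝ) (B : ℝ) (F : SimpleGraph (Fin n)) : Prop :=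
  ∃ S : Finset (Sym2 (Fin n)), S.Nonempty ∧ (∀ e ∈ S, ¬ e.IsDiag) ∧
    1 + (n : ℝ) / S.card ≤ B ∧ ∀ e ∈ S, Ψ (addEdge F e) ≤ Ψ F - (1 + (n : ℝ) / S.card)

/-- If there is progress at `F`, the greedy strategy decreases the potential by `1` in the mean. -/
lemma Progress.drift {n : ℕ} (hn : 1 ≤ n) {Ψ : SimpleGraph (Fin n) → ℝ} (hΨ : Antitone Ψ) {B : ℝ}
    {F : SimpleGraph (Fin n)} (h : Progress Ψ B F) :
    treeMean (fun T => Ψ (addEdge F ((greedy Ψ).select F T))) + 1 ≤ Ψ F := by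
  obtain ⟨S, hS, hd, -, hdec⟩ := h
  have hc : (0 : ℝ) < S.card := by exact_mod_cast hS.card_pos
  have hn' : (0 : ℝ) < n := by exact_mod_cast hn
  have h1 : ∀ T, Ψ (addEdge F ((greedy Ψ).select F T)) ≤
      Ψ F - (1 + (n : ℝ) / S.card) * hits S T := by
    intro T
    unfold hits
    split_ifs with hT
    · obtain ⟨e, he, heT⟩ := hT
      rw [mul_one]
      exact (greedy_le Ψ F T heT).trans (hdec e he)
    · rw [mul_zero, sub_zero]
      exact greedy_le_self hΨ F T
  have h2 := treeMean_mono h1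
  rw [treeMean_sub, treeMean_const hn, treeMean_mul] at h2
  have h3 := le_treeMean_hits hn S hd
  have h4 : 1 ≤ (1 + (n : ℝ) / S.card) * treeMean (hits S) := by
    calc (1 : ℝ) = (1 + (n : ℝ) / S.card) * (S.card / (n + S.card)) := by field_simp; ring
      _ ≤ _ := by gcongr
  linarith

/-- Markov's inequality for the excess of the hitting time of `P` over the trivial lower bound
`L`: if the potential `Ψ` has drift `-1` outside `P`, then `Ψ` bounds the expected hitting time
from above, and the graphs in `P` have at least `L` edges. -/
lemma failProb_le_of_drift {n : ℕ} (hn : 1 ≤ n) (σ : Strategy n) {P : Set (SimpleGraph (Fin n))}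
    (hP : IsUpperSet P) {Ψ : SimpleGraph (Fin n) → ℝ} (h0 : ∀ F, 0 ≤ Ψ F) {L K : ℝ} (hK : 0 < K)
    (hL : ∀ F ∈ P, L ≤ F.edgeSet.ncard)
    (hdrift : ∀ F ∉ P, treeMean (fun T => Ψ (addEdge F (σ.select F T))) + 1 ≤ Ψ F) (s : ℕ) :
    ∀ F : SimpleGraph (Fin n), s ≤ K + (L - F.edgeSet.ncard) →
      failProb σ P s F ≤ (Ψ F - s + K) / K := by
  induction s with
  | zero =>
    intro F _
    have : 1 ≤ (Ψ F - (0 : ℕ) + K) / K := by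
      rw [le_div_iff₀ hK]; have := h0 F; push_cast; linarith
    unfold failProb
    split_ifs
    · linarith
    · exact this
  | succ s ih =>
    intro F hs
    by_cases hF : F ∈ P
    · rw [failProb_of_mem σ hP _ F hF]
      have := hL F hF
      have := h0 F
      apply div_nonneg _ hK.le
      linarith
    · have h1 : ∀ T, failProb σ P s (addEdge F (σ.select F T)) ≤
          (1 / K) * Ψ (addEdge F (σ.select F T)) + (K - s) / K := by
        intro T
        have hcard : ((addEdge F (σ.select F T)).edgeSet.ncard : ℝ) ≤ F.edgeSet.ncard + 1 := by
          exact_mod_cast ncard_edgeSet_addEdge_le F _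
        refine (ih _ ?_).trans (le_of_eq ?_)
        · push_cast at hs; linarith
        · field_simp; ring
      have h2 := treeMean_mono h1
      rw [treeMean_add, treeMean_mul, treeMean_const hn] at h2
      change treeMean (fun T => failProb σ P s (addEdge F (σ.select F T))) ≤ _
      refine h2.trans ?_
      have h3 := hdrift F hF
      rw [one_div, inv_mul_eq_div, ← add_div]
      refine div_le_div_of_nonneg_right ?_ hK.le
      push_cast
      linarith

/-- An exponential tail bound for the hitting time of `P`: a decrease by `D ≤ B` that occurs with
probability at least `1 / D` multiplies `exp (Ψ / B)` by at most `1 - 1 / (2 B)` in the mean. -/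
lemma failProb_le_of_progress {n : ℕ} (hn : 1 ≤ n) {P : Set (SimpleGraph (Fin n))}
    {Ψ : SimpleGraph (Fin n) → ℝ} (hΨ : Antitone Ψ) (hP : IsUpperSet P) (h0 : ∀ F, 0 ≤ Ψ F)
    {B : ℝ} (hB : 0 < B) (hprog : ∀ F ∉ P, Progress Ψ B F) (s : ℕ) :
    ∀ F, failProb (greedy Ψ) P s F ≤ Real.exp ((Ψ F - s / 2) / B) := by
  induction s with
  | zero =>
    intro F
    have : 1 ≤ Real.exp ((Ψ F - (0 : ℕ) / 2) / B) := by
      apply Real.one_le_exp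
      have := h0 F
      simp only [Nat.cast_zero, zero_div, sub_zero]
      positivity
    unfold failProb
    split_ifs
    · linarith
    · exact this
  | succ s ih =>
    intro F
    by_cases hF : F ∈ P
    · rw [failProb_of_mem _ hP _ F hF]
      exact (Real.exp_pos _).le
    obtain ⟨S, hS, hd, hDB, hdec⟩ := hprog F hF
    have hc : (0 : ℝ) < S.card := by exact_mod_cast hS.card_pos
    have hn' : (0 : ℝ) < n := by exact_mod_cast hn
    set D := 1 + (n : ℝ) / S.card with hD
    have hD1 : 1 ≤ D := by rw [hD]; have : 0 ≤ (n : ℝ) / S.card := by positivity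
                           linarith
    set E := Real.exp ((Ψ F - s / 2) / B) with hE
    have hEpos : 0 < E := Real.exp_pos _
    have h1 : ∀ T, failProb (greedy Ψ) P s (addEdge F ((greedy Ψ).select F T)) ≤
        E - E * (1 - Real.exp (-(D / B))) * hits S T := by
      intro T
      refine (ih _).trans ?_
      unfold hits
      split_ifs with hT
      · obtain ⟨e, he, heT⟩ := hT
        have := (greedy_le Ψ F T heT).trans (hdec e he)
        have h2 : E - E * (1 - Real.exp (-(D / B))) * 1 = Real.exp ((Ψ F - D - s / 2) / B) := by
          rw [hE, show (Ψ F - D - s / 2) / B = (Ψ F - s / 2) / B + -(D / B) by ring, Real.exp_add]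
          ring
        rw [h2]
        gcongr
      · rw [mul_zero, sub_zero, hE]
        gcongr
        exact greedy_le_self hΨ F T
    have h2 := treeMean_mono h1
    rw [treeMean_sub, treeMean_const hn, treeMean_mul] at h2
    change treeMean (fun T => failProb (greedy Ψ) P s (addEdge F ((greedy Ψ).select F T))) ≤ _
    have h3 : 1 / D ≤ treeMean (hits S) := by
      refine le_trans (le_of_eq ?_) (le_treeMean_hits hn S hd)
      rw [hD]; field_simp; ring
    -- `1 - exp (-x) ≥ x / 2` for `0 ≤ x ≤ 1`
    have h4 : D / B / 2 ≤ 1 - Real.exp (-(D / B)) := by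
      have hx0 : 0 ≤ D / B := by positivity
      have hx1 : D / B ≤ 1 := by rw [div_le_one hB]; exact hDB
      have h5 : 1 + D / B ≤ Real.exp (D / B) := by linarith [Real.add_one_le_exp (D / B)]
      have h6 : Real.exp (-(D / B)) ≤ 1 / (1 + D / B) := by
        rw [Real.exp_neg, ← one_div]
        exact one_div_le_one_div_of_le (by positivity) h5
      have h7 : 1 / (1 + D / B) ≤ 1 - D / B / 2 := by
        rw [div_le_iff₀ (by positivity)]; nlinarith
      linarith
    have h5 : 1 / B / 2 ≤ (1 - Real.exp (-(D / B))) * treeMean (hits S) := by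
      calc 1 / B / 2 = D / B / 2 * (1 / D) := by field_simp
        _ ≤ _ := mul_le_mul h4 h3 (by positivity) (le_trans (by positivity) h4)
    have h6 : Real.exp ((Ψ F - (s + 1 : ℕ) / 2) / B) = E * Real.exp (-(1 / B / 2)) := by
      rw [hE, ← Real.exp_add]; congr 1; push_cast; ring
    rw [h6]
    have h7 : 1 - 1 / B / 2 ≤ Real.exp (-(1 / B / 2)) := by
      linarith [Real.add_one_le_exp (-(1 / B / 2))]
    calc _ ≤ E - E * (1 - Real.exp (-(D / B))) * treeMean (hits S) := h2
      _ = E * (1 - (1 - Real.exp (-(D / B))) * treeMean (hits S)) := by ring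
      _ ≤ E * (1 - 1 / B / 2) := by gcongr
      _ ≤ _ := by gcongr

/-! ### The cost of a perfect matching -/

/-- The number of edges that are collected at an unmatched vertex before an augmentation,
of order `√n`. -/
def collectNum (n : ℕ) : ℕ := Nat.sqrt n + 1

/-- The defect, of order `n ^ (1/4)`, below which a matching is completed by augmentations. -/
def smallDefect (n : ℕ) : ℕ := Nat.sqrt (Nat.sqrt n) + 1

/-- An upper bound for the expected number of rounds in which the defect of a bipartite matching
decreases from `a` to `a - 1`. If the defect is large, the rounds pass in waiting for one of the
`a ^ 2` edges between unmatched vertices. Otherwise `collectNum n` edges are collected, from at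
least `N / 2` candidates each, before one of `collectNum n` augmenting edges is awaited. -/
noncomputable def stepCost (n N a : ℕ) : ℝ :=
  if smallDefect n ≤ a then 1 + n / (a : ℝ) ^ 2
  else 1 + (n : ℝ) / collectNum n + collectNum n * (1 + 2 * n / N)

/-- An upper bound for the expected number of rounds in which a bipartite matching of defect `a`
is completed. -/
noncomputable def defectCost (n N a : ℕ) : ℝ := ∑ i ∈ Finset.range a, stepCost n N (i + 1)

/-- The relation `R` contains a matching of size `N - a`, given by a permutation `π` of which the
values on the set `D` are disregarded. If `j > 0`, moreover, the defect is small and an unmatched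
vertex `u` is adjacent to the partners of `j` matched vertices. -/
def Supports (n : ℕ) {N : ℕ} (R : Fin N → Fin N → Prop) (a j : ℕ) : Prop :=
  ∃ (π : Equiv.Perm (Fin N)) (D : Finset (Fin N)), D.card = a ∧ (∀ x ∉ D, R x (π x)) ∧
    (j = 0 ∨ (a < smallDefect n ∧ j ≤ collectNum n ∧
      ∃ u ∈ D, ∃ X : Finset (Fin N), X.card = j ∧ Disjoint X D ∧ ∀ x ∈ X, R u (π x)))

/-- The potential of the bipartite graph `R`: the least cost of a partial matching in `R`,
counting the edges collected for the next augmentation. -/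
noncomputable def matchCost (n : ℕ) {N : ℕ} (R : Fin N → Fin N → Prop) : ℝ :=
  sInf ((fun p : ℕ × ℕ => defectCost n N p.1 - p.2 * (1 + 2 * (n : ℝ) / N)) ''
    {p | Supports n R p.1 p.2})

lemma Supports.le {n N : ℕ} {R : Fin N → Fin N → Prop} {a j : ℕ} (h : Supports n R a j) :
    a ≤ N ∧ j ≤ collectNum n := by
  obtain ⟨π, D, hD, -, hj⟩ := h
  constructor
  · rw [← hD]; simpa using D.card_le_univ
  · rcases hj with rfl | ⟨_, h, _⟩
    · exact Nat.zero_le _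
    · exact h

lemma Supports.mono {n N : ℕ} {R R' : Fin N → Fin N → Prop} (hR : ∀ x y, R x y → R' x y)
    {a j : ℕ} (h : Supports n R a j) : Supports n R' a j := by
  obtain ⟨π, D, hD, hm, hj⟩ := h
  refine ⟨π, D, hD, fun x hx => hR _ _ (hm x hx), ?_⟩
  rcases hj with h | ⟨h1, h2, u, hu, X, hX, hd, hux⟩
  · exact Or.inl h
  · exact Or.inr ⟨h1, h2, u, hu, X, hX, hd, fun x hx => hR _ _ (hux x hx)⟩

lemma supports_finite {n N : ℕ} (R : Fin N → Fin N → Prop) :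
    {p : ℕ × ℕ | Supports n R p.1 p.2}.Finite := by
  refine ((Finset.range (N + 1) ×ˢ Finset.range (collectNum n + 1)).finite_toSet).subset ?_
  rintro ⟨a, j⟩ h
  have := Supports.le h
  simp only [Finset.coe_product, Finset.coe_range, Set.mem_prod, Set.mem_Iio]
  omega

lemma supports_self (n : ℕ) {N : ℕ} (R : Fin N → Fin N → Prop) : Supports n R N 0 :=
  ⟨1, Finset.univ, by simp, by simp, Or.inl rfl⟩

lemma matchCost_mem (n : ℕ) {N : ℕ} (R : Fin N → Fin N → Prop) :
    ∃ a j, Supports n R a j ∧ matchCost n R = defectCost n N a - j * (1 + 2 * (n : ℝ) / N) := by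
  have h : ((fun p : ℕ × ℕ => defectCost n N p.1 - p.2 * (1 + 2 * (n : ℝ) / N)) ''
      {p | Supports n R p.1 p.2}).Nonempty := ⟨_, (N, 0), supports_self n R, rfl⟩
  obtain ⟨⟨a, j⟩, hs, he⟩ := h.csInf_mem ((supports_finite R).image _)
  exact ⟨a, j, hs, he.symm⟩

lemma matchCost_le {n N : ℕ} {R : Fin N → Fin N → Prop} {a j : ℕ} (h : Supports n R a j) :
    matchCost n R ≤ defectCost n N a - j * (1 + 2 * (n : ℝ) / N) :=
  csInf_le ((supports_finite R).image _).bddBelow ⟨(a, j), h, rfl⟩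

lemma matchCost_anti {n N : ℕ} {R R' : Fin N → Fin N → Prop} (hR : ∀ x y, R x y → R' x y) :
    matchCost n R' ≤ matchCost n R := by
  obtain ⟨a, j, hs, he⟩ := matchCost_mem n R
  rw [he]
  exact matchCost_le (hs.mono hR)

lemma stepCost_nonneg (n N a : ℕ) : 0 ≤ stepCost n N a := by
  unfold stepCost; split_ifs <;> positivity

lemma defectCost_succ (n N a : ℕ) :
    defectCost n N (a + 1) = defectCost n N a + stepCost n N (a + 1) :=
  Finset.sum_range_succ _ _

lemma defectCost_nonneg (n N a : ℕ) : 0 ≤ defectCost n N a :=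
  Finset.sum_nonneg fun _ _ => stepCost_nonneg _ _ _

lemma matchCost_nonneg (n : ℕ) {N : ℕ} (R : Fin N → Fin N → Prop) : 0 ≤ matchCost n R := by
  obtain ⟨a, j, hs, he⟩ := matchCost_mem n R
  rw [he]
  obtain ⟨π, D, hD, -, rfl | ⟨ha, hj, u, hu, -⟩⟩ := hs
  · simpa using defectCost_nonneg n N a
  · have hpos : 0 < a := by rw [← hD]; exact Finset.card_pos.2 ⟨u, hu⟩
    obtain ⟨b, rfl⟩ : ∃ b, a = b + 1 := ⟨a - 1, by omega⟩
    rw [defectCost_succ]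
    have h1 := defectCost_nonneg n N b
    have h2 : (j : ℝ) * (1 + 2 * (n : ℝ) / N) ≤ collectNum n * (1 + 2 * (n : ℝ) / N) := by
      gcongr
    have h3 : (0 : ℝ) ≤ (n : ℝ) / collectNum n := by positivity
    -- the collected edges are worth less than the step that they prepare
    unfold stepCost
    rw [if_neg (by omega)]
    linarith

lemma lt_collectNum_sq (n : ℕ) : n < collectNum n ^ 2 := by
  unfold collectNum; have := Nat.lt_succ_sqrt n; rw [pow_two]; exact this

lemma collectNum_le_smallDefect_sq (n : ℕ) : collectNum n ≤ smallDefect n ^ 2 := by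
  unfold collectNum smallDefect
  have := Nat.lt_succ_sqrt (Nat.sqrt n); rw [pow_two]; exact this

/-- The relation that results from `R` by adding the pair `p`. -/
def addPair {N : ℕ} (R : Fin N → Fin N → Prop) (p : Fin N × Fin N) (x y : Fin N) : Prop :=
  R x y ∨ (x = p.1 ∧ y = p.2)

open Classical in
/-- Joining an unmatched point `i` on the left to the point `π j` on the right, which is unmatched
as `j ∈ D`, decreases the defect by one. -/
lemma exists_perm_of_addPair {N : ℕ} {R : Fin N → Fin N → Prop} {π : Equiv.Perm (Fin N)}
    {D : Finset (Fin N)} (hm : ∀ x ∉ D, R x (π x)) {i j : Fin N} (hi : i ∈ D) (hj : j ∈ D) :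
    ∃ (π' : Equiv.Perm (Fin N)) (D' : Finset (Fin N)), D'.card + 1 = D.card ∧
      ∀ x ∉ D', addPair R (i, π j) x (π' x) := by
  refine ⟨(Equiv.swap i j).trans π, D.erase i,
    Finset.card_erase_add_one hi, ?_⟩
  intro x hx
  rw [Finset.mem_erase, not_and_or, not_not] at hx
  by_cases hxi : x = i
  · right; subst hxi; simp
  · have hxD : x ∉ D := by tauto
    have hxj : x ≠ j := by rintro rfl; exact hxD hj
    left
    simp only [Equiv.trans_apply, Equiv.swap_apply_of_ne_of_ne hxi hxj]
    exact hm x hxD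

open Classical in
/-- Unless `R` contains a perfect matching, there are many pairs each of which decreases the
potential by at least `1` plus the mean waiting time for one of these pairs. -/
lemma matchCost_progress {n N : ℕ} (hN : 2 * (smallDefect n + collectNum n) ≤ N)
    {R : Fin N → Fin N → Prop} (hR : ¬ ∃ π : Equiv.Perm (Fin N), ∀ x, R x (π x)) :
    ∃ S : Finset (Fin N × Fin N), S.Nonempty ∧ 1 + (n : ℝ) / S.card ≤ 1 + collectNum n ∧
      ∀ p ∈ S, matchCost n (addPair R p) ≤ matchCost n R - (1 + (n : ℝ) / S.card) := by
  have hc : 0 < collectNum n := Nat.succ_pos _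
  have hNpos : 0 < N := by omega
  -- a set of at least `collectNum n` pairs is large enough for the bound on the decrease
  have hbound : ∀ S : Finset (Fin N × Fin N), collectNum n ≤ S.card →
      S.Nonempty ∧ 1 + (n : ℝ) / S.card ≤ 1 + collectNum n := by
    intro S hS
    refine ⟨Finset.card_pos.1 (by omega), ?_⟩
    have h1 : (collectNum n : ℝ) ≤ S.card := by exact_mod_cast hS
    have h2 : (n : ℝ) < collectNum n ^ 2 := by exact_mod_cast lt_collectNum_sq n
    have h3 : (0 : ℝ) < collectNum n := by exact_mod_cast hc
    rw [add_le_add_iff_left, div_le_iff₀ (by linarith)]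
    nlinarith
  obtain ⟨a, j, hs, he⟩ := matchCost_mem n R
  obtain ⟨π, D, hD, hm, hj⟩ := hs
  have ha : 0 < a := by
    rw [Nat.pos_iff_ne_zero]
    rintro rfl
    rw [Finset.card_eq_zero] at hD
    subst hD
    exact hR ⟨π, fun x => hm x (Finset.notMem_empty x)⟩
  obtain ⟨b, rfl⟩ : ∃ b, a = b + 1 := ⟨a - 1, by omega⟩
  by_cases hbig : smallDefect n ≤ b + 1
  · -- large defect: join an unmatched vertex on the left to one on the right
    have hj0 : j = 0 := by rcases hj with h | ⟨h, -⟩ <;> omega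
    subst hj0
    have hcard : (D ×ˢ D.map π.toEmbedding).card = (b + 1) ^ 2 := by
      rw [Finset.card_product, Finset.card_map, hD, pow_two]
    have hle : collectNum n ≤ (D ×ˢ D.map π.toEmbedding).card := by
      rw [hcard]
      exact (collectNum_le_smallDefect_sq n).trans (Nat.pow_le_pow_left hbig 2)
    refine ⟨D ×ˢ D.map π.toEmbedding, (hbound _ hle).1, (hbound _ hle).2, ?_⟩
    rintro ⟨i, y⟩ hp
    simp only [Finset.mem_product, Finset.mem_map, Equiv.coe_toEmbedding] at hp
    obtain ⟨hi, k, hk, rfl⟩ := hp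
    obtain ⟨π', D', hD', hm'⟩ := exists_perm_of_addPair hm hi hk
    have hs' : Supports n (addPair R (i, π k)) b 0 := ⟨π', D', by omega, hm', Or.inl rfl⟩
    refine (matchCost_le hs').trans ?_
    rw [he, defectCost_succ, stepCost, if_pos hbig, hcard]
    push_cast
    linarith
  · by_cases hjc : j < collectNum n
    · -- collect one more edge at the unmatched vertex
      obtain ⟨u, hu, X, hX, hdis, hux⟩ : ∃ u ∈ D, ∃ X : Finset (Fin N),
          X.card = j ∧ Disjoint X D ∧ ∀ x ∈ X, R u (π x) := by
        rcases hj with rfl | ⟨-, -, h⟩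
        · obtain ⟨u, hu⟩ := Finset.card_pos.1 (by omega : 0 < D.card)
          exact ⟨u, hu, ∅, rfl, Finset.disjoint_empty_left _, by simp⟩
        · exact h
      set Y := Finset.univ \ (D ∪ X) with hY
      have hYcard : N ≤ 2 * Y.card ∧ collectNum n ≤ Y.card := by
        have h1 : (D ∪ X).card ≤ (b + 1) + j := by
          rw [← hD, ← hX]; exact Finset.card_union_le _ _
        have h2 := Finset.le_card_sdiff (D ∪ X) (Finset.univ : Finset (Fin N))
        rw [Finset.card_univ, Fintype.card_fin, ← hY] at h2
        omega
      have hinj : (Y.map (π.toEmbedding.trans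
          ⟨fun y => (u, y), fun y y' h => (Prod.ext_iff.1 h).2⟩)).card = Y.card :=
        Finset.card_map _
      refine ⟨Y.map (π.toEmbedding.trans
        ⟨fun y => (u, y), fun y y' h => (Prod.ext_iff.1 h).2⟩), ?_⟩
      obtain ⟨hne, hB⟩ := hbound (Y.map (π.toEmbedding.trans
          ⟨fun y => (u, y), fun y y' h => (Prod.ext_iff.1 h).2⟩)) (by rw [hinj]; exact hYcard.2)
      refine ⟨hne, hB, ?_⟩
      intro p hp
      simp only [Finset.mem_map, Function.Embedding.trans_apply,
        Function.Embedding.coeFn_mk] at hp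
      obtain ⟨x, hx, rfl⟩ := hp
      have hx' : x ∉ D ∧ x ∉ X := by simpa [hY] using hx
      have hs' : Supports n (addPair R (u, π x)) (b + 1) (j + 1) := by
        refine ⟨π, D, hD, fun z hz => Or.inl (hm z hz), Or.inr ⟨by omega, by omega, u, hu,
          insert x X, ?_, ?_, ?_⟩⟩
        · rw [Finset.card_insert_of_notMem hx'.2, hX]
        · rw [Finset.disjoint_insert_left]; exact ⟨hx'.1, hdis⟩
        · intro z hz
          rcases Finset.mem_insert.1 hz with rfl | hz
          · exact Or.inr ⟨rfl, rfl⟩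
          · exact Or.inl (hux z hz)
      refine (matchCost_le hs').trans ?_
      rw [he, hinj]
      have h1 : (n : ℝ) / Y.card ≤ 2 * n / N := by
        have hN' : (0 : ℝ) < N := by exact_mod_cast hNpos
        have hYp : (0 : ℝ) < Y.card := by exact_mod_cast (by omega : 0 < Y.card)
        have h2 : (N : ℝ) ≤ 2 * Y.card := by exact_mod_cast hYcard.1
        rw [div_le_div_iff₀ hYp hN']
        have h3 : (0 : ℝ) ≤ n := Nat.cast_nonneg _
        nlinarith
      push_cast
      linarith
    · -- enough edges are collected: augment along a path with three edges
      rcases hj with rfl | ⟨-, hj2, u, hu, X, hX, hdis, hux⟩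
      · omega
      have hjeq : j = collectNum n := by omega
      have hinj : (X.map ⟨fun x => (x, π u), fun y y' h => (Prod.ext_iff.1 h).1⟩ :
          Finset (Fin N × Fin N)).card = collectNum n := by
        rw [Finset.card_map, hX, hjeq]
      refine ⟨X.map ⟨fun x => (x, π u), fun y y' h => (Prod.ext_iff.1 h).1⟩, (hbound _ hinj.ge).1,
        (hbound _ hinj.ge).2, ?_⟩
      intro p hp
      simp only [Finset.mem_map] at hp
      obtain ⟨x, hx, rfl⟩ := hp
      have hxD : x ∉ D := Finset.disjoint_left.1 hdis hx
      have hxu : x ≠ u := by rintro rfl; exact hxD hu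
      have hs' : Supports n (addPair R (x, π u)) b 0 := by
        refine ⟨(Equiv.swap u x).trans π, D.erase u, ?_, ?_, Or.inl rfl⟩
        · rw [Finset.card_erase_of_mem hu]; omega
        · intro z hz
          rw [Finset.mem_erase, not_and_or, not_not] at hz
          by_cases hzu : z = u
          · left; subst hzu; simpa using hux x hx
          · by_cases hzx : z = x
            · right; subst hzx; simp
            · left
              simp only [Equiv.trans_apply, Equiv.swap_apply_of_ne_of_ne hzu hzx]
              exact hm z (by tauto)
      refine (matchCost_le hs').trans ?_
      rw [he, hinj, defectCost_succ, stepCost, if_neg hbig, hjeq]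
      push_cast
      linarith

/-- A bound for the expected number of rounds wasted in the construction of a perfect matching. -/
noncomputable def waste (n N : ℕ) : ℝ :=
  2 * n / smallDefect n +
    smallDefect n * ((n : ℝ) / collectNum n + collectNum n * (1 + 2 * n / N))

lemma waste_nonneg (n N : ℕ) : 0 ≤ waste n N := by unfold waste; positivity

lemma defectCost_le (n N a : ℕ) : defectCost n N a ≤ a + waste n N := by
  set E := (n : ℝ) / collectNum n + collectNum n * (1 + 2 * n / N) with hE
  have hE0 : 0 ≤ E := by positivity
  have ha0 : 0 < smallDefect n := Nat.succ_pos _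
  have h1 : ∀ a, a < smallDefect n → defectCost n N a ≤ a * (1 + E) := by
    intro a
    induction a with
    | zero => intro _; simp [defectCost]
    | succ a ih =>
      intro h
      rw [defectCost_succ, stepCost, if_neg (by omega)]
      have := ih (by omega)
      push_cast
      linarith
  have h2 : ∀ k : ℕ, defectCost n N (smallDefect n - 1 + k) ≤ ((smallDefect n - 1 + k : ℕ) : ℝ) +
      (smallDefect n : ℝ) * E + 2 * n * (1 / smallDefect n - 1 / (smallDefect n + k)) := by
    intro k
    induction k with
    | zero =>
      have := h1 (smallDefect n - 1) (by omega)
      have h3 : ((smallDefect n - 1 : ℕ) : ℝ) ≤ smallDefect n := by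
        exact_mod_cast Nat.sub_le _ _
      have h4 : ((smallDefect n - 1 : ℕ) : ℝ) * E ≤ smallDefect n * E := by gcongr
      simp only [add_zero, Nat.cast_zero, sub_self, mul_zero]
      linarith
    | succ k ih =>
      rw [← add_assoc, defectCost_succ, stepCost, if_pos (by omega),
        show smallDefect n - 1 + k + 1 = smallDefect n + k by omega]
      have hp : (0 : ℝ) < smallDefect n := by exact_mod_cast ha0
      have h3 : ((smallDefect n + k : ℕ) : ℝ) = ((smallDefect n - 1 + k : ℕ) : ℝ) + 1 := by
        rw [show smallDefect n + k = (smallDefect n - 1 + k) + 1 by omega]; push_cast; rfl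
      -- `1 / x² ≤ 2 (1 / x - 1 / (x + 1))` for `x ≥ 1`
      have h4 : (n : ℝ) / ((smallDefect n + k : ℕ) : ℝ) ^ 2 ≤
          2 * n * (1 / (smallDefect n + k) - 1 / (smallDefect n + (k + 1 : ℕ))) := by
        push_cast
        set x : ℝ := smallDefect n + k with hx
        have hx1 : 1 ≤ x := by
          have : (1 : ℝ) ≤ smallDefect n := by exact_mod_cast ha0
          have : (0 : ℝ) ≤ k := Nat.cast_nonneg k
          linarith
        rw [← add_assoc, ← hx, show 1 / x - 1 / (x + 1) = 1 / (x * (x + 1)) by field_simp; ring,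
          mul_one_div, div_le_div_iff₀ (by positivity) (by positivity)]
        have : (0 : ℝ) ≤ n := Nat.cast_nonneg n
        have h5 : x * (x + 1) ≤ 2 * x ^ 2 := by nlinarith
        nlinarith
      linarith
  by_cases h : a < smallDefect n
  · have := h1 a h
    have h3 : (a : ℝ) * E ≤ smallDefect n * E := by gcongr
    have h4 : 0 ≤ 2 * (n : ℝ) / smallDefect n := by positivity
    unfold waste
    linarith
  · have := h2 (a - (smallDefect n - 1))
    rw [show smallDefect n - 1 + (a - (smallDefect n - 1)) = a by omega] at this
    have h3 : 0 ≤ 2 * (n : ℝ) * (1 / (smallDefect n + (a - (smallDefect n - 1) : ℕ))) := by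
      positivity
    have h4 : 2 * (n : ℝ) / smallDefect n = 2 * n * (1 / smallDefect n) := by ring
    unfold waste
    rw [h4]
    linarith

/-- A matching of defect `|D|` costs at most `|D|` useful rounds and the waste. -/
lemma matchCost_le_of_card (n : ℕ) {N : ℕ} {R : Fin N → Fin N → Prop} (π : Equiv.Perm (Fin N))
    (D : Finset (Fin N)) (h : ∀ x ∉ D, R x (π x)) : matchCost n R ≤ D.card + waste n N := by
  have hs : Supports n R D.card 0 := ⟨π, D, rfl, h, Or.inl rfl⟩
  have := matchCost_le hs
  have h2 := defectCost_le n N D.card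
  push_cast at this
  linarith

/-- The waste is of order `n ^ (3/4)` if the classes have linear size. -/
lemma waste_le {n N : ℕ} {c : ℝ} (hn : 1 ≤ n) (hN : 0 < N) (hc : (n : ℝ) ≤ c * N) :
    waste n N ≤ (8 + 8 * c) * (n : ℝ) ^ (3 / 4 : ℝ) := by
  set x : ℝ := (n : ℝ) ^ (1 / 4 : ℝ) with hx
  have hn0 : (0 : ℝ) ≤ n := Nat.cast_nonneg n
  have hx4 : x ^ 4 = n := by
    rw [hx, ← Real.rpow_natCast, ← Real.rpow_mul hn0]; norm_num
  have hx3 : (n : ℝ) ^ (3 / 4 : ℝ) = x ^ 3 := by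
    rw [hx, ← Real.rpow_natCast, ← Real.rpow_mul hn0]; norm_num
  have hx0 : 0 ≤ x := Real.rpow_nonneg hn0 _
  have hx1 : 1 ≤ x := Real.one_le_rpow (by exact_mod_cast hn) (by norm_num)
  have hc0 : 0 ≤ c := by
    by_contra hneg
    have h1 : (0 : ℝ) < N := by exact_mod_cast hN
    have h2 : (1 : ℝ) ≤ n := by exact_mod_cast hn
    nlinarith
  have hsq : ((Nat.sqrt n : ℕ) : ℝ) ≤ x ^ 2 := by
    rw [← pow_le_pow_iff_left₀ (Nat.cast_nonneg _) (by positivity) two_ne_zero, ← pow_mul, hx4]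
    exact_mod_cast Nat.sqrt_le' n
  have hsq2 : ((Nat.sqrt (Nat.sqrt n) : ℕ) : ℝ) ≤ x := by
    rw [← pow_le_pow_iff_left₀ (Nat.cast_nonneg _) hx0 two_ne_zero]
    refine le_trans ?_ hsq
    exact_mod_cast Nat.sqrt_le' (Nat.sqrt n)
  have hm1 : x ^ 2 ≤ collectNum n := by
    rw [← pow_le_pow_iff_left₀ (by positivity) (Nat.cast_nonneg _) two_ne_zero, ← pow_mul, hx4]
    exact_mod_cast (lt_collectNum_sq n).le
  have ha1 : x ≤ smallDefect n := by
    rw [← pow_le_pow_iff_left₀ hx0 (Nat.cast_nonneg _) two_ne_zero]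
    refine hm1.trans ?_
    exact_mod_cast collectNum_le_smallDefect_sq n
  have hm2 : (collectNum n : ℝ) ≤ 2 * x ^ 2 := by
    unfold collectNum
    push_cast
    nlinarith
  have ha2 : (smallDefect n : ℝ) ≤ 2 * x := by
    unfold smallDefect
    push_cast
    linarith
  have hN' : (0 : ℝ) < N := by exact_mod_cast hN
  have h1 : 2 * (n : ℝ) / smallDefect n ≤ 2 * x ^ 3 := by
    rw [div_le_iff₀ (by linarith), ← hx4]
    have : 0 ≤ x ^ 3 := by positivity
    nlinarith
  have h2 : (n : ℝ) / collectNum n ≤ x ^ 2 := by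
    have : 0 < x ^ 2 := by positivity
    rw [div_le_iff₀ (by linarith), ← hx4]
    nlinarith
  have h3 : 2 * (n : ℝ) / N ≤ 2 * c := by
    rw [div_le_iff₀ hN']; linarith
  rw [hx3]
  unfold waste
  calc _ ≤ 2 * x ^ 3 + 2 * x * (x ^ 2 + 2 * x ^ 2 * (1 + 2 * c)) := by gcongr
    _ = (8 + 8 * c) * x ^ 3 := by ring

/-! ### Composition of matchings along bridges, and the trivial lower bound -/

/-- Along bridges, matchings can be composed consistently: if every edge of `H` outside a set of
bridges admits the trivial voltage, and every edge of the set admits some voltage, then there is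
a potential whose differences are admissible voltages. -/
lemma exists_potential_of_isBridge {V G : Type*} [Group G] (A : V → V → Set G)
    (hA : ∀ u w, ∀ g ∈ A u w, g⁻¹ ∈ A w u) (Br : Finset (Sym2 V)) :
    ∀ H : SimpleGraph V, (∀ e ∈ Br, H.IsBridge e) →
      (∀ u w, H.Adj u w → s(u, w) ∉ Br → 1 ∈ A u w) →
      (∀ u w, H.Adj u w → s(u, w) ∈ Br → (A u w).Nonempty) →
      ∃ ρ : V → G, ∀ u w, H.Adj u w → ρ w * (ρ u)⁻¹ ∈ A u w := by
  classical
  induction Br using Finset.induction_on with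
  | empty =>
    intro H _ h1 _
    exact ⟨fun _ => 1, fun u w h => by simpa using h1 u w h (Finset.notMem_empty _)⟩
  | insert e Br he ih =>
    intro H hbr h1 h2
    induction e using Sym2.ind with
    | _ u₀ w₀ =>
    set H' := H.deleteEdges {s(u₀, w₀)} with hH'
    have hle : H' ≤ H := SimpleGraph.deleteEdges_le _
    have hadj : ∀ u w, H'.Adj u w ↔ H.Adj u w ∧ s(u, w) ≠ s(u₀, w₀) := by
      intro u w; rw [hH', SimpleGraph.deleteEdges_adj]; simp
    obtain ⟨ρ, hρ⟩ := ih H' (fun e he' => (hbr e (Finset.mem_insert_of_mem he')).anti hle)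
      (fun u w h hn => h1 u w (hle h) (by
        rw [Finset.mem_insert, not_or]; exact ⟨((hadj u w).1 h).2, hn⟩))
      (fun u w h hn => h2 u w (hle h) (Finset.mem_insert_of_mem hn))
    by_cases hH : H.Adj u₀ w₀
    swap
    · refine ⟨ρ, fun u w h => hρ u w ((hadj u w).2 ⟨h, fun heq => hH ?_⟩)⟩
      rw [← SimpleGraph.mem_edgeSet, ← heq]; exact h
    obtain ⟨g, hg⟩ := h2 u₀ w₀ hH (Finset.mem_insert_self _ _)
    have hnr : ¬ H'.Reachable w₀ u₀ := fun h =>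
      SimpleGraph.isBridge_iff.1 (hbr _ (Finset.mem_insert_self _ _)) h.symm
    -- the potential is changed by a right multiplication on the side of `w₀`
    let ρ' : V → G := fun x => if H'.Reachable w₀ x then ρ x * ((ρ w₀)⁻¹ * g * ρ u₀) else ρ x
    have hu : ρ' u₀ = ρ u₀ := if_neg hnr
    have hw : ρ' w₀ = g * ρ u₀ := by
      simp only [ρ']
      rw [if_pos (SimpleGraph.Reachable.refl _)]
      group
    have hgw : ρ' w₀ * (ρ' u₀)⁻¹ = g := by rw [hu, hw]; group
    refine ⟨ρ', fun u w h => ?_⟩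
    by_cases heq : s(u, w) = s(u₀, w₀)
    · rcases Sym2.eq_iff.1 heq with ⟨rfl, rfl⟩ | ⟨rfl, rfl⟩
      · rw [hgw]; exact hg
      · have := hA _ _ _ hg
        rw [← hgw] at this
        simpa using this
    · have h' := (hadj u w).2 ⟨h, heq⟩
      have hiff : H'.Reachable w₀ u ↔ H'.Reachable w₀ w :=
        ⟨fun h3 => h3.trans h'.reachable, fun h3 => h3.trans h'.symm.reachable⟩
      have hval := hρ u w h'
      simp only [ρ']
      by_cases hr : H'.Reachable w₀ u
      · rw [if_pos hr, if_pos (hiff.1 hr)]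
        convert hval using 1
        group
      · rw [if_neg hr, if_neg (fun h3 => hr (hiff.2 h3))]
        exact hval

/-- The vertex classes `φ (u, ·)`, for `u ∈ V`, contain a factor as soon as all edges of `H`
outside a set `Br` of bridges are realized within equal indices, and all edges in `Br` by perfect
matchings. -/
lemma mem_containsFactor {V : Type*} [Fintype V] {H : SimpleGraph V} {Br : Finset (Sym2 V)}
    (hBr : ∀ e ∈ Br, H.IsBridge e) {n : ℕ} {F : SimpleGraph (Fin n)}
    {φ : V × Fin (n / Fintype.card V) → Fin n} (hφ : Function.Injective φ)
    (h1 : ∀ u w x, H.Adj u w → s(u, w) ∉ Br → F.Adj (φ (u, x)) (φ (w, x)))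
    (h2 : ∀ u w, H.Adj u w → s(u, w) ∈ Br → ∃ π : Equiv.Perm (Fin (n / Fintype.card V)),
      ∀ x, F.Adj (φ (u, x)) (φ (w, π x))) :
    F ∈ containsFactor H n := by
  obtain ⟨ρ, hρ⟩ := exists_potential_of_isBridge
    (A := fun u w => {π : Equiv.Perm (Fin (n / Fintype.card V)) |
      ∀ x, F.Adj (φ (u, x)) (φ (w, π x))})
    (by
      intro u w π hπ x
      have := hπ (π⁻¹ x)
      rw [show π (π⁻¹ x) = x from π.apply_symm_apply x] at this
      exact this.symm) Br H hBr
    (fun u w h hn x => h1 u w x h hn) (fun u w h hn => h2 u w h hn)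
  refine ⟨fun b => ⟨⟨fun u => φ (u, ρ u b), ?_⟩, ?_⟩, ?_⟩
  · intro u w h
    have := hρ u w h (ρ u b)
    simpa using this
  · intro u w h
    exact (Prod.ext_iff.1 (hφ h)).1
  · intro b b' hbb
    rw [Set.disjoint_left]
    rintro _ ⟨u, rfl⟩ ⟨w, hw⟩
    have h := Prod.ext_iff.1 (hφ (hw : φ (w, ρ w b') = φ (u, ρ u b)))
    have h3 : w = u := h.1
    subst h3
    exact hbb ((ρ w).injective h.2.symm)

lemma isUpperSet_containsFactor {V : Type*} [Fintype V] (H : SimpleGraph V) (n : ℕ) :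
    IsUpperSet (containsFactor H n) := by
  rintro F F' hF ⟨f, hf⟩
  refine ⟨fun b => ⟨(SimpleGraph.Hom.ofLE hF).comp (f b).toHom, (f b).injective⟩, hf⟩

/-- A graph with an `H`-factor has at least as many edges as the copies of `H` together. -/
lemma le_ncard_edgeSet_of_mem_containsFactor {V : Type*} [Fintype V] {H : SimpleGraph V} {n : ℕ}
    {F : SimpleGraph (Fin n)} (hF : F ∈ containsFactor H n) :
    n / Fintype.card V * H.edgeSet.ncard ≤ F.edgeSet.ncard := by
  obtain ⟨f, hf⟩ := hF
  let g : Fin (n / Fintype.card V) × H.edgeSet → F.edgeSet :=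
    fun p => ⟨p.2.1.map (f p.1), by
      obtain ⟨b, e, he⟩ := p
      induction e using Sym2.ind with
      | _ u w => exact (f b).toHom.map_adj he⟩
  have hg : Function.Injective g := by
    rintro ⟨b, e, he⟩ ⟨b', e', he'⟩ h
    have h' : e.map (f b) = e'.map (f b') := Subtype.ext_iff.1 h
    have hb : b = b' := by
      by_contra hne
      have hd := hf hne
      induction e using Sym2.ind with
      | _ u w =>
      have hu : f b u ∈ e'.map (f b') := by rw [← h']; simp
      rw [Sym2.mem_map] at hu
      obtain ⟨v, -, hv⟩ := hu
      exact Set.disjoint_left.1 hd ⟨u, rfl⟩ ⟨v, hv⟩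
    subst hb
    have : e = e' := Sym2.map.injective (f b).injective h'
    subst this
    rfl
  have := Nat.card_le_card_of_injective g hg
  rw [Nat.card_prod, Nat.card_eq_fintype_card, Fintype.card_fin] at this
  exact this

lemma ncard_edgeSet_builtGraph_le {n : ℕ} (σ : Strategy n) (T : ℕ → SpanningTree n) (i : ℕ) :
    (builtGraph σ i T).edgeSet.ncard ≤ i := by
  induction i with
  | zero => simp [builtGraph]
  | succ i ih => exact (ncard_edgeSet_addEdge_le _ _).trans (by omega)

/-- The trivial lower bound for the time in which an `H`-factor is built. -/
lemma le_of_hittingTime_eq {V : Type*} [Fintype V] {H : SimpleGraph V} {n : ℕ} {σ : Strategy n}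
    {T : ℕ → SpanningTree n} {i : ℕ} (h : hittingTime σ (containsFactor H n) T = i) :
    n / Fintype.card V * H.edgeSet.ncard ≤ i := by
  have hmem : builtGraph σ i T ∈ containsFactor H n := by
    have h1 := hittingAfter_mem_set_of_ne_top (u := builtGraph σ) (s := containsFactor H n)
      (n := 0) (ω := T) (by
        change hittingTime σ (containsFactor H n) T ≠ ⊤
        rw [h]; exact WithTop.coe_ne_top)
    have h2 : (hittingAfter (builtGraph σ) (containsFactor H n) 0 T).untopA = i := by
      change (hittingTime σ (containsFactor H n) T).untopA = i
      rw [h]; rfl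
    rwa [h2] at h1
  exact (le_ncard_edgeSet_of_mem_containsFactor hmem).trans (ncard_edgeSet_builtGraph_le _ _ _)

/-! ### Placements of vertex classes and two-stage potentials -/

section Placement

variable {V : Type*} {n N : ℕ}

/-- The bipartite graph that `F` induces between the classes of the two ends of `e`; the ends are
taken in an arbitrary but fixed order. -/
def linkRel (F : SimpleGraph (Fin n)) (φ : V × Fin N → Fin n) (e : Sym2 V) (x y : Fin N) : Prop :=
  F.Adj (φ ((Quot.out e).1, x)) (φ ((Quot.out e).2, y))

lemma linkRel_mono {F F' : SimpleGraph (Fin n)} (hF : F ≤ F') (φ : V × Fin N → Fin n)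
    (e : Sym2 V) (x y : Fin N) (h : linkRel F φ e x y) : linkRel F' φ e x y := hF h

/-- The potential of the placement `φ` of the vertex classes: the cost of the matchings between
the classes that are joined by edges in `Br`. -/
noncomputable def placeCost (Br : Finset (Sym2 V)) (F : SimpleGraph (Fin n))
    (φ : V × Fin N → Fin n) : ℝ :=
  ∑ e ∈ Br, matchCost n (linkRel F φ e)

/-- The edges of `H` outside `Br` are present in `F` within equal indices of the classes. -/
def Placed (H : SimpleGraph V) (Br : Finset (Sym2 V)) (F : SimpleGraph (Fin n))
    (φ : V × Fin N → Fin n) : Prop :=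
  ∀ u w x, H.Adj u w → s(u, w) ∉ Br → F.Adj (φ (u, x)) (φ (w, x))

lemma Placed.mono {H : SimpleGraph V} {Br : Finset (Sym2 V)} {F F' : SimpleGraph (Fin n)}
    (hF : F ≤ F') {φ : V × Fin N → Fin n} (h : Placed H Br F φ) : Placed H Br F' φ :=
  fun u w x h1 h2 => hF (h u w x h1 h2)

lemma placeCost_nonneg (Br : Finset (Sym2 V)) (F : SimpleGraph (Fin n))
    (φ : V × Fin N → Fin n) : 0 ≤ placeCost Br F φ :=
  Finset.sum_nonneg fun _ _ => matchCost_nonneg _ _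

lemma placeCost_anti (Br : Finset (Sym2 V)) {F F' : SimpleGraph (Fin n)} (hF : F ≤ F')
    (φ : V × Fin N → Fin n) : placeCost Br F' φ ≤ placeCost Br F φ :=
  Finset.sum_le_sum fun e _ => matchCost_anti (linkRel_mono hF φ e)

lemma placeCost_le (Br : Finset (Sym2 V)) (F : SimpleGraph (Fin n)) (φ : V × Fin N → Fin n) :
    placeCost Br F φ ≤ Br.card * (N + waste n N) := by
  unfold placeCost
  rw [← nsmul_eq_mul]
  refine Finset.sum_le_card_nsmul _ _ _ fun e _ => ?_
  have := matchCost_le_of_card n (R := linkRel F φ e) 1 Finset.univ (by simp)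
  simpa using this

open scoped Classical in
/-- The potential of a two-stage construction. In the second stage, when some placement of the
family `Φ` is available, it is the least cost of such a placement. In the first stage it is
`Ψ`. -/
noncomputable def potential (H : SimpleGraph V) (Br : Finset (Sym2 V))
    (Φ : Set (V × Fin N → Fin n)) (Ψ : SimpleGraph (Fin n) → ℝ) (F : SimpleGraph (Fin n)) : ℝ :=
  if ∃ φ ∈ Φ, Placed H Br F φ then sInf (placeCost Br F '' {φ | φ ∈ Φ ∧ Placed H Br F φ})
  else Ψ F

variable {H : SimpleGraph V} {Br : Finset (Sym2 V)} {Φ : Set (V × Fin N → Fin n)}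
  {Ψ : SimpleGraph (Fin n) → ℝ} {F : SimpleGraph (Fin n)}

lemma potential_of_not (h : ¬ ∃ φ ∈ Φ, Placed H Br F φ) : potential H Br Φ Ψ F = Ψ F :=
  if_neg h

lemma potential_le_placeCost {φ : V × Fin N → Fin n} (hφ : φ ∈ Φ) (h : Placed H Br F φ) :
    potential H Br Φ Ψ F ≤ placeCost Br F φ := by
  unfold potential
  rw [if_pos ⟨φ, hφ, h⟩]
  refine csInf_le ⟨0, ?_⟩ ⟨φ, ⟨hφ, h⟩, rfl⟩
  rintro _ ⟨ψ, -, rfl⟩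
  exact placeCost_nonneg _ _ _

lemma exists_potential_eq [Finite V] (h : ∃ φ ∈ Φ, Placed H Br F φ) :
    ∃ φ ∈ Φ, Placed H Br F φ ∧ potential H Br Φ Ψ F = placeCost Br F φ := by
  obtain ⟨φ₀, h₀⟩ := h
  have hne : (placeCost Br F '' {φ | φ ∈ Φ ∧ Placed H Br F φ}).Nonempty := ⟨_, φ₀, h₀, rfl⟩
  obtain ⟨φ, hφ, he⟩ := hne.csInf_mem ((Set.toFinite _).image _)
  refine ⟨φ, hφ.1, hφ.2, ?_⟩
  unfold potential
  rw [if_pos ⟨φ₀, h₀⟩, he]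

lemma potential_le (h : ∀ φ ∈ Φ, Placed H Br F φ → placeCost Br F φ ≤ Ψ F) :
    potential H Br Φ Ψ F ≤ Ψ F := by
  by_cases hp : ∃ φ ∈ Φ, Placed H Br F φ
  · obtain ⟨φ, h1, h2⟩ := hp
    exact (potential_le_placeCost h1 h2).trans (h φ h1 h2)
  · exact (potential_of_not hp).le

lemma potential_nonneg [Finite V] (hΨ : ∀ F, 0 ≤ Ψ F) (F : SimpleGraph (Fin n)) :
    0 ≤ potential H Br Φ Ψ F := by
  by_cases hp : ∃ φ ∈ Φ, Placed H Br F φ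
  · obtain ⟨φ, -, -, he⟩ := exists_potential_eq (Ψ := Ψ) hp
    rw [he]
    exact placeCost_nonneg _ _ _
  · rw [potential_of_not hp]
    exact hΨ F

lemma potential_antitone [Finite V] (hΨ : Antitone Ψ)
    (h : ∀ F, ∀ φ ∈ Φ, Placed H Br F φ → placeCost Br F φ ≤ Ψ F) :
    Antitone (potential H Br Φ Ψ) := by
  intro F F' hF
  by_cases hp : ∃ φ ∈ Φ, Placed H Br F φ
  · obtain ⟨φ, h1, h2, he⟩ := exists_potential_eq (Ψ := Ψ) hp
    rw [he]
    exact (potential_le_placeCost h1 (h2.mono hF)).trans (placeCost_anti Br hF φ)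
  · rw [potential_of_not hp]
    exact (potential_le (h F')).trans (hΨ hF)

end Placement

/-- Progress in the second stage: if there is no factor yet, one of the matchings along the bridges
is not perfect in the best placement, and the edges that improve it are useful. -/
lemma potential_progress {V : Type*} [Fintype V] {n : ℕ} {H : SimpleGraph V}
    {Br : Finset (Sym2 V)} (hBr : ∀ e ∈ Br, H.IsBridge e)
    (hN : 2 * (smallDefect n + collectNum n) ≤ n / Fintype.card V)
    {Φ : Set (V × Fin (n / Fintype.card V) → Fin n)} (hΦ : ∀ φ ∈ Φ, Function.Injective φ)
    {Ψ : SimpleGraph (Fin n) → ℝ} {F : SimpleGraph (Fin n)} (hF : F ∉ containsFactor H n)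
    (hp : ∃ φ ∈ Φ, Placed H Br F φ) :
    Progress (potential H Br Φ Ψ) (1 + collectNum n) F := by
  classical
  obtain ⟨φ, hφ, hpl, he⟩ := exists_potential_eq (Ψ := Ψ) hp
  have hinj := hΦ φ hφ
  obtain ⟨e, heBr, heH, hno⟩ : ∃ e ∈ Br, e ∈ H.edgeSet ∧
      ¬ ∃ π : Equiv.Perm (Fin (n / Fintype.card V)), ∀ x, linkRel F φ e x (π x) := by
    by_contra hcon
    push Not at hcon
    refine hF (mem_containsFactor hBr hinj hpl fun u w h hu => ?_)
    obtain ⟨π, hπ⟩ := hcon s(u, w) hu h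
    unfold linkRel at hπ
    have hout : s((Quot.out s(u, w)).1, (Quot.out s(u, w)).2) = s(u, w) := Quot.out_eq _
    rcases Sym2.eq_iff.1 hout with ⟨h1, h2⟩ | ⟨h1, h2⟩
    · rw [h1, h2] at hπ
      exact ⟨π, hπ⟩
    · rw [h1, h2] at hπ
      refine ⟨π.symm, fun x => ?_⟩
      have := hπ (π.symm x)
      rw [Equiv.apply_symm_apply] at this
      exact this.symm
  set a := (Quot.out e).1 with ha
  set b := (Quot.out e).2 with hb
  have hab : a ≠ b := by
    have hout : s(a, b) = e := Quot.out_eq _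
    rw [← hout] at heH
    exact H.ne_of_adj heH
  obtain ⟨S, hS, hB, hdec⟩ := matchCost_progress hN hno
  have hmapinj : Function.Injective
      fun p : Fin (n / Fintype.card V) × Fin (n / Fintype.card V) =>
        s(φ (a, p.1), φ (b, p.2)) := by
    rintro ⟨x, y⟩ ⟨x', y'⟩ h
    rcases Sym2.eq_iff.1 h with ⟨h1, h2⟩ | ⟨h1, h2⟩
    · have h3 := Prod.ext_iff.1 (hinj h1)
      have h4 := Prod.ext_iff.1 (hinj h2)
      exact Prod.ext h3.2 h4.2
    · exact absurd (Prod.ext_iff.1 (hinj h1)).1 hab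
  refine ⟨S.map ⟨_, hmapinj⟩, by simpa using hS, ?_, by simpa using hB, ?_⟩
  · intro g hg
    rw [Finset.mem_map] at hg
    obtain ⟨p, -, rfl⟩ := hg
    intro hdiag
    exact hab (Prod.ext_iff.1 (hinj (Sym2.mk_isDiag_iff.1 hdiag))).1
  · intro g hg
    rw [Finset.mem_map] at hg
    obtain ⟨p, hpS, rfl⟩ := hg
    rw [Finset.card_map, he]
    refine (potential_le_placeCost hφ (hpl.mono le_sup_left)).trans ?_
    unfold placeCost
    rw [← Finset.add_sum_erase _ _ heBr, ← Finset.add_sum_erase Br _ heBr]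
    have h1 : matchCost n (linkRel (addEdge F s(φ (a, p.1), φ (b, p.2))) φ e) ≤
        matchCost n (linkRel F φ e) - (1 + (n : ℝ) / S.card) := by
      refine le_trans (matchCost_anti ?_) (hdec p hpS)
      rintro x y (hxy | ⟨rfl, rfl⟩)
      · exact linkRel_mono le_sup_left φ e x y hxy
      · refine Or.inr ?_
        rw [SimpleGraph.fromEdgeSet_adj]
        exact ⟨rfl, fun h => hab (Prod.ext_iff.1 (hinj h)).1⟩
    have h2 : ∑ e' ∈ Br.erase e, matchCost n (linkRel (addEdge F s(φ (a, p.1), φ (b, p.2))) φ e') ≤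
        ∑ e' ∈ Br.erase e, matchCost n (linkRel F φ e') :=
      Finset.sum_le_sum fun e' _ => matchCost_anti (linkRel_mono le_sup_left φ e')
    simp only [Function.Embedding.coeFn_mk]
    linarith

/-- A potential of drift `-1` which exceeds the trivial lower bound for the hitting time by
`O(n ^ (3/4))` yields an asymptotically optimal strategy. -/
lemma buildsFactorWhp_of_drift {V : Type*} [Fintype V] (H : SimpleGraph V) {C : ℝ}
    (Ψ : ∀ n, SimpleGraph (Fin n) → ℝ) (h0 : ∀ n F, 0 ≤ Ψ n F)
    (hdrift : ∀ᶠ n : ℕ in atTop, ∀ F ∉ containsFactor H n,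
      treeMean (fun T => Ψ n (addEdge F ((greedy (Ψ n)).select F T))) + 1 ≤ Ψ n F)
    (hstart : ∀ᶠ n : ℕ in atTop, Ψ n ⊥ ≤
      (n / Fintype.card V : ℕ) * (H.edgeSet.ncard : ℝ) + C * (n : ℝ) ^ (3 / 4 : ℝ))
    (ω : ℕ → ℝ) (hω : Tendsto ω atTop atTop) :
    BuildsFactorWhp H (fun n => greedy (Ψ n)) fun n =>
      (n : ℝ) * (H.edgeSet.ncard : ℝ) / (Fintype.card V : ℝ) + ω n * (n : ℝ) ^ (3 / 4 : ℝ) := by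
  set x : ℕ → ℝ := fun n => (n : ℝ) ^ (3 / 4 : ℝ) with hx
  set L : ℕ → ℝ := fun n => (n / Fintype.card V : ℕ) * (H.edgeSet.ncard : ℝ) with hL
  have hLle : ∀ n, L n ≤ (n : ℝ) * (H.edgeSet.ncard : ℝ) / (Fintype.card V : ℝ) := by
    intro n
    rw [hL, mul_div_right_comm]
    have : ((n / Fintype.card V : ℕ) : ℝ) ≤ (n : ℝ) / Fintype.card V := Nat.cast_div_le
    dsimp only
    gcongr
  have hL0 : ∀ n, 0 ≤ L n := fun n => by positivity
  refine buildsFactorWhp_of_failProb H _ _ (fun n => ⌊L n + ω n * x n⌋₊) ?_ ?_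
  · filter_upwards [hω.eventually_ge_atTop 0] with n hn
    have hx0 : 0 ≤ x n := by positivity
    refine (Nat.floor_le (by have := hL0 n; positivity)).trans ?_
    have := hLle n
    linarith
  · have hlim : Tendsto (fun n => (|C| + 1) / (ω n)) atTop (𝓝 0) := hω.const_div_atTop _
    refine tendsto_of_tendsto_of_tendsto_of_le_of_le' tendsto_const_nhds hlim
      (Eventually.of_forall fun n => failProb_nonneg _ _ _ _) ?_
    filter_upwards [hdrift, hstart, hω.eventually_gt_atTop 0, eventually_ge_atTop 1]
      with n hd hs hωn hn1
    have hx1 : 1 ≤ x n := Real.one_le_rpow (by exact_mod_cast hn1) (by norm_num)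
    have hK : 0 < ω n * x n := by positivity
    have hnn : 0 ≤ L n + ω n * x n := by have := hL0 n; linarith
    have hfl := Nat.floor_le hnn
    have hfl2 := Nat.lt_floor_add_one (L n + ω n * x n)
    have h1 := failProb_le_of_drift hn1 (greedy (Ψ n)) (isUpperSet_containsFactor H n) (h0 n)
      (L := L n) hK (fun F hF => by
        have := le_ncard_edgeSet_of_mem_containsFactor hF
        change ((n / Fintype.card V : ℕ) : ℝ) * (H.edgeSet.ncard : ℝ) ≤ _
        exact_mod_cast this) hd ⌊L n + ω n * x n⌋₊ ⊥ (by
        simp only [SimpleGraph.edgeSet_bot, Set.ncard_empty, Nat.cast_zero]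
        linarith)
    refine h1.trans ?_
    rw [div_le_div_iff₀ hK hωn]
    have h2 : C * x n ≤ |C| * x n := by gcongr; exact le_abs_self C
    have h3 : Ψ n ⊥ - (⌊L n + ω n * x n⌋₊ : ℝ) + ω n * x n ≤ (|C| + 1) * x n := by
      linarith
    nlinarith

/-! ### Trees and central graphs -/

lemma smallDefect_le_collectNum (n : ℕ) : smallDefect n ≤ collectNum n := by
  unfold smallDefect collectNum
  exact Nat.succ_le_succ (Nat.sqrt_le_self _)

/-- The size conditions that hold for all large `n`. -/
lemma eventually_large {k : ℕ} (hk : 0 < k) (c : ℕ) :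
    ∀ᶠ n : ℕ in atTop, 1 ≤ n ∧ 0 < n / k ∧ (n : ℝ) ≤ 2 * k * (n / k : ℕ) ∧
      2 * (smallDefect n + collectNum n) ≤ n / k ∧ c ≤ collectNum n := by
  filter_upwards [eventually_ge_atTop ((8 * k) ^ 2 + c ^ 2 + 1)] with n hn
  have h8 : 8 * k ≤ Nat.sqrt n := by
    rw [Nat.le_sqrt']; omega
  have hc : c ≤ Nat.sqrt n := by
    rw [Nat.le_sqrt']; omega
  have hsq : Nat.sqrt n ^ 2 ≤ n := Nat.sqrt_le' n
  have hN : 4 * (Nat.sqrt n + 1) ≤ n / k := by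
    rw [Nat.le_div_iff_mul_le hk]
    nlinarith
  have hdiv : n < k * (n / k + 1) := Nat.lt_mul_div_succ n hk
  refine ⟨by omega, by omega, ?_, ?_, ?_⟩
  · have h1 : n ≤ 2 * k * (n / k) := by
      have : 1 ≤ n / k := by omega
      nlinarith
    exact_mod_cast h1
  · have := smallDefect_le_collectNum n
    have h2 : collectNum n = Nat.sqrt n + 1 := rfl
    omega
  · unfold collectNum; omega

lemma exists_injective_placement (V : Type*) [Fintype V] (n : ℕ) :
    ∃ φ : V × Fin (n / Fintype.card V) → Fin n, Function.Injective φ := by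
  have h : Fintype.card (V × Fin (n / Fintype.card V)) ≤ Fintype.card (Fin n) := by
    rw [Fintype.card_prod, Fintype.card_fin, Fintype.card_fin]
    exact Nat.mul_div_le n _
  obtain ⟨f⟩ := Function.Embedding.nonempty_of_card_le h
  exact ⟨f, f.injective⟩

/-- Factors of trees: all edges are bridges, and the factor is composed of perfect matchings
between fixed vertex classes. -/
lemma exists_strategy_of_isTree {V : Type*} [Fintype V] (H : SimpleGraph V) (hH : H.IsTree)
    (ω : ℕ → ℝ) (hω : Tendsto ω atTop atTop) :
    ∃ σ : ∀ n, Strategy n, BuildsFactorWhp H σ fun n =>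
      (n : ℝ) * ((Fintype.card V : ℝ) - 1) / (Fintype.card V : ℝ)
        + ω n * (n : ℝ) ^ (3 / 4 : ℝ) := by
  classical
  have hV : Nonempty V := hH.connected.nonempty
  have hk : 0 < Fintype.card V := Fintype.card_pos
  have hcard : (H.edgeSet.ncard : ℝ) = (Fintype.card V : ℝ) - 1 := by
    have := (SimpleGraph.isTree_iff_connected_and_card.1 hH).2
    rw [Nat.card_eq_fintype_card (α := V)] at this
    rw [← this]
    push_cast
    rw [add_sub_cancel_right]
    rfl
  set Br : Finset (Sym2 V) := (Set.toFinite H.edgeSet).toFinset with hBrdef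
  have hBr : ∀ e ∈ Br, H.IsBridge e := fun e he =>
    SimpleGraph.isAcyclic_iff_forall_isBridge.1 hH.isAcyclic (by simpa [hBrdef] using he)
  have hBrcard : Br.card = H.edgeSet.ncard := by
    rw [Set.ncard_eq_toFinset_card _ (Set.toFinite H.edgeSet)]
  choose φ hφ using fun n => exists_injective_placement V n
  set Ψ : ∀ n, SimpleGraph (Fin n) → ℝ := fun n => potential H Br {φ n}
    (fun _ => Br.card * ((n / Fintype.card V : ℕ) + waste n (n / Fintype.card V))) with hΨ
  have hplaced : ∀ n F, Placed H Br F (φ n) := by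
    intro n F u w x h hn
    exact absurd (by simpa [hBrdef] using h) hn
  have key := buildsFactorWhp_of_drift H
    (C := H.edgeSet.ncard * (8 + 8 * (2 * Fintype.card V))) Ψ ?_ ?_ ?_ ω hω
  · simp only [hcard] at key
    exact ⟨_, key⟩
  · intro n F
    refine potential_nonneg (fun _ => ?_) F
    have := waste_nonneg n (n / Fintype.card V)
    positivity
  · filter_upwards [eventually_large hk 0] with n hn F hF
    have hprog : Progress (Ψ n) (1 + collectNum n) F :=
      potential_progress hBr hn.2.2.2.1 (by rintro _ rfl; exact hφ n) hF
        ⟨φ n, rfl, hplaced n F⟩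
    exact hprog.drift hn.1 (potential_antitone antitone_const
      fun F ψ _ _ => placeCost_le Br F ψ)
  · filter_upwards [eventually_large hk 0] with n hn
    refine (potential_le_placeCost (φ := φ n) (Set.mem_singleton _) (hplaced n ⊥)).trans ?_
    refine (placeCost_le _ _ _).trans ?_
    rw [hBrcard, mul_add, mul_assoc, mul_comm (H.edgeSet.ncard : ℝ)]
    gcongr
    exact waste_le hn.1 hn.2.1 hn.2.2.1

section Central

variable {V : Type*} [Fintype V] (H : SimpleGraph V) (v : V) {n M : ℕ}

open scoped Classical in
/-- The edges of the copies of `H - v` on the prescribed cells that are missing in `F`. The cell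
of index `c` consists of the vertices `γ (x, c)`. -/
noncomputable def missing (γ : {x : V // x ≠ v} × Fin M → Fin n) (F : SimpleGraph (Fin n)) :
    Finset (Sym2 (Fin n)) :=
  Finset.univ.filter fun e => e ∉ F.edgeSet ∧
    ∃ x y c, H.Adj x.1 y.1 ∧ e = s(γ (x, c), γ (y, c))

/-- The cell of index `c` carries a copy of `H - v` in `F`. -/
def IsComplete (γ : {x : V // x ≠ v} × Fin M → Fin n) (F : SimpleGraph (Fin n)) (c : Fin M) :
    Prop :=
  ∀ x y : {x : V // x ≠ v}, H.Adj x.1 y.1 → F.Adj (γ (x, c)) (γ (y, c))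

variable {H v} {γ : {x : V // x ≠ v} × Fin M → Fin n} {F F' : SimpleGraph (Fin n)}

lemma missing_anti (hF : F ≤ F') : missing H v γ F' ⊆ missing H v γ F := by
  classical
  intro e he
  simp only [missing, Finset.mem_filter, Finset.mem_univ, true_and] at he ⊢
  exact ⟨fun h => he.1 (SimpleGraph.edgeSet_mono hF h), he.2⟩

lemma not_isDiag_of_mem_missing (hγ : Function.Injective γ) {e : Sym2 (Fin n)}
    (he : e ∈ missing H v γ F) : ¬ e.IsDiag := by
  classical
  simp only [missing, Finset.mem_filter, Finset.mem_univ, true_and] at he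
  obtain ⟨-, x, y, c, hxy, rfl⟩ := he
  intro h
  have := (Prod.ext_iff.1 (hγ (Sym2.mk_isDiag_iff.1 h))).1
  simp only at this
  subst this
  exact H.irrefl hxy

lemma card_missing_addEdge (hγ : Function.Injective γ) {e : Sym2 (Fin n)}
    (he : e ∈ missing H v γ F) :
    (missing H v γ (addEdge F e)).card + 1 ≤ (missing H v γ F).card := by
  classical
  have h1 : e ∉ missing H v γ (addEdge F e) := by
    intro h
    have hd := not_isDiag_of_mem_missing hγ he
    simp only [missing, Finset.mem_filter, Finset.mem_univ, true_and] at h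
    apply h.1
    rw [SimpleGraph.edgeSet_sup, SimpleGraph.edgeSet_fromEdgeSet]
    exact Or.inr ⟨rfl, hd⟩
  rw [← Finset.card_insert_of_notMem h1]
  refine Finset.card_le_card (Finset.insert_subset he (missing_anti le_sup_left))

open scoped Classical in
/-- Every incomplete cell lacks an edge, and different cells lack different edges. -/
lemma card_incomplete_le (hγ : Function.Injective γ) :
    (Finset.univ.filter fun c => ¬ IsComplete H v γ F c).card ≤ (missing H v γ F).card := by
  refine Finset.card_le_card_of_forall_subsingleton
    (fun c e => ∃ x y, e = s(γ (x, c), γ (y, c))) ?_ ?_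
  · intro c hc
    have hc' := (Finset.mem_filter.1 hc).2
    unfold IsComplete at hc'
    push Not at hc'
    obtain ⟨x, y, hxy, hF⟩ := hc'
    refine ⟨s(γ (x, c), γ (y, c)), ?_, x, y, rfl⟩
    simp only [missing, Finset.mem_filter, Finset.mem_univ, true_and]
    exact ⟨hF, x, y, c, hxy, rfl⟩
  · rintro e - c ⟨-, x, y, h1⟩ c' ⟨-, x', y', h2⟩
    rw [h1] at h2
    rcases Sym2.eq_iff.1 h2 with ⟨h3, -⟩ | ⟨h3, -⟩
    · exact (Prod.ext_iff.1 (hγ h3)).2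
    · exact (Prod.ext_iff.1 (hγ h3)).2

lemma card_missing_le : (missing H v γ F).card ≤ Fintype.card V ^ 2 * M := by
  classical
  have hsub : missing H v γ F ⊆ Finset.univ.image
      fun p : ({x : V // x ≠ v} × {x : V // x ≠ v}) × Fin M => s(γ (p.1.1, p.2), γ (p.1.2, p.2)) := by
    intro e he
    simp only [missing, Finset.mem_filter, Finset.mem_univ, true_and] at he
    obtain ⟨-, x, y, c, -, rfl⟩ := he
    exact Finset.mem_image.2 ⟨((x, y), c), Finset.mem_univ _, rfl⟩
  refine (Finset.card_le_card hsub).trans (Finset.card_image_le.trans ?_)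
  rw [Finset.card_univ, Fintype.card_prod, Fintype.card_prod, Fintype.card_fin, pow_two]
  have := Fintype.card_subtype_le fun x : V => x ≠ v
  gcongr

open scoped Classical in
/-- If there are `N` complete cells, the classes can be placed: `N` complete cells carry the
copies of `H - v`, and the copies of `v` are placed on further vertices. -/
lemma exists_placed {N : ℕ} (hγ : Function.Injective γ) (hN : N * Fintype.card V ≤ n)
    (hc : N ≤ (Finset.univ.filter fun c => IsComplete H v γ F c).card) {Br : Finset (Sym2 V)}
    (hBr : ∀ e ∈ H.incidenceSet v, e ∈ Br) :
    ∃ φ : V × Fin N → Fin n, Function.Injective φ ∧ Placed H Br F φ := by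
  obtain ⟨ι⟩ : Nonempty (Fin N ↪ {c // c ∈ Finset.univ.filter fun c => IsComplete H v γ F c}) :=
    Function.Embedding.nonempty_of_card_le (by rwa [Fintype.card_fin, Fintype.card_coe])
  set U : Finset (Fin n) := Finset.univ.image
    fun p : {x : V // x ≠ v} × Fin N => γ (p.1, (ι p.2).1) with hU
  have hUcard : U.card ≤ (Fintype.card V - 1) * N := by
    refine Finset.card_image_le.trans ?_
    rw [Finset.card_univ, Fintype.card_prod, Fintype.card_fin, Fintype.card_subtype_compl,
      Fintype.card_subtype_eq]
  have hVpos : 1 ≤ Fintype.card V := Fintype.card_pos_iff.2 ⟨v⟩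
  have hcompl : N ≤ (Finset.univ \ U).card := by
    have h1 := Finset.le_card_sdiff U (Finset.univ : Finset (Fin n))
    rw [Finset.card_univ, Fintype.card_fin] at h1
    have h2 : (Fintype.card V - 1) * N + N = N * Fintype.card V := by
      obtain ⟨q, hq⟩ : ∃ q, Fintype.card V = q + 1 := ⟨Fintype.card V - 1, by omega⟩
      rw [hq, Nat.add_sub_cancel]; ring
    omega
  obtain ⟨η⟩ : Nonempty (Fin N ↪ {a // a ∈ Finset.univ \ U}) :=
    Function.Embedding.nonempty_of_card_le (by rwa [Fintype.card_fin, Fintype.card_coe])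
  have hη : ∀ b x b', (η b).1 ≠ γ (x, (ι b').1) := by
    intro b x b' h
    have := (Finset.mem_sdiff.1 (η b).2).2
    exact this (Finset.mem_image.2 ⟨(x, b'), Finset.mem_univ _, h.symm⟩)
  refine ⟨fun p => if h : p.1 = v then (η p.2).1 else γ (⟨p.1, h⟩, (ι p.2).1), ?_, ?_⟩
  · rintro ⟨u, b⟩ ⟨w, b'⟩ h
    simp only at h
    split_ifs at h with h1 h2 h2
    · rw [h1, h2, η.injective (Subtype.ext h)]
    · exact absurd h (hη _ _ _)
    · exact absurd h.symm (hη _ _ _)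
    · have h3 := Prod.ext_iff.1 (hγ h)
      have h4 : u = w := congrArg Subtype.val h3.1
      rw [h4, ι.injective (Subtype.ext h3.2)]
  · intro u w b h hn
    have hu : u ≠ v := by
      rintro rfl
      exact hn (hBr _ ⟨h, by simp⟩)
    have hw : w ≠ v := by
      rintro rfl
      exact hn (hBr _ ⟨h, by simp⟩)
    simp only [hu, hw, dif_neg, not_false_iff]
    exact (Finset.mem_filter.1 (ι b).2).2 ⟨u, hu⟩ ⟨w, hw⟩ h

end Central

lemma bot_mem_containsFactor_of_card_eq_one {V : Type*} [Fintype V] (H : SimpleGraph V)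
    (hV : Fintype.card V = 1) (n : ℕ) : (⊥ : SimpleGraph (Fin n)) ∈ containsFactor H n := by
  have hs : Subsingleton V := Fintype.card_le_one_iff_subsingleton.1 hV.le
  have hn : n / Fintype.card V = n := by rw [hV, Nat.div_one]
  refine ⟨fun b => ⟨⟨fun _ => Fin.cast hn b, fun {u w} h => ?_⟩, fun u w _ => Subsingleton.elim u w⟩, ?_⟩
  · exact absurd (Subsingleton.elim u w) (H.ne_of_adj h)
  · intro b b' h
    rw [Set.disjoint_left]
    rintro _ ⟨u, rfl⟩ ⟨w, hw⟩
    exact h (Fin.cast_injective hn hw.symm)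

/-- Factors of central graphs are built in linear time: more than `n / |H|` disjoint cells are
prescribed for the copies of `H - v`, so that there are always linearly many useful edges until
sufficiently many cells are complete. Then the bridges at `v` are built as matchings. -/
lemma exists_strategy_of_isCentral {V : Type*} [Fintype V] (H : SimpleGraph V)
    (hH : IsCentral H) :
    ∃ C : ℝ, 0 < C ∧ ∃ σ : ∀ n, Strategy n, BuildsFactorWhp H σ fun n => C * (n : ℝ) := by
  classical
  obtain ⟨v, hv⟩ := hH
  have hVpos : 0 < Fintype.card V := Fintype.card_pos_iff.2 ⟨v⟩
  -- a single vertex has no cell; its factor is present from the start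
  by_cases hV1 : Fintype.card V = 1
  · refine ⟨1, one_pos, fun n => greedy fun _ => 0, ?_⟩
    refine buildsFactorWhp_of_failProb H _ _ (fun n => 0) (Eventually.of_forall fun n => ?_) ?_
    · simp
    · simp_rw [failProb_of_mem _ (isUpperSet_containsFactor H _) 0 ⊥
        (bot_mem_containsFactor_of_card_eq_one H hV1 _)]
      exact tendsto_const_nhds
  set k := Fintype.card V with hk
  set q := Fintype.card {x : V // x ≠ v} with hq
  have hqk : q + 1 = k := by
    rw [hq, Fintype.card_subtype_compl, Fintype.card_subtype_eq]
    omega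
  have hq0 : 0 < q := by omega
  set Br : Finset (Sym2 V) := (Set.toFinite (H.incidenceSet v)).toFinset with hBrdef
  have hBr : ∀ e ∈ Br, H.IsBridge e := fun e he => hv e (by simpa [hBrdef] using he)
  choose γ hγ using fun n => exists_injective_placement {x : V // x ≠ v} n
  set W : ℕ → ℝ := fun n => Br.card * ((n / k : ℕ) + waste n (n / k)) with hW
  have hW0 : ∀ n, 0 ≤ W n := fun n => by
    have := waste_nonneg n (n / k)
    positivity
  -- a missing edge is worth `1 + k ^ 2`, as there will be at least `n / k ^ 2` missing edges
  set Ψ₁ : ∀ n, SimpleGraph (Fin n) → ℝ := fun n F =>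
    (1 + (k : ℝ) ^ 2) * (missing H v (γ n) F).card + W n with hΨ₁
  set Φ : ∀ n, Set (V × Fin (n / k) → Fin n) := fun n => {φ | Function.Injective φ} with hΦ
  set Ψ : ∀ n, SimpleGraph (Fin n) → ℝ := fun n => potential H Br (Φ n) (Ψ₁ n) with hΨ
  have hΨ₁anti : ∀ n, Antitone (Ψ₁ n) := by
    intro n F F' hF
    have : (missing H v (γ n) F').card ≤ (missing H v (γ n) F).card :=
      Finset.card_le_card (missing_anti hF)
    simp only [hΨ₁]
    gcongr
  have hle : ∀ n F, ∀ φ ∈ Φ n, Placed H Br F φ → placeCost Br F φ ≤ Ψ₁ n F := by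
    intro n F φ _ _
    refine (placeCost_le Br F φ).trans ?_
    simp only [hΨ₁]
    have : 0 ≤ (1 + (k : ℝ) ^ 2) * (missing H v (γ n) F).card := by positivity
    linarith
  have hanti : ∀ n, Antitone (Ψ n) := fun n => potential_antitone (hΨ₁anti n) (hle n)
  have hΨ0 : ∀ n F, 0 ≤ Ψ n F := fun n F => potential_nonneg (fun F => by
    have := hW0 n
    simp only [hΨ₁]
    positivity) F
  have hprog : ∀ᶠ n : ℕ in atTop, ∀ F ∉ containsFactor H n,
      Progress (Ψ n) (1 + collectNum n) F := by
    filter_upwards [eventually_large hVpos (k ^ 2)] with n hn F hF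
    by_cases hp : ∃ φ ∈ Φ n, Placed H Br F φ
    · exact potential_progress hBr hn.2.2.2.1 (fun φ hφ => hφ) hF hp
    have hcomp : (Finset.univ.filter fun c => IsComplete H v (γ n) F c).card < n / k := by
      by_contra hcon
      obtain ⟨φ, h1, h2⟩ := exists_placed (Br := Br) (hγ n) (Nat.div_mul_le_self n k)
        (not_lt.1 hcon) (fun e he => by simpa [hBrdef] using he)
      exact hp ⟨φ, h1, h2⟩
    have hinc := card_incomplete_le (H := H) (F := F) (hγ n)
    have hsum := Finset.card_filter_add_card_filter_not (s := Finset.univ)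
      (fun c => IsComplete H v (γ n) F c)
    rw [Finset.card_univ, Fintype.card_fin] at hsum
    change _ + _ = n / q at hsum
    set S := missing H v (γ n) F with hS
    -- there are at least `n / (k (k - 1))` incomplete cells
    have hSk : (n : ℝ) ≤ k ^ 2 * S.card := by
      have h1 : n / q + 1 ≤ S.card + n / k := by omega
      have h2 : n < q * (n / q + 1) := Nat.lt_mul_div_succ n hq0
      have h3 : n / k * k ≤ n := Nat.div_mul_le_self n k
      have h4 : n ≤ k ^ 2 * S.card := by
        have h5 : n < q * (S.card + n / k) := lt_of_lt_of_le h2 (Nat.mul_le_mul_left q h1)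
        have h6 : k * n < k * (q * (S.card + n / k)) := Nat.mul_lt_mul_of_pos_left h5 hVpos
        have h7 : q * (n / k * k) ≤ q * n := Nat.mul_le_mul_left q h3
        have h8 : k * (q * (S.card + n / k)) = k * q * S.card + q * (n / k * k) := by ring
        have h9 : k * n = q * n + n := by rw [← hqk]; ring
        have h10 : k * q * S.card ≤ k ^ 2 * S.card := by
          rw [pow_two]
          exact Nat.mul_le_mul_right _ (Nat.mul_le_mul_left k (by omega))
        omega
      exact_mod_cast h4
    have hn1 : (1 : ℝ) ≤ n := by exact_mod_cast hn.1
    have hSpos : (0 : ℝ) < S.card := by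
      by_contra hneg
      have : (S.card : ℝ) = 0 := le_antisymm (not_lt.1 hneg) (Nat.cast_nonneg _)
      rw [this] at hSk
      linarith
    have hD : (n : ℝ) / S.card ≤ k ^ 2 := by rw [div_le_iff₀ hSpos]; exact hSk
    refine ⟨S, Finset.card_pos.1 (by exact_mod_cast hSpos),
      fun e he => not_isDiag_of_mem_missing (hγ n) he, ?_, ?_⟩
    · have : ((k ^ 2 : ℕ) : ℝ) ≤ collectNum n := by exact_mod_cast hn.2.2.2.2
      push_cast at this
      linarith
    · intro e he
      have h1 := card_missing_addEdge (hγ n) he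
      have h2 : ((missing H v (γ n) (addEdge F e)).card : ℝ) + 1 ≤ S.card := by exact_mod_cast h1
      refine (potential_le (hle n _)).trans ?_
      simp only [hΨ]
      rw [potential_of_not hp]
      simp only [hΨ₁]
      have h3 : (1 + (k : ℝ) ^ 2) * ((missing H v (γ n) (addEdge F e)).card + 1) ≤
          (1 + (k : ℝ) ^ 2) * S.card := by gcongr
      linarith
  -- the potential of the empty graph is linear in `n`
  obtain ⟨C₀, hC₀⟩ : ∃ C₀ : ℕ, ∀ᶠ n : ℕ in atTop, Ψ n ⊥ ≤ C₀ * n := by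
    obtain ⟨C₀, hC₀⟩ := exists_nat_ge ((1 + (k : ℝ) ^ 2) * k ^ 2 +
      Br.card * (1 + (8 + 8 * (2 * k))))
    refine ⟨C₀, ?_⟩
    filter_upwards [eventually_large hVpos 0] with n hn
    have hn1 : (1 : ℝ) ≤ n := by exact_mod_cast hn.1
    have h1 : waste n (n / k) ≤ (8 + 8 * (2 * k)) * n := by
      refine (waste_le hn.1 hn.2.1 hn.2.2.1).trans ?_
      gcongr
      calc (n : ℝ) ^ (3 / 4 : ℝ) ≤ (n : ℝ) ^ (1 : ℝ) :=
            Real.rpow_le_rpow_of_exponent_le hn1 (by norm_num)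
        _ = n := Real.rpow_one _
    have h2 : ((missing H v (γ n) ⊥).card : ℝ) ≤ k ^ 2 * n := by
      have := card_missing_le (H := H) (γ := γ n) (F := ⊥)
      have h3 : k ^ 2 * (n / q) ≤ k ^ 2 * n := Nat.mul_le_mul_left _ (Nat.div_le_self _ _)
      exact_mod_cast this.trans h3
    have h4 : ((n / k : ℕ) : ℝ) ≤ n := by exact_mod_cast Nat.div_le_self n k
    refine (potential_le (hle n ⊥)).trans ?_
    simp only [hΨ₁, hW]
    calc _ ≤ (1 + (k : ℝ) ^ 2) * (k ^ 2 * n) + Br.card * (n + (8 + 8 * (2 * k)) * n) := by gcongr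
      _ = ((1 + (k : ℝ) ^ 2) * k ^ 2 + Br.card * (1 + (8 + 8 * (2 * k)))) * n := by ring
      _ ≤ C₀ * n := by gcongr
  refine ⟨2 * C₀ + 2, by positivity, fun n => greedy (Ψ n), ?_⟩
  refine buildsFactorWhp_of_failProb H _ _ (fun n => (2 * C₀ + 2) * n)
    (Eventually.of_forall fun n => by push_cast; rfl) ?_
  have hlim : Tendsto (fun n : ℕ => Real.exp (-(Real.sqrt n / 3))) atTop (𝓝 0) := by
    refine Real.tendsto_exp_neg_atTop_nhds_zero.comp ?_
    exact (Real.tendsto_sqrt_atTop.comp tendsto_natCast_atTop_atTop).atTop_div_const (by norm_num)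
  refine tendsto_of_tendsto_of_tendsto_of_le_of_le' tendsto_const_nhds hlim
    (Eventually.of_forall fun n => failProb_nonneg _ _ _ _) ?_
  filter_upwards [hprog, hC₀, eventually_ge_atTop 1] with n hpn hCn hn
  have hB : (0 : ℝ) < 1 + collectNum n := by positivity
  refine (failProb_le_of_progress hn (hanti n) (isUpperSet_containsFactor H n) (hΨ0 n) hB hpn
    _ ⊥).trans ?_
  apply Real.exp_le_exp.2
  have hs : (collectNum n : ℝ) ≤ Real.sqrt n + 1 := by
    unfold collectNum
    push_cast
    gcongr
    exact Real.nat_sqrt_le_real_sqrt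
  have hs1 : 1 ≤ Real.sqrt n := by
    rw [Real.one_le_sqrt]; exact_mod_cast hn
  have hss : Real.sqrt n * Real.sqrt n = n := Real.mul_self_sqrt (Nat.cast_nonneg n)
  rw [div_le_iff₀ hB]
  have h1 : Ψ n ⊥ - (((2 * C₀ + 2) * n : ℕ) : ℝ) / 2 ≤ -n := by
    push_cast
    linarith
  have h2 : Real.sqrt n / 3 * (1 + collectNum n) ≤ n := by
    calc Real.sqrt n / 3 * (1 + collectNum n) ≤ Real.sqrt n / 3 * (3 * Real.sqrt n) := by
          gcongr; linarith
      _ = n := by linarith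
  linarith

/-! ### Hub graphs, and tools for the first stage -/

/-- The graph obtained from `Q` by adding a vertex `none`, the hub, which is joined to exactly one
vertex of every component of `Q`. -/
def hubGraph {X : Type*} (Q : SimpleGraph X) : SimpleGraph (Option X) where
  Adj
    | none, none => False
    | none, some x => Quot.out (Q.connectedComponentMk x) = x
    | some x, none => Quot.out (Q.connectedComponentMk x) = x
    | some x, some y => Q.Adj x y
  symm := ⟨by
    rintro (_ | x) (_ | y) h
    · exact h
    · exact h
    · exact h
    · exact SimpleGraph.Adj.symm (G := Q) h⟩
  loopless := ⟨by
    rintro (_ | x) h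
    · exact h
    · exact Q.irrefl h⟩

section HubGraph

variable {X : Type*} (Q : SimpleGraph X)

lemma hubGraph_connected : (hubGraph Q).Connected := by
  have h : ∀ v, (hubGraph Q).Reachable v none := by
    rintro (_ | x)
    · exact SimpleGraph.Reachable.refl _
    · set y := Quot.out (Q.connectedComponentMk x) with hy
      have hxy : Q.connectedComponentMk y = Q.connectedComponentMk x := Quot.out_eq _
      have h1 : Q.Reachable x y := (SimpleGraph.ConnectedComponent.exact hxy).symm
      have h2 : (hubGraph Q).Reachable (some x) (some y) :=
        h1.map (⟨some, fun h => h⟩ : Q →g hubGraph Q)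
      refine h2.trans (SimpleGraph.Adj.reachable ?_)
      change Quot.out (Q.connectedComponentMk y) = y
      rw [hxy]
  exact SimpleGraph.Connected.mk fun u v => (h u).trans (h v).symm

/-- The edge from the hub to a component of `Q` is the only one that leaves the component. -/
lemma isBridge_of_mem_incidenceSet_hub {e : Sym2 (Option X)}
    (he : e ∈ (hubGraph Q).incidenceSet none) : (hubGraph Q).IsBridge e := by
  obtain ⟨h1, h2⟩ := he
  obtain ⟨w, rfl⟩ := Sym2.mem_iff_exists.1 h2
  obtain _ | x := w
  · exact ((hubGraph Q).irrefl (v := none) h1).elim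
  rw [SimpleGraph.isBridge_iff]
  intro hr
  have hx : Quot.out (Q.connectedComponentMk x) = x := h1
  -- without the edge, the component of `x` in `Q` is not left
  have hinv : ∀ u v, ((hubGraph Q).deleteEdges {s(none, some x)}).Reachable u v →
      (∃ y, u = some y ∧ Q.Reachable x y) → ∃ y, v = some y ∧ Q.Reachable x y := by
    rintro u v ⟨p⟩
    induction p with
    | nil => exact id
    | @cons a b c hab _ ih =>
      rintro ⟨y, rfl, hy⟩
      apply ih
      rw [SimpleGraph.deleteEdges_adj] at hab
      obtain ⟨h3, h4⟩ := hab
      obtain _ | z := b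
      · have h5 : Quot.out (Q.connectedComponentMk y) = y := h3
        rw [← SimpleGraph.ConnectedComponent.sound hy, hx] at h5
        subst h5
        exact absurd (by rw [Sym2.eq_swap]; rfl) h4
      · exact ⟨z, rfl, hy.trans (SimpleGraph.Adj.reachable h3)⟩
  obtain ⟨y, hy, -⟩ := hinv _ _ hr.symm ⟨x, rfl, SimpleGraph.Reachable.refl _⟩
  exact absurd hy (by simp)

lemma hubGraph_isCentral : IsCentral (hubGraph Q) :=
  ⟨none, fun _ he => isBridge_of_mem_incidenceSet_hub Q he⟩

end HubGraph

section Transfer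

variable {V W : Type*} {H : SimpleGraph V} {H' : SimpleGraph W}

lemma IsCentral.of_iso (f : H ≃g H') (h : IsCentral H) : IsCentral H' := by
  obtain ⟨v, hv⟩ := h
  refine ⟨f v, fun e he => ?_⟩
  obtain ⟨h1, h2⟩ := he
  obtain ⟨w, rfl⟩ := Sym2.mem_iff_exists.1 h2
  obtain ⟨w, rfl⟩ := f.surjective w
  have hadj : H.Adj v w := f.map_adj_iff.1 h1
  have hb := hv s(v, w) ⟨hadj, by simp⟩
  rw [SimpleGraph.isBridge_iff] at hb ⊢
  intro hr
  apply hb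
  let g : H'.deleteEdges {s(f v, f w)} →g H.deleteEdges {s(v, w)} := ⟨f.symm, by
    intro a b hab
    rw [SimpleGraph.deleteEdges_adj] at hab ⊢
    refine ⟨f.symm.map_adj_iff.2 hab.1, fun h3 => hab.2 ?_⟩
    have h4 := congrArg (Sym2.map f) (Set.mem_singleton_iff.1 h3)
    simpa using h4⟩
  have h5 : ∀ x, g (f x) = x := f.symm_apply_apply
  have := hr.map g
  rwa [h5, h5] at this

lemma containsFactor_subset_of_iso [Fintype V] [Fintype W] (f : H ≃g H') (n : ℕ) :
    containsFactor H n ⊆ containsFactor H' n := by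
  rintro F ⟨g, hg⟩
  have hc : n / Fintype.card W = n / Fintype.card V := by
    rw [Fintype.card_congr f.toEquiv]
  refine ⟨fun b => (g (Fin.cast hc b)).comp f.symm.toCopy, fun b b' hbb => ?_⟩
  refine (hg fun h => hbb (Fin.cast_injective hc h)).mono ?_ ?_ <;>
  · rintro _ ⟨x, rfl⟩
    exact ⟨f.symm x, rfl⟩

lemma containsFactor_congr [Fintype V] [Fintype W] (f : H ≃g H') (n : ℕ) :
    containsFactor H n = containsFactor H' n :=
  (containsFactor_subset_of_iso f n).antisymm (containsFactor_subset_of_iso f.symm n)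

end Transfer

/-- Sorting: the elements can be permuted in such a way that the initial segments consist of
elements of the highest levels. -/
lemma exists_perm_le_level {α : Type*} [Fintype α] {K : ℕ} (e : α ≃ Fin K) (lev : α → ℕ) :
    ∃ ρ : Equiv.Perm α, ∀ z j, (e z : ℕ) < (Finset.univ.filter fun z => j ≤ lev z).card →
      j ≤ lev (ρ z) := by
  set f : Fin K → ℕᵒᵈ := fun p => OrderDual.toDual (lev (e.symm p)) with hf
  have hmono := Tuple.monotone_sort f
  refine ⟨(e.trans (Tuple.sort f)).trans e.symm, fun z j hz => ?_⟩
  by_contra hcon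
  have hlt : lev (e.symm (Tuple.sort f (e z))) < j := not_le.1 hcon
  have hsub : (Finset.univ.filter fun z => j ≤ lev z) ⊆
      (Finset.univ.filter fun p : Fin K => p < e z).map
        ((Tuple.sort f).trans e.symm).toEmbedding := by
    intro y hy
    have hy' : j ≤ lev y := (Finset.mem_filter.1 hy).2
    rw [Finset.mem_map_equiv, Finset.mem_filter]
    refine ⟨Finset.mem_univ _, ?_⟩
    by_contra hle
    have h1 := hmono (not_lt.1 hle)
    have h2 : lev (e.symm (Tuple.sort f (((Tuple.sort f).trans e.symm).symm y))) ≤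
      lev (e.symm (Tuple.sort f (e z))) := h1
    simp at h2
    omega
  have := Finset.card_le_card hsub
  rw [Finset.card_map] at this
  have h3 : (Finset.univ.filter fun p : Fin K => p < e z).card = (e z : ℕ) := by
    rw [show (Finset.univ.filter fun p : Fin K => p < e z) = Finset.Iio (e z) by ext; simp,
      Fin.card_Iio]
  omega

/-- A mixed strategy for two kinds of useful edges: those in `S₁`, of gain `g₁`, are preferred
to those in `S₂`, of gain `g₂`. -/
lemma treeMean_greedy_le {n : ℕ} (hn : 1 ≤ n) {Ψ : SimpleGraph (Fin n) → ℝ} (hΨ : Antitone Ψ)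
    {F : SimpleGraph (Fin n)} {S₁ S₂ : Finset (Sym2 (Fin n))} [DecidableEq (Sym2 (Fin n))]
    {g₁ g₂ : ℝ} (h₁ : ∀ e ∈ S₁, Ψ (addEdge F e) ≤ Ψ F - g₁)
    (h₂ : ∀ e ∈ S₂, Ψ (addEdge F e) ≤ Ψ F - g₂) :
    treeMean (fun T => Ψ (addEdge F ((greedy Ψ).select F T))) ≤
      Ψ F - (g₁ * treeMean (hits S₁) +
        g₂ * (treeMean (hits (S₁ ∪ S₂)) - treeMean (hits S₁))) := by
  have h : ∀ T, Ψ (addEdge F ((greedy Ψ).select F T)) ≤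
      Ψ F - (g₁ * hits S₁ T + g₂ * (hits (S₁ ∪ S₂) T - hits S₁ T)) := by
    intro T
    by_cases hT₁ : ∃ e ∈ S₁, e ∈ T.1.edgeSet
    · have hT : ∃ e ∈ S₁ ∪ S₂, e ∈ T.1.edgeSet := by
        obtain ⟨e, he, heT⟩ := hT₁
        exact ⟨e, Finset.mem_union_left _ he, heT⟩
      rw [hits, hits, if_pos hT₁, if_pos hT, sub_self, mul_zero, add_zero, mul_one]
      obtain ⟨e, he, heT⟩ := hT₁
      exact (greedy_le Ψ F T heT).trans (h₁ e he)
    · by_cases hT : ∃ e ∈ S₁ ∪ S₂, e ∈ T.1.edgeSet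
      · rw [hits, hits, if_neg hT₁, if_pos hT, mul_zero, zero_add, sub_zero, mul_one]
        obtain ⟨e, he, heT⟩ := hT
        refine (greedy_le Ψ F T heT).trans (h₂ e ?_)
        rcases Finset.mem_union.1 he with he | he
        · exact absurd ⟨e, he, heT⟩ hT₁
        · exact he
      · rw [hits, hits, if_neg hT₁, if_neg hT, mul_zero, sub_zero, mul_zero, add_zero, sub_zero]
        exact greedy_le_self hΨ F T
  have := treeMean_mono h
  rwa [treeMean_sub, treeMean_const hn, treeMean_add, treeMean_mul, treeMean_mul,
    treeMean_sub] at this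

/-- The exponential bounds behind the drift of the first stage: a decrease of `2 / p` that
occurs with probability `p` outweighs an increase of `1`. -/
lemma exp_drift {p ε : ℝ} (hp : 0 < p) (hp1 : p ≤ 1) (hε : 0 < ε) (hεp : ε ≤ p / 3) :
    (1 - p) * (Real.exp ε - 1) ≤ ε ∧ ε ≤ p * (1 - Real.exp (-(ε * (2 / p)))) := by
  constructor
  · have h1 : Real.exp ε * (1 - ε) ≤ 1 := by
      have h2 : 1 - ε ≤ Real.exp (-ε) := by linarith [Real.add_one_le_exp (-ε)]
      calc Real.exp ε * (1 - ε) ≤ Real.exp ε * Real.exp (-ε) := by gcongr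
        _ = 1 := by rw [← Real.exp_add]; simp
    have h3 : Real.exp ε - 1 ≤ ε / (1 - ε) := by
      rw [le_div_iff₀ (by linarith)]
      nlinarith
    calc (1 - p) * (Real.exp ε - 1) ≤ (1 - p) * (ε / (1 - ε)) := by
          gcongr
      _ = ε * ((1 - p) / (1 - ε)) := by ring
      _ ≤ ε * 1 := by
          gcongr
          rw [div_le_one (by linarith)]
          linarith
      _ = ε := mul_one ε
  · set y := ε * (2 / p) with hy
    have hy0 : 0 < y := by positivity
    have hyp : p * y = 2 * ε := by rw [hy]; field_simp
    have h5 : 1 + y ≤ Real.exp y := by linarith [Real.add_one_le_exp y]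
    have h6 : Real.exp (-y) ≤ 1 / (1 + y) := by
      rw [Real.exp_neg, ← one_div]
      exact one_div_le_one_div_of_le (by positivity) h5
    have hy1 : y ≤ 1 := by nlinarith
    have h7 : 1 / (1 + y) ≤ 1 - y / 2 := by
      rw [div_le_iff₀ (by positivity)]; nlinarith
    nlinarith

/-! ### Cells, levels and the potential of the first stage -/

section Cells

variable {s m₀ r L n N : ℕ}

/-- The disjoint union of `s` isolated vertices and of `m₀` cells with `r` vertices each. The cell
of index `c` carries the edges `ed i` with `c < m (i + 1)`; thus `m j` of the cells contain the
first `j` of these edges if `m` is antitone. -/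
def cellGraph (s m₀ : ℕ) (m : ℕ → ℕ) (ed : Fin L → Sym2 (Fin r)) :
    SimpleGraph (Fin s ⊕ (Fin m₀ × Fin r)) where
  Adj u w := ∃ c x y, u = Sum.inr (c, x) ∧ w = Sum.inr (c, y) ∧ x ≠ y ∧
    ∃ i : Fin L, ed i = s(x, y) ∧ (c : ℕ) < m (i + 1)
  symm := ⟨by
    rintro _ _ ⟨c, x, y, rfl, rfl, h, i, hi, hc⟩
    exact ⟨c, y, x, rfl, rfl, h.symm, i, by rw [hi, Sym2.eq_swap], hc⟩⟩
  loopless := ⟨by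
    rintro _ ⟨c, x, y, h1, h2, h, -⟩
    rw [h1] at h2
    exact h (Prod.ext_iff.1 (Sum.inr_injective h2)).2⟩

variable (θ : Option (Fin s ⊕ (Fin m₀ × Fin r)) × Fin N → Fin n) (ed : Fin L → Sym2 (Fin r))
  (m : ℕ → ℕ)

/-- The position of the edge `ed i` in the cell `z`, for a placement `θ` of all vertices. -/
def slotEdge (i : Fin L) (z : Fin m₀ × Fin N) : Sym2 (Fin n) :=
  (ed i).map fun x => θ (some (Sum.inr (z.1, x)), z.2)

open scoped Classical in
/-- The level of the cell `z`: the largest `j` such that the first `j` edges are present in it. -/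
noncomputable def level (F : SimpleGraph (Fin n)) (z : Fin m₀ × Fin N) : ℕ :=
  Nat.findGreatest (fun j => ∀ i : Fin L, (i : ℕ) < j → slotEdge θ ed i z ∈ F.edgeSet) L

/-- The number of cells of level at least `j`. -/
noncomputable def levelCount (F : SimpleGraph (Fin n)) (j : ℕ) : ℕ :=
  (Finset.univ.filter fun z => j ≤ level θ ed F z).card

/-- The number of cells that have yet to be raised above level `i`. -/
noncomputable def shortfall (F : SimpleGraph (Fin n)) (i : Fin L) : ℕ :=
  m (i + 1) * N - levelCount θ ed F (i + 1)

/-- The graph `F` contains matchings between the hubs and the `s` classes of leaves with a total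
of `Y` missing edges. -/
def LeafDefect (F : SimpleGraph (Fin n)) (Y : ℕ) : Prop :=
  ∃ (π : Fin s → Equiv.Perm (Fin N)) (D : Fin s → Finset (Fin N)), ∑ l, (D l).card = Y ∧
    ∀ l, ∀ x ∉ D l, F.Adj (θ (none, x)) (θ (some (Sum.inl l), π l x))

/-- The cost of a state of the first stage: the number of useful edges that remain to be built,
with a small relative correction `κ` for the rounds in which nothing useful is offered, and an
exponential term, which becomes large if the leaf edges are in danger of being used up before the
cells are finished: about `w i` rounds are reckoned for raising a cell above level `i`, and one leaf
edge is consumed in each of them. -/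
noncomputable def stageCost (κ ε : ℝ) (w : Fin L → ℝ) (F : SimpleGraph (Fin n)) (Y : ℕ) : ℝ :=
  (1 + κ) * (∑ i, (shortfall θ ed m F i : ℝ) + Y) +
    1 / ε * Real.exp (ε * (∑ i, w i * (shortfall θ ed m F i : ℝ) - Y + N))

/-- The potential of the first stage: the least cost over all matchings of the leaves, and a constant
`W` for the cost of the second stage. -/
noncomputable def firstStage (κ ε : ℝ) (w : Fin L → ℝ) (W : ℝ) (F : SimpleGraph (Fin n)) : ℝ :=
  sInf ((fun Y => stageCost θ ed m κ ε w F Y + W) '' {Y | LeafDefect θ F Y})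

variable {θ ed m} {F F' : SimpleGraph (Fin n)} {κ ε W : ℝ} {w : Fin L → ℝ}

lemma le_level_iff {j : ℕ} (hj : j ≤ L) {z : Fin m₀ × Fin N} :
    j ≤ level θ ed F z ↔ ∀ i : Fin L, (i : ℕ) < j → slotEdge θ ed i z ∈ F.edgeSet := by
  classical
  constructor
  · intro h i hi
    have := Nat.findGreatest_spec
      (P := fun j => ∀ i : Fin L, (i : ℕ) < j → slotEdge θ ed i z ∈ F.edgeSet)
      (Nat.zero_le L) (by intro i hi; omega)
    exact this i (lt_of_lt_of_le hi h)
  · intro h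
    exact Nat.le_findGreatest hj h

lemma levelCount_mono (hF : F ≤ F') {j : ℕ} (hj : j ≤ L) :
    levelCount θ ed F j ≤ levelCount θ ed F' j := by
  refine Finset.card_le_card fun z hz => ?_
  rw [Finset.mem_filter] at hz ⊢
  refine ⟨hz.1, (le_level_iff hj).2 fun i hi => ?_⟩
  exact SimpleGraph.edgeSet_mono hF ((le_level_iff hj).1 hz.2 i hi)

lemma shortfall_anti (hF : F ≤ F') (i : Fin L) : shortfall θ ed m F' i ≤ shortfall θ ed m F i := by
  unfold shortfall
  have := levelCount_mono (θ := θ) (ed := ed) hF (j := i + 1) i.2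
  omega

/-- Adding the next edge to a cell of level `i` decreases the shortfall. -/
lemma shortfall_addEdge {i : Fin L} {z : Fin m₀ × Fin N} (hz : level θ ed F z = i)
    (hd : ¬ (slotEdge θ ed i z).IsDiag) (hi : levelCount θ ed F (i + 1) < m (i + 1) * N) :
    shortfall θ ed m (addEdge F (slotEdge θ ed i z)) i + 1 ≤ shortfall θ ed m F i := by
  classical
  have hle : F ≤ addEdge F (slotEdge θ ed i z) := le_sup_left
  have h1 : levelCount θ ed F (i + 1) + 1 ≤
      levelCount θ ed (addEdge F (slotEdge θ ed i z)) (i + 1) := by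
    unfold levelCount
    rw [← Finset.card_insert_of_notMem (a := z) (by
      rw [Finset.mem_filter, hz]; omega)]
    refine Finset.card_le_card (Finset.insert_subset ?_ fun y hy => ?_)
    · rw [Finset.mem_filter, le_level_iff i.2]
      refine ⟨Finset.mem_univ _, fun i' hi' => ?_⟩
      rw [SimpleGraph.edgeSet_sup, SimpleGraph.edgeSet_fromEdgeSet]
      by_cases h : i' = i
      · subst h
        exact Or.inr ⟨rfl, hd⟩
      · refine Or.inl ((le_level_iff (j := i) i.2.le).1 hz.ge i' ?_)
        have : (i' : ℕ) ≠ i := fun h' => h (Fin.ext h')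
        omega
    · rw [Finset.mem_filter, le_level_iff i.2] at hy ⊢
      exact ⟨hy.1, fun i' hi' => SimpleGraph.edgeSet_mono hle (hy.2 i' hi')⟩
  unfold shortfall
  omega

lemma LeafDefect.mono (hF : F ≤ F') {Y : ℕ} (h : LeafDefect θ F Y) : LeafDefect θ F' Y := by
  obtain ⟨π, D, hD, hm⟩ := h
  exact ⟨π, D, hD, fun l x hx => hF (hm l x hx)⟩

lemma leafDefect_self : LeafDefect θ F (s * N) :=
  ⟨fun _ => 1, fun _ => Finset.univ, by simp, by simp⟩

lemma leafDefect_finite : {Y | LeafDefect θ F Y}.Finite := by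
  refine (Set.finite_Iic (s * N)).subset ?_
  rintro Y ⟨π, D, rfl, -⟩
  have : ∀ l ∈ (Finset.univ : Finset (Fin s)), (D l).card ≤ N := fun l _ => by
    simpa using (D l).card_le_univ
  simpa using Finset.sum_le_card_nsmul _ _ _ this

lemma exists_firstStage_eq : ∃ Y, LeafDefect θ F Y ∧
    firstStage θ ed m κ ε w W F = stageCost θ ed m κ ε w F Y + W := by
  have h : ((fun Y => stageCost θ ed m κ ε w F Y + W) '' {Y | LeafDefect θ F Y}).Nonempty :=
    ⟨_, s * N, leafDefect_self, rfl⟩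
  obtain ⟨Y, hY, he⟩ := h.csInf_mem (leafDefect_finite.image _)
  exact ⟨Y, hY, he.symm⟩

lemma firstStage_le {Y : ℕ} (hY : LeafDefect θ F Y) :
    firstStage θ ed m κ ε w W F ≤ stageCost θ ed m κ ε w F Y + W :=
  csInf_le (leafDefect_finite.image _).bddBelow ⟨Y, hY, rfl⟩

lemma stageCost_anti (hκ : 0 ≤ κ) (hε : 0 < ε) (hw : ∀ i, 0 ≤ w i) (hF : F ≤ F') (Y : ℕ) :
    stageCost θ ed m κ ε w F' Y ≤ stageCost θ ed m κ ε w F Y := by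
  have h : ∀ i, (shortfall θ ed m F' i : ℝ) ≤ shortfall θ ed m F i := fun i => by
    exact_mod_cast shortfall_anti hF i
  have hw' : ∀ i, w i * (shortfall θ ed m F' i : ℝ) ≤ w i * shortfall θ ed m F i := fun i =>
    mul_le_mul_of_nonneg_left (h i) (hw i)
  unfold stageCost
  have h1 := Finset.sum_le_sum fun i (_ : i ∈ Finset.univ) => h i
  have h2 := Finset.sum_le_sum fun i (_ : i ∈ Finset.univ) => hw' i
  gcongr

lemma firstStage_antitone (hκ : 0 ≤ κ) (hε : 0 < ε) (hw : ∀ i, 0 ≤ w i) :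
    Antitone (firstStage θ ed m κ ε w W) := by
  intro F F' hF
  obtain ⟨Y, hY, he⟩ := exists_firstStage_eq (θ := θ) (ed := ed) (m := m) (F := F) (κ := κ)
    (ε := ε) (w := w) (W := W)
  rw [he]
  refine (firstStage_le (hY.mono hF)).trans ?_
  have := stageCost_anti (θ := θ) (ed := ed) (m := m) hκ hε hw hF Y
  linarith

lemma le_stageCost (hκ : 0 ≤ κ) (hε : 0 < ε) (Y : ℕ) : (Y : ℝ) ≤ stageCost θ ed m κ ε w F Y := by
  unfold stageCost
  have h1 : 0 ≤ 1 / ε * Real.exp (ε * (∑ i, w i * (shortfall θ ed m F i : ℝ) - Y + N)) := by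
    positivity
  have h2 : 0 ≤ ∑ i, (shortfall θ ed m F i : ℝ) := by positivity
  have h3 : (0 : ℝ) ≤ Y := Nat.cast_nonneg Y
  nlinarith

/-- The gain of an edge that raises a cell of level `i`. -/
lemma stageCost_addEdge_le (hκ : 0 ≤ κ) (hε : 0 < ε) (hw : ∀ i, 0 ≤ w i) {i : Fin L}
    {z : Fin m₀ × Fin N} (hz : level θ ed F z = i)
    (hd : ¬ (slotEdge θ ed i z).IsDiag) (hi : levelCount θ ed F (i + 1) < m (i + 1) * N) (Y : ℕ) :
    stageCost θ ed m κ ε w (addEdge F (slotEdge θ ed i z)) Y ≤ stageCost θ ed m κ ε w F Y -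
      ((1 + κ) + 1 / ε * Real.exp (ε * (∑ i, w i * (shortfall θ ed m F i : ℝ) - Y + N)) *
        (1 - Real.exp (-(ε * w i)))) := by
  set F' := addEdge F (slotEdge θ ed i z) with hF'
  have hle : F ≤ F' := le_sup_left
  have h : ∀ i, (shortfall θ ed m F' i : ℝ) ≤ shortfall θ ed m F i := fun i => by
    exact_mod_cast shortfall_anti hle i
  have hi' : (shortfall θ ed m F' i : ℝ) + 1 ≤ shortfall θ ed m F i := by
    exact_mod_cast shortfall_addEdge hz hd hi
  have h1 : ∑ i, (shortfall θ ed m F' i : ℝ) + 1 ≤ ∑ i, (shortfall θ ed m F i : ℝ) := by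
    rw [← Finset.add_sum_erase _ _ (Finset.mem_univ i),
      ← Finset.add_sum_erase Finset.univ (fun i => (shortfall θ ed m F i : ℝ))
        (Finset.mem_univ i)]
    have := Finset.sum_le_sum fun j (_ : j ∈ Finset.univ.erase i) => h j
    linarith
  have h2 : ∑ i, w i * (shortfall θ ed m F' i : ℝ) + w i ≤
      ∑ i, w i * (shortfall θ ed m F i : ℝ) := by
    rw [← Finset.add_sum_erase _ _ (Finset.mem_univ i),
      ← Finset.add_sum_erase Finset.univ (fun i => w i * (shortfall θ ed m F i : ℝ))
        (Finset.mem_univ i)]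
    have h3 := Finset.sum_le_sum fun j (_ : j ∈ Finset.univ.erase i) =>
      mul_le_mul_of_nonneg_left (h j) (hw j)
    have h4 := mul_le_mul_of_nonneg_left hi' (hw i)
    linarith
  have h5 : Real.exp (ε * (∑ i, w i * (shortfall θ ed m F' i : ℝ) - Y + N)) ≤
      Real.exp (ε * (∑ i, w i * (shortfall θ ed m F i : ℝ) - Y + N)) *
        Real.exp (-(ε * w i)) := by
    rw [← Real.exp_add]
    apply Real.exp_le_exp.2
    have := mul_le_mul_of_nonneg_left h2 hε.le
    linarith
  have h6 := mul_le_mul_of_nonneg_left h5 (by positivity : 0 ≤ 1 / ε)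
  have h7 := mul_le_mul_of_nonneg_left h1 (by linarith : 0 ≤ 1 + κ)
  unfold stageCost
  linarith

/-- The cost after a leaf edge has been added. -/
lemma stageCost_pred (hκ : 0 ≤ κ) (hε : 0 < ε) (hw : ∀ i, 0 ≤ w i) (hF : F ≤ F') (Y : ℕ) :
    stageCost θ ed m κ ε w F' Y ≤ stageCost θ ed m κ ε w F (Y + 1) -
      ((1 + κ) - 1 / ε *
        Real.exp (ε * (∑ i, w i * (shortfall θ ed m F i : ℝ) - (Y + 1 : ℕ) + N)) *
          (Real.exp ε - 1)) := by
  refine (stageCost_anti hκ hε hw hF Y).trans (le_of_eq ?_)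
  unfold stageCost
  have : Real.exp (ε * (∑ i, w i * (shortfall θ ed m F i : ℝ) - Y + N)) =
      Real.exp (ε * (∑ i, w i * (shortfall θ ed m F i : ℝ) - (Y + 1 : ℕ) + N)) *
        Real.exp ε := by
    rw [← Real.exp_add]
    congr 1
    push_cast
    ring
  rw [this]
  push_cast
  ring

open scoped Classical in
/-- As long as `Y` leaf edges are missing, there are at least `(Y / s) ^ 2` edges which decrease
`Y`, namely those between unmatched vertices for the leaf class with the largest defect. -/
lemma exists_leaf_edges (hθ : Function.Injective θ) {Y : ℕ} (hY : LeafDefect θ F Y) (hpos : 0 < Y) :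
    ∃ S : Finset (Sym2 (Fin n)), (∀ e ∈ S, ¬ e.IsDiag) ∧ Y ^ 2 ≤ s ^ 2 * S.card ∧
      ∀ e ∈ S, ∃ Y', Y = Y' + 1 ∧ LeafDefect θ (addEdge F e) Y' := by
  obtain ⟨π, D, hD, hm⟩ := hY
  have hs : (Finset.univ : Finset (Fin s)).Nonempty := by
    rw [Finset.nonempty_iff_ne_empty]
    intro h
    rw [h] at hD
    simp at hD
    omega
  obtain ⟨l, -, hl⟩ := Finset.exists_le_of_sum_le (f := fun _ : Fin s => Y)
    (g := fun l => s * (D l).card) hs (by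
      rw [← Finset.mul_sum, hD]
      simp)
  set g : Fin N × Fin N → Sym2 (Fin n) := fun p => s(θ (none, p.1), θ (some (Sum.inl l), p.2))
    with hg
  have hginj : Function.Injective g := by
    rintro ⟨x, y⟩ ⟨x', y'⟩ h
    rcases Sym2.eq_iff.1 h with ⟨h1, h2⟩ | ⟨h1, -⟩
    · exact Prod.ext (Prod.ext_iff.1 (hθ h1)).2 (Prod.ext_iff.1 (hθ h2)).2
    · exact absurd (Prod.ext_iff.1 (hθ h1)).1 (by simp)
  have hgd : ∀ p, ¬ (g p).IsDiag := by
    intro p h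
    exact absurd (Prod.ext_iff.1 (hθ (Sym2.mk_isDiag_iff.1 h))).1 (by simp)
  refine ⟨(D l ×ˢ (D l).map (π l).toEmbedding).map ⟨g, hginj⟩, ?_, ?_, ?_⟩
  · intro e he
    obtain ⟨p, -, rfl⟩ := Finset.mem_map.1 he
    exact hgd p
  · rw [Finset.card_map, Finset.card_product, Finset.card_map]
    calc Y ^ 2 ≤ (s * (D l).card) ^ 2 := Nat.pow_le_pow_left hl 2
      _ = _ := by ring
  · intro e he
    obtain ⟨⟨i, y⟩, hp, rfl⟩ := Finset.mem_map.1 he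
    simp only [Finset.mem_product, Finset.mem_map, Equiv.coe_toEmbedding] at hp
    obtain ⟨hi, j, hj, rfl⟩ := hp
    obtain ⟨π', D', hD', hm'⟩ := exists_perm_of_addPair
      (R := fun x y => F.Adj (θ (none, x)) (θ (some (Sum.inl l), y))) (hm l) hi hj
    refine ⟨∑ l', (Function.update D l D' l').card, ?_, Function.update π l π',
      Function.update D l D', rfl, ?_⟩
    · rw [← hD, ← Finset.add_sum_erase _ _ (Finset.mem_univ l),
        ← Finset.add_sum_erase Finset.univ (fun l' => (Function.update D l D' l').card)
          (Finset.mem_univ l), Function.update_self, ← hD']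
      have hrest : ∑ l' ∈ Finset.univ.erase l, (Function.update D l D' l').card =
          ∑ l' ∈ Finset.univ.erase l, (D l').card :=
        Finset.sum_congr rfl fun l' hl' => by
          rw [Function.update_of_ne (Finset.ne_of_mem_erase hl')]
      rw [hrest]
      omega
    · intro l' x hx
      by_cases h : l' = l
      · subst h
        rw [Function.update_self] at hx ⊢
        rcases hm' x hx with h1 | ⟨h1, h2⟩
        · exact Or.inl h1
        · refine Or.inr ?_
          rw [h2, h1, SimpleGraph.fromEdgeSet_adj]
          exact ⟨rfl, fun h3 => absurd (Prod.ext_iff.1 (hθ h3)).1 (by simp)⟩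
      · rw [Function.update_of_ne h] at hx ⊢
        exact Or.inl (hm l' x hx)

open scoped Classical in
/-- In the phase in which cells of level `i` are raised, the number of useful edges is at least
the difference of the numbers of cells of level `i` and of level `i + 1` that are aimed at. -/
lemma exists_slot_edges (hθ : Function.Injective θ) (hed : ∀ i, ¬ (ed i).IsDiag) (i : Fin L)
    (hi : m i * N ≤ levelCount θ ed F i) (hi' : levelCount θ ed F (i + 1) < m (i + 1) * N) :
    ∃ S : Finset (Sym2 (Fin n)), (∀ e ∈ S, ¬ e.IsDiag) ∧ (m i - m (i + 1)) * N ≤ S.card ∧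
      ∀ e ∈ S, ∃ z, level θ ed F z = i ∧ e = slotEdge θ ed i z := by
  obtain ⟨x, y, hxy⟩ : ∃ x y, ed i = s(x, y) := by
    induction h : ed i using Sym2.ind with
    | _ x y => exact ⟨x, y, rfl⟩
  have hne : x ≠ y := fun h => hed i (by rw [hxy, h]; exact rfl)
  have hslot : ∀ z, slotEdge θ ed i z =
      s(θ (some (Sum.inr (z.1, x)), z.2), θ (some (Sum.inr (z.1, y)), z.2)) := by
    intro z; unfold slotEdge; rw [hxy]; rfl
  have hinj : Function.Injective (slotEdge θ ed i) := by
    intro z z' h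
    rw [hslot, hslot] at h
    rcases Sym2.eq_iff.1 h with ⟨h1, -⟩ | ⟨h1, -⟩ <;>
    · have h2 := Prod.ext_iff.1 (hθ h1)
      simp only [Option.some.injEq, Sum.inr.injEq, Prod.mk.injEq] at h2
      exact Prod.ext h2.1.1 h2.2
  refine ⟨(Finset.univ.filter fun z => level θ ed F z = i).map ⟨_, hinj⟩, ?_, ?_, ?_⟩
  · intro e he
    obtain ⟨z, -, rfl⟩ := Finset.mem_map.1 he
    simp only [Function.Embedding.coeFn_mk]
    rw [hslot]
    intro h
    have h2 := (Prod.ext_iff.1 (hθ (Sym2.mk_isDiag_iff.1 h))).1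
    simp only [Option.some.injEq, Sum.inr.injEq, Prod.mk.injEq, true_and] at h2
    exact hne h2
  · rw [Finset.card_map]
    have h1 : levelCount θ ed F i ≤ levelCount θ ed F (i + 1) +
        (Finset.univ.filter fun z => level θ ed F z = i).card := by
      unfold levelCount
      refine le_trans (Finset.card_le_card ?_) (Finset.card_union_le _ _)
      intro z hz
      rw [Finset.mem_union, Finset.mem_filter, Finset.mem_filter]
      have := (Finset.mem_filter.1 hz).2
      by_cases h : level θ ed F z = i
      · exact Or.inr ⟨Finset.mem_univ _, h⟩
      · exact Or.inl ⟨Finset.mem_univ _, by omega⟩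
    rw [Nat.sub_mul]
    omega
  · intro e he
    obtain ⟨z, hz, rfl⟩ := Finset.mem_map.1 he
    exact ⟨z, (Finset.mem_filter.1 hz).2, rfl⟩

end Cells

/-! ### Drift of the first stage and placement of the cells -/

section Drift

variable {s m₀ r L n N : ℕ} {θ : Option (Fin s ⊕ (Fin m₀ × Fin r)) × Fin N → Fin n}
  {ed : Fin L → Sym2 (Fin r)} {m : ℕ → ℕ} {F : SimpleGraph (Fin n)} {κ ε W : ℝ} {w : Fin L → ℝ}

/-- Drift in the first stage. As long as there are many leaf edges to be built, hardly any round
is wasted. Once they are scarce, the exponential term is so large that its decrease by the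
edges in the cells compensates for the wasted rounds. -/
lemma firstStage_drift (hn : 1 ≤ n) (hN : 0 < N) (hθ : Function.Injective θ)
    (hed : ∀ i, ¬ (ed i).IsDiag) {Ψ : SimpleGraph (Fin n) → ℝ} (hΨ : Antitone Ψ)
    (hle : ∀ F', Ψ F' ≤ firstStage θ ed m κ ε w W F') (heq : Ψ F = firstStage θ ed m κ ε w W F)
    {i : Fin L} (hi : m i * N ≤ levelCount θ ed F i)
    (hi' : levelCount θ ed F (i + 1) < m (i + 1) * N) {p : ℝ} (hp0 : 0 < p)
    (hp : p ≤ ((m i - m (i + 1)) * N : ℕ) / (n + ((m i - m (i + 1)) * N : ℕ)))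
    (hwi : w i = 2 / p) (hw : ∀ i, 0 ≤ w i) (hε : 0 < ε) (hεp : ε ≤ p / 3) (hκ : 0 ≤ κ)
    (hκ1 : κ ≤ 1) (hκs : 2 * n * (s : ℝ) ^ 2 ≤ κ * (N : ℝ) ^ 2) :
    treeMean (fun T => Ψ (addEdge F ((greedy Ψ).select F T))) + 1 ≤ Ψ F := by
  classical
  have hn' : (0 : ℝ) < n := by exact_mod_cast hn
  have hN' : (0 : ℝ) < N := by exact_mod_cast hN
  obtain ⟨Y, hY, hYeq⟩ := exists_firstStage_eq (θ := θ) (ed := ed) (m := m) (F := F) (κ := κ)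
    (ε := ε) (w := w) (W := W)
  obtain ⟨S₁, hS₁d, hS₁, hS₁e⟩ := exists_slot_edges hθ hed i hi hi'
  have hp1 : p ≤ 1 := hp.trans (div_le_one_of_le₀ (by linarith) (by positivity))
  obtain ⟨hexp1, hexp2⟩ := exp_drift hp0 hp1 hε hεp
  set E := Real.exp (ε * (∑ i, w i * (shortfall θ ed m F i : ℝ) - Y + N)) with hE
  have hEpos : 0 < E := Real.exp_pos _
  set a := 1 - Real.exp (-(ε * w i)) with ha
  rw [← hwi, ← ha] at hexp2
  have ha0 : 0 ≤ a := by nlinarith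
  have hgain₁ : ∀ e ∈ S₁, Ψ (addEdge F e) ≤ Ψ F - ((1 + κ) + 1 / ε * E * a) := by
    intro e he
    obtain ⟨z, hz, rfl⟩ := hS₁e e he
    refine (hle _).trans ((firstStage_le (hY.mono le_sup_left)).trans ?_)
    have := stageCost_addEdge_le (w := w) hκ hε hw hz (hS₁d _ he) hi' Y
    rw [heq, hYeq]
    linarith
  have hh₁ : p ≤ treeMean (hits S₁) := by
    refine hp.trans (le_trans ?_ (le_treeMean_hits hn S₁ hS₁d))
    have h1 : (((m i - m (i + 1)) * N : ℕ) : ℝ) ≤ S₁.card := by exact_mod_cast hS₁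
    rw [div_le_div_iff₀ (by positivity) (by positivity)]
    nlinarith
  -- leaf edges are regarded as scarce if fewer than `N` of them are missing
  by_cases hYN : Y < N
  · have h1 := treeMean_greedy_le hn hΨ (S₁ := S₁) (S₂ := ∅) (g₂ := 0) hgain₁ (by simp)
    have hE1 : 1 ≤ E := by
      apply Real.one_le_exp
      have h2 : 0 ≤ ∑ i, w i * (shortfall θ ed m F i : ℝ) :=
        Finset.sum_nonneg fun i _ => mul_nonneg (hw i) (Nat.cast_nonneg _)
      have h3 : (Y : ℝ) ≤ N := by exact_mod_cast hYN.le
      have : 0 ≤ ∑ i, w i * (shortfall θ ed m F i : ℝ) - Y + N := by linarith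
      positivity
    have h2 : 1 ≤ ((1 + κ) + 1 / ε * E * a) * treeMean (hits S₁) := by
      calc (1 : ℝ) = 1 / ε * 1 * ε := by field_simp
        _ ≤ 1 / ε * E * (p * a) := by gcongr
        _ = (1 / ε * E * a) * p := by ring
        _ ≤ (1 / ε * E * a) * treeMean (hits S₁) := by gcongr
        _ ≤ _ := by
          gcongr
          · exact hp0.le.trans hh₁
          · linarith
    linarith
  · have hYpos : 0 < Y := by omega
    obtain ⟨S₂, hS₂d, hS₂, hS₂e⟩ := exists_leaf_edges hθ hY hYpos
    have hgain₂ : ∀ e ∈ S₂, Ψ (addEdge F e) ≤ Ψ F -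
        ((1 + κ) - 1 / ε * E * (Real.exp ε - 1)) := by
      intro e he
      obtain ⟨Y', rfl, hY'⟩ := hS₂e e he
      refine (hle _).trans ((firstStage_le hY').trans ?_)
      have := stageCost_pred (θ := θ) (ed := ed) (m := m) (w := w) hκ hε hw
        (le_sup_left : F ≤ addEdge F e) Y'
      rw [heq, hYeq]
      linarith
    have h1 := treeMean_greedy_le hn hΨ hgain₁ hgain₂
    have hd : ∀ e ∈ S₁ ∪ S₂, ¬ e.IsDiag := fun e he => by
      rcases Finset.mem_union.1 he with he | he
      · exact hS₁d e he
      · exact hS₂d e he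
    -- some useful edge is offered with probability at least `1 - κ / 2`
    have hh : 1 - κ / 2 ≤ treeMean (hits (S₁ ∪ S₂)) := by
      refine le_trans ?_ (le_treeMean_hits hn _ hd)
      have h2 : (S₂.card : ℝ) ≤ (S₁ ∪ S₂).card := by
        exact_mod_cast Finset.card_le_card Finset.subset_union_right
      have h3 : (N : ℝ) ^ 2 ≤ s ^ 2 * S₂.card := by
        have : N ^ 2 ≤ s ^ 2 * S₂.card := (Nat.pow_le_pow_left (not_lt.1 hYN) 2).trans hS₂
        exact_mod_cast this
      have hc : (0 : ℝ) ≤ (S₁ ∪ S₂).card := Nat.cast_nonneg _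
      have h4 : (N : ℝ) ^ 2 ≤ s ^ 2 * (S₁ ∪ S₂).card := h3.trans (by gcongr)
      -- `2 n ≤ κ |S₁ ∪ S₂|`
      have h5 : 2 * (n : ℝ) ≤ κ * (S₁ ∪ S₂).card := by
        have hs2 : (0 : ℝ) < s ^ 2 := by
          by_contra hneg
          have : (s : ℝ) ^ 2 = 0 := le_antisymm (not_lt.1 hneg) (by positivity)
          rw [this] at h4
          nlinarith
        have h6 : 2 * n * (s : ℝ) ^ 2 ≤ κ * (S₁ ∪ S₂).card * s ^ 2 := by
          calc _ ≤ κ * (N : ℝ) ^ 2 := hκs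
            _ ≤ κ * (s ^ 2 * (S₁ ∪ S₂).card) := by gcongr
            _ = _ := by ring
        exact le_of_mul_le_mul_right h6 hs2
      rw [le_div_iff₀ (by positivity)]
      nlinarith
    have hh1 : treeMean (hits (S₁ ∪ S₂)) ≤ 1 := by
      rw [← treeMean_const hn 1]
      exact treeMean_mono fun T => hits_le_one _ T
    set h₁ := treeMean (hits S₁) with hh₁def
    set h := treeMean (hits (S₁ ∪ S₂)) with hhdef
    have hG : 0 ≤ 1 / ε * E := by positivity
    have hbr : 0 ≤ h₁ * a - (h - h₁) * (Real.exp ε - 1) := by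
      have he0 : 0 ≤ Real.exp ε - 1 := by linarith [Real.add_one_le_exp ε]
      have h2 : (h - h₁) * (Real.exp ε - 1) ≤ (1 - p) * (Real.exp ε - 1) := by
        gcongr
      have h3 : p * a ≤ h₁ * a := by gcongr
      linarith
    have h2 : 1 ≤ ((1 + κ) + 1 / ε * E * a) * h₁ +
        ((1 + κ) - 1 / ε * E * (Real.exp ε - 1)) * (h - h₁) := by
      have h3 : ((1 + κ) + 1 / ε * E * a) * h₁ +
          ((1 + κ) - 1 / ε * E * (Real.exp ε - 1)) * (h - h₁) =
          (1 + κ) * h + 1 / ε * E * (h₁ * a - (h - h₁) * (Real.exp ε - 1)) := by ring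
      rw [h3]
      have h4 := mul_nonneg hG hbr
      have h5 : 1 ≤ (1 + κ) * h := by
        have : (1 + κ) * (1 - κ / 2) ≤ (1 + κ) * h := by gcongr
        nlinarith
      linarith
    linarith

end Drift

section HubPlacement

variable {s m₀ r L n N : ℕ}

/-- The placement that results from `θ` by a permutation of the cells. -/
def permPlacement (θ : Option (Fin s ⊕ (Fin m₀ × Fin r)) × Fin N → Fin n)
    (ρ : Equiv.Perm (Fin m₀ × Fin N)) : Option (Fin s ⊕ (Fin m₀ × Fin r)) × Fin N → Fin n
  | (none, b) => θ (none, b)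
  | (some (Sum.inl l), b) => θ (some (Sum.inl l), b)
  | (some (Sum.inr (c, x)), b) => θ (some (Sum.inr ((ρ (c, b)).1, x)), (ρ (c, b)).2)

variable {θ : Option (Fin s ⊕ (Fin m₀ × Fin r)) × Fin N → Fin n} {ed : Fin L → Sym2 (Fin r)}
  {m : ℕ → ℕ} {F : SimpleGraph (Fin n)}

lemma permPlacement_injective (hθ : Function.Injective θ) (ρ : Equiv.Perm (Fin m₀ × Fin N)) :
    Function.Injective (permPlacement θ ρ) := by
  rintro ⟨_ | l | ⟨c, x⟩, b⟩ ⟨_ | l' | ⟨c', x'⟩, b'⟩ h <;> have h' := hθ h <;>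
    simp only [Prod.mk.injEq, Option.some.injEq, Sum.inl.injEq, Sum.inr.injEq, reduceCtorEq,
      false_and] at h' ⊢
  · exact h'
  · exact h'
  · obtain ⟨⟨h1, rfl⟩, h2⟩ := h'
    have h3 := ρ.injective (Prod.ext h1 h2)
    simpa using h3

/-- If sufficiently many cells have reached every level, they can be distributed over the copies
of the hub graph. -/
lemma exists_placed_of_levelCount {Br : Finset (Sym2 (Option (Fin s ⊕ (Fin m₀ × Fin r))))}
    (hBr : ∀ e ∈ (hubGraph (cellGraph s m₀ m ed)).incidenceSet none, e ∈ Br)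
    (hc : ∀ i : Fin L, m (i + 1) * N ≤ levelCount θ ed F (i + 1)) :
    ∃ ρ, Placed (hubGraph (cellGraph s m₀ m ed)) Br F (permPlacement θ ρ) := by
  obtain ⟨ρ, hρ⟩ := exists_perm_le_level finProdFinEquiv (level θ ed F)
  refine ⟨ρ, ?_⟩
  rintro (_ | u) (_ | w) b h hn
  · exact h.elim
  · exact absurd (hBr _ ⟨h, by simp⟩) hn
  · exact absurd (hBr _ ⟨h, by simp⟩) hn
  · obtain ⟨c, x, y, rfl, rfl, hxy, i, hi, hcm⟩ := h
    have hlev : (i : ℕ) + 1 ≤ level θ ed F (ρ (c, b)) := by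
      apply hρ
      refine lt_of_lt_of_le ?_ (hc i)
      rw [finProdFinEquiv_apply_val]
      calc (b : ℕ) + N * c < N + N * c := by have := b.2; omega
        _ = N * (c + 1) := by ring
        _ ≤ N * m (i + 1) := Nat.mul_le_mul_left _ hcm
        _ = m (i + 1) * N := mul_comm _ _
    have := (le_level_iff i.2).1 hlev i (Nat.lt_succ_self _)
    unfold slotEdge at this
    rw [hi] at this
    exact this

/-- A leaf is a component by itself and hence joined to the hub. -/
lemma leaf_mem_incidenceSet (l : Fin s) : s(none, some (Sum.inl l)) ∈
    (hubGraph (cellGraph s m₀ m ed)).incidenceSet none := by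
  refine ⟨?_, by simp⟩
  change Quot.out ((cellGraph s m₀ m ed).connectedComponentMk (Sum.inl l)) = Sum.inl l
  have h : (cellGraph s m₀ m ed).Reachable (Sum.inl l)
      (Quot.out ((cellGraph s m₀ m ed).connectedComponentMk (Sum.inl l))) :=
    SimpleGraph.ConnectedComponent.exact (Quot.out_eq _).symm
  obtain ⟨p⟩ := h
  generalize Quot.out ((cellGraph s m₀ m ed).connectedComponentMk (Sum.inl l)) = y at p
  cases p with
  | nil => rfl
  | cons h _ =>
    obtain ⟨c, x, y, h1, -⟩ := h
    exact absurd h1 (by simp)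

/-- The edges of the cells and the edges at the hub are different edges of the hub graph. -/
lemma sum_add_card_le_ncard_edgeSet (hed : ∀ i, ¬ (ed i).IsDiag) (hinj : Function.Injective ed)
    (hm : ∀ i : Fin L, m (i + 1) ≤ m₀)
    {Br : Finset (Sym2 (Option (Fin s ⊕ (Fin m₀ × Fin r))))}
    (hBr : ∀ e ∈ Br, e ∈ (hubGraph (cellGraph s m₀ m ed)).incidenceSet none) :
    ∑ i : Fin L, m (i + 1) + Br.card ≤
      (hubGraph (cellGraph s m₀ m ed)).edgeSet.ncard := by
  classical
  set g : ((i : Fin L) × Fin (m (i + 1))) → Sym2 (Option (Fin s ⊕ (Fin m₀ × Fin r))) :=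
    fun p => (ed p.1).map fun x => some (Sum.inr (⟨p.2, p.2.2.trans_le (hm p.1)⟩, x)) with hg
  have hginj : Function.Injective g := by
    rintro ⟨i, c⟩ ⟨i', c'⟩ h
    have hcc : (c : ℕ) = c' := by
      simp only [hg] at h
      induction hi : ed i using Sym2.ind with
      | _ x y =>
      induction hi' : ed i' using Sym2.ind with
      | _ x' y' =>
      rw [hi, hi', Sym2.map_mk, Sym2.map_mk] at h
      rcases Sym2.eq_iff.1 h with ⟨h1, -⟩ | ⟨h1, -⟩ <;>
      · simp only [Option.some.injEq, Sum.inr.injEq, Prod.mk.injEq, Fin.mk.injEq] at h1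
        exact h1.1
    have hii : ed i = ed i' := by
      have h2 : (ed i).map (fun x => (some (Sum.inr (⟨c, c.2.trans_le (hm i)⟩, x)) :
          Option (Fin s ⊕ (Fin m₀ × Fin r)))) = (ed i').map (fun x =>
          some (Sum.inr (⟨c, c.2.trans_le (hm i)⟩, x))) := by
        simp only [hg] at h
        rw [h]
        congr 1
        funext x
        simp only [hcc]
      refine Sym2.map.injective ?_ h2
      intro x y hxy
      simpa using hxy
    obtain rfl := hinj hii
    obtain rfl : c = c' := Fin.ext hcc
    rfl
  have hgE : ∀ p, g p ∈ (hubGraph (cellGraph s m₀ m ed)).edgeSet := by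
    rintro ⟨i, c⟩
    simp only [hg]
    have hd := hed i
    induction hi : ed i using Sym2.ind with
    | _ x y =>
    rw [hi] at hd
    exact ⟨_, x, y, rfl, rfl, fun h => hd (Sym2.mk_isDiag_iff.2 h), i, hi, c.2⟩
  have hgn : ∀ p, none ∉ g p := by
    rintro ⟨i, c⟩ h
    simp only [hg, Sym2.mem_map] at h
    obtain ⟨x, -, hx⟩ := h
    exact absurd hx (by simp)
  have hdisj : Disjoint (Finset.univ.map ⟨g, hginj⟩) Br := by
    rw [Finset.disjoint_left]
    intro e he heBr
    obtain ⟨p, -, rfl⟩ := Finset.mem_map.1 he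
    exact hgn p (hBr _ heBr).2
  have hcard : (Finset.univ.map ⟨g, hginj⟩ ∪ Br).card = ∑ i : Fin L, m (i + 1) + Br.card := by
    rw [Finset.card_union_of_disjoint hdisj, Finset.card_map, Finset.card_univ, Fintype.card_sigma]
    simp
  rw [← hcard, ← Set.ncard_coe_finset]
  refine Set.ncard_le_ncard ?_ (Set.toFinite _)
  intro e he
  rcases Finset.mem_union.1 (Finset.mem_coe.1 he) with he | he
  · obtain ⟨p, -, rfl⟩ := Finset.mem_map.1 he
    exact hgE p
  · exact (hBr e he).1

/-- A partial matching bounds the cost, whatever the orientation of the edge. -/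
lemma matchCost_linkRel_le {V : Type*} {φ : V × Fin N → Fin n} {u v : V} (π : Equiv.Perm (Fin N))
    (D : Finset (Fin N)) (h : ∀ x ∉ D, F.Adj (φ (u, x)) (φ (v, π x))) :
    matchCost n (linkRel F φ s(u, v)) ≤ D.card + waste n N := by
  have hout : s((Quot.out s(u, v)).1, (Quot.out s(u, v)).2) = s(u, v) := Quot.out_eq _
  rcases Sym2.eq_iff.1 hout with ⟨h1, h2⟩ | ⟨h1, h2⟩
  · refine matchCost_le_of_card n π D fun x hx => ?_
    unfold linkRel
    rw [h1, h2]
    exact h x hx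
  · rw [← Finset.card_map π.toEmbedding]
    refine matchCost_le_of_card n π.symm _ fun x hx => ?_
    unfold linkRel
    rw [h1, h2]
    have := h (π.symm x) fun hD => hx (Finset.mem_map_equiv.2 hD)
    rw [Equiv.apply_symm_apply] at this
    exact this.symm

/-- The number of missing leaf edges bounds the cost of a placement. -/
lemma placeCost_permPlacement_le {Br : Finset (Sym2 (Option (Fin s ⊕ (Fin m₀ × Fin r))))}
    (hBr : ∀ l : Fin s, s(none, some (Sum.inl l)) ∈ Br) {Y : ℕ} (hY : LeafDefect θ F Y)
    (ρ : Equiv.Perm (Fin m₀ × Fin N)) :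
    placeCost Br F (permPlacement θ ρ) ≤
      Y + (Br.card * waste n N + ((Br.card : ℝ) - s) * N) := by
  classical
  obtain ⟨π, D, rfl, hm⟩ := hY
  set f : Fin s ↪ Sym2 (Option (Fin s ⊕ (Fin m₀ × Fin r))) :=
    ⟨fun l => s(none, some (Sum.inl l)), fun l l' h => by
      rcases Sym2.eq_iff.1 h with ⟨-, h1⟩ | ⟨h1, -⟩
      · simpa using h1
      · simp at h1⟩ with hf
  have hsub : Finset.univ.map f ⊆ Br := by
    intro e he
    obtain ⟨l, -, rfl⟩ := Finset.mem_map.1 he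
    exact hBr l
  have hcard : (Finset.univ.map f).card = s := by simp
  unfold placeCost
  rw [← Finset.sum_sdiff hsub, Finset.sum_map]
  have h1 : ∑ l, matchCost n (linkRel F (permPlacement θ ρ) (f l)) ≤
      ∑ l, ((D l).card + waste n N) :=
    Finset.sum_le_sum fun l _ => matchCost_linkRel_le (π l) (D l) (hm l)
  have h2 : ∑ e ∈ Br \ Finset.univ.map f, matchCost n (linkRel F (permPlacement θ ρ) e) ≤
      ((Br.card : ℝ) - s) * (N + waste n N) := by
    have h3 : ((Br \ Finset.univ.map f).card : ℝ) = (Br.card : ℝ) - s := by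
      have h4 := Finset.card_le_card hsub
      rw [hcard] at h4
      rw [Finset.card_sdiff_of_subset hsub, hcard, Nat.cast_sub h4]
    rw [← h3, ← nsmul_eq_mul]
    refine Finset.sum_le_card_nsmul _ _ _ fun e _ => ?_
    have := matchCost_le_of_card n (R := linkRel F (permPlacement θ ρ) e) 1 Finset.univ (by simp)
    simpa using this
  rw [Finset.sum_add_distrib, Finset.sum_const, Finset.card_univ, Fintype.card_fin,
    nsmul_eq_mul] at h1
  push_cast
  linarith

end HubPlacement

/-! ### Central graphs with factors in optimal time -/

/-- The arithmetic of the initial value of the potential of a hub graph: `N` factors with `E` edges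
each are paid for, and everything else is of the order of `x`. -/
lemma stage_budget_le {A κ N D S B K ε X x c U E : ℝ} (hκ : 0 ≤ κ) (hA : A ≤ (D + S) * N)
    (hK : κ * N ≤ K) (hDS : 0 ≤ D + S) (hN : 0 ≤ N) (hε : 0 < ε) (hX : X ≤ 1) (hx : 1 ≤ x)
    (hB : 0 ≤ B) (hU : U ≤ c * x) (hE : D + B ≤ E) :
    (1 + κ) * A + 1 / ε * X + (B * U + (B - S) * N) ≤ N * E + (K * (D + S) + 1 / ε + B * c) * x := by
  have hK0 : 0 ≤ K := (mul_nonneg hκ hN).trans hK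
  have h1 : (1 + κ) * A ≤ (1 + κ) * ((D + S) * N) := by gcongr
  have h2 : κ * N * (D + S) ≤ K * (D + S) * x := by
    calc κ * N * (D + S) ≤ K * (D + S) := by gcongr
      _ ≤ K * (D + S) * x := le_mul_of_one_le_right (by positivity) hx
  have h3 : 1 / ε * X ≤ 1 / ε * x := by gcongr; exact hX.trans hx
  have h4 : B * U ≤ B * (c * x) := by gcongr
  have h5 : (D + B) * N ≤ E * N := by gcongr
  linarith

/-- Factors of the hub graphs are built in asymptotically optimal time if the number `s` of leaves
is large enough for there to be leaf edges left when the cells are finished. -/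
lemma hubGraph_exists_strategy {s m₀ r L : ℕ} {ed : Fin L → Sym2 (Fin r)}
    (hed : ∀ i, ¬ (ed i).IsDiag) (hinj : Function.Injective ed) {m : ℕ → ℕ} (hm0 : m 0 = m₀)
    (hm : ∀ i < L, m (i + 1) < m i) {k : ℕ}
    (hk : k = Fintype.card (Option (Fin s ⊕ (Fin m₀ × Fin r))))
    (hbudget : ∑ i : Fin L, 2 * ((m (i + 1) : ℝ) + 2 * k * m (i + 1) / (m i - m (i + 1) : ℕ)) + 1
      ≤ s) (ω : ℕ → ℝ) (hω : Tendsto ω atTop atTop) :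
    ∃ σ : ∀ n, Strategy n, BuildsFactorWhp (hubGraph (cellGraph s m₀ m ed)) σ fun n =>
      (n : ℝ) * ((hubGraph (cellGraph s m₀ m ed)).edgeSet.ncard : ℝ) / (k : ℝ) +
        ω n * (n : ℝ) ^ (3 / 4 : ℝ) := by
  classical
  set V := Option (Fin s ⊕ (Fin m₀ × Fin r)) with hV
  set H := hubGraph (cellGraph s m₀ m ed) with hH
  subst hk
  set k := Fintype.card V with hk
  have hkpos : 0 < k := Fintype.card_pos
  have hkR : (0 : ℝ) < k := by exact_mod_cast hkpos
  set Br : Finset (Sym2 V) := (Set.toFinite (H.incidenceSet none)).toFinset with hBrdef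
  have hBrmem : ∀ e, e ∈ Br ↔ e ∈ H.incidenceSet none := fun e => by simp [hBrdef]
  have hBr : ∀ e ∈ Br, H.IsBridge e := fun e he =>
    isBridge_of_mem_incidenceSet_hub _ ((hBrmem e).1 he)
  have hleaf : ∀ l : Fin s, s(none, some (Sum.inl l)) ∈ Br := fun l =>
    (hBrmem _).2 (leaf_mem_incidenceSet l)
  have hmle : ∀ i : Fin L, m (i + 1) ≤ m₀ := by
    have h : ∀ j, j ≤ L → m j ≤ m₀ := by
      intro j
      induction j with
      | zero => intro _; exact hm0.le
      | succ j ih => intro h; exact (hm j (by omega)).le.trans (ih (by omega))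
    exact fun i => h _ i.2
  have hedges := sum_add_card_le_ncard_edgeSet hed hinj hmle fun e he => (hBrmem e).1 he
  have hsBr : (s : ℝ) ≤ Br.card := by
    have h1 : (Finset.univ.image fun l : Fin s => (s(none, some (Sum.inl l)) : Sym2 V)) ⊆ Br := by
      intro e he
      obtain ⟨l, -, rfl⟩ := Finset.mem_image.1 he
      exact hleaf l
    have h2 := Finset.card_le_card h1
    rw [Finset.card_image_of_injective _ (by
      intro l l' h
      rcases Sym2.eq_iff.1 h with ⟨-, h3⟩ | ⟨h3, -⟩
      · exact Sum.inl_injective (Option.some_injective _ h3)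
      · cases h3), Finset.card_univ, Fintype.card_fin] at h2
    exact_mod_cast h2
  choose θ hθ using fun n => exists_injective_placement V n
  -- `p n i` bounds the probability that a cell of level `i` can be raised from below, and `w n i`
  -- is twice the mean waiting time; `ε` is chosen so small that `ε ≤ p n i / 3`, and `κ n`, of
  -- order `1 / n`, bounds twice the probability that no leaf edge is offered
  set ε : ℝ := 1 / (3 * (1 + 2 * k)) with hε
  have hεpos : 0 < ε := by positivity
  set p : ℕ → Fin L → ℝ := fun n i =>
    ((m i - m (i + 1)) * (n / k) : ℕ) / (n + ((m i - m (i + 1)) * (n / k) : ℕ)) with hp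
  set w : ℕ → Fin L → ℝ := fun n i => 2 / p n i with hw
  have hw0 : ∀ n i, 0 ≤ w n i := fun n i => by positivity
  set κ : ℕ → ℝ := fun n => 2 * n * (s : ℝ) ^ 2 / ((n / k : ℕ) : ℝ) ^ 2 with hκ
  have hκ0 : ∀ n, 0 ≤ κ n := fun n => by positivity
  set W : ℕ → ℝ := fun n => Br.card * waste n (n / k) + ((Br.card : ℝ) - s) * (n / k : ℕ) with hW
  have hW0 : ∀ n, 0 ≤ W n := fun n => by
    have h1 := waste_nonneg n (n / k)
    have h2 : 0 ≤ (Br.card : ℝ) - s := by linarith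
    positivity
  set Ψ₁ : ∀ n, SimpleGraph (Fin n) → ℝ := fun n =>
    firstStage (θ n) ed m (κ n) ε (w n) (W n) with hΨ₁
  set Φ : ∀ n, Set (V × Fin (n / k) → Fin n) := fun n => Set.range (permPlacement (θ n)) with hΦ
  set Ψ : ∀ n, SimpleGraph (Fin n) → ℝ := fun n => potential H Br (Φ n) (Ψ₁ n) with hΨ
  have hΨ₁0 : ∀ n F, 0 ≤ Ψ₁ n F := by
    intro n F
    obtain ⟨Y, -, he⟩ := exists_firstStage_eq (θ := θ n) (ed := ed) (m := m) (F := F) (κ := κ n)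
      (ε := ε) (w := w n) (W := W n)
    have h1 : (Y : ℝ) ≤ stageCost (θ n) ed m (κ n) ε (w n) F Y := le_stageCost (hκ0 n) hεpos Y
    have h2 : (0 : ℝ) ≤ Y := Nat.cast_nonneg Y
    have h3 := hW0 n
    simp only [hΨ₁]
    rw [he]
    linarith
  have hle : ∀ n F, ∀ φ ∈ Φ n, Placed H Br F φ → placeCost Br F φ ≤ Ψ₁ n F := by
    rintro n F _ ⟨ρ, rfl⟩ -
    obtain ⟨Y, hY, he⟩ := exists_firstStage_eq (θ := θ n) (ed := ed) (m := m) (F := F) (κ := κ n)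
      (ε := ε) (w := w n) (W := W n)
    have h1 : (Y : ℝ) ≤ stageCost (θ n) ed m (κ n) ε (w n) F Y := le_stageCost (hκ0 n) hεpos Y
    have h2 := placeCost_permPlacement_le hleaf hY ρ
    simp only [hΨ₁]
    rw [he]
    linarith
  have hanti : ∀ n, Antitone (Ψ n) := fun n =>
    potential_antitone (firstStage_antitone (hκ0 n) hεpos (hw0 n)) (hle n)
  refine ⟨_, buildsFactorWhp_of_drift H
    (C := 4 * k * s ^ 2 * (∑ i : Fin L, (m (i + 1) : ℝ) + s) + 1 / ε +
      Br.card * (8 + 8 * (2 * k))) Ψ ?_ ?_ ?_ ω hω⟩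
  · exact fun n F => potential_nonneg (hΨ₁0 n) F
  · filter_upwards [eventually_large hkpos (4 * k * s ^ 2)] with n ⟨hn1, hNpos, hnN, hNl, hc⟩ F hF
    have hN' : (0 : ℝ) < (n / k : ℕ) := by exact_mod_cast hNpos
    by_cases hpl : ∃ φ ∈ Φ n, Placed H Br F φ
    · have hprog : Progress (Ψ n) (1 + collectNum n) F :=
        potential_progress hBr hNl (by rintro _ ⟨ρ, rfl⟩; exact permPlacement_injective (hθ n) ρ)
          hF hpl
      exact hprog.drift hn1 (hanti n)
    · have hex : ∃ j, ∃ h : j < L,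
          levelCount (θ n) ed F (j + 1) < m (j + 1) * (n / k) := by
        by_contra hcon
        push Not at hcon
        obtain ⟨ρ, hρ⟩ := exists_placed_of_levelCount (θ := θ n) (ed := ed) (m := m) (F := F)
          (fun e he => (hBrmem e).2 he) fun i => hcon i i.2
        exact hpl ⟨_, ⟨ρ, rfl⟩, hρ⟩
      -- the first level which too few cells have reached
      obtain ⟨hjL, hj⟩ := Nat.find_spec hex
      have hjmin : m (Nat.find hex) * (n / k) ≤ levelCount (θ n) ed F (Nat.find hex) := by
        rcases h : Nat.find hex with _ | j
        · rw [hm0]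
          unfold levelCount
          simp
          exact le_rfl
        · by_contra hlt
          exact Nat.find_min hex (m := j) (by omega) ⟨by omega, not_le.1 hlt⟩
      set i : Fin L := ⟨Nat.find hex, hjL⟩ with hi
      have hsz : n / k ≤ (m i - m (i + 1)) * (n / k) := by
        have := hm i i.2
        exact Nat.le_mul_of_pos_left _ (by omega)
      have hsz' : ((n / k : ℕ) : ℝ) ≤ ((m i - m (i + 1)) * (n / k) : ℕ) := by exact_mod_cast hsz
      have hplow : 1 / (1 + 2 * (k : ℝ)) ≤ p n i := by
        simp only [hp]
        rw [div_le_div_iff₀ (by positivity) (by linarith [(Nat.cast_nonneg n : (0 : ℝ) ≤ n)])]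
        nlinarith
      refine firstStage_drift hn1 hNpos (hθ n) hed (hanti n) (fun F' => potential_le (hle n F'))
        (potential_of_not hpl) (i := i) hjmin hj (p := p n i)
        (lt_of_lt_of_le (by positivity) hplow) le_rfl rfl (hw0 n) hεpos ?_ (hκ0 n) ?_ ?_
      · rw [hε, show 1 / (3 * (1 + 2 * (k : ℝ))) = 1 / (1 + 2 * (k : ℝ)) / 3 by field_simp]
        gcongr
      · simp only [hκ]
        rw [div_le_one (by positivity)]
        have h1 : 4 * k * s ^ 2 ≤ n / k := by omega
        have h2 : 4 * (k : ℝ) * s ^ 2 ≤ (n / k : ℕ) := by exact_mod_cast h1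
        calc 2 * (n : ℝ) * s ^ 2 ≤ 2 * (2 * k * (n / k : ℕ)) * s ^ 2 := by gcongr
          _ = 4 * (k : ℝ) * s ^ 2 * (n / k : ℕ) := by ring
          _ ≤ (n / k : ℕ) * (n / k : ℕ) := by gcongr
          _ = _ := by ring
      · simp only [hκ]
        rw [div_mul_cancel₀ _ (by positivity)]
  · filter_upwards [eventually_large hkpos 0] with n hn
    obtain ⟨hn1, hNpos, hnN, -, -⟩ := hn
    have hN' : (0 : ℝ) < (n / k : ℕ) := by exact_mod_cast hNpos
    have hn' : (0 : ℝ) < n := by exact_mod_cast hn1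
    refine (potential_le (hle n ⊥)).trans ?_
    simp only [hΨ₁]
    refine (firstStage_le leafDefect_self).trans ?_
    have hsf : ∀ i, (shortfall (θ n) ed m ⊥ i : ℝ) ≤ m (i + 1) * (n / k : ℕ) := fun i => by
      have : shortfall (θ n) ed m ⊥ i ≤ m (i + 1) * (n / k) := Nat.sub_le _ _
      exact_mod_cast this
    have hsum1 : ∑ i, (shortfall (θ n) ed m ⊥ i : ℝ) ≤
        (∑ i : Fin L, (m (i + 1) : ℝ)) * (n / k : ℕ) := by
      rw [Finset.sum_mul]
      exact Finset.sum_le_sum fun i _ => hsf i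
    have hsum2 : ∑ i, w n i * (shortfall (θ n) ed m ⊥ i : ℝ) ≤ ((s : ℝ) - 1) * (n / k : ℕ) := by
      have h1 : ∀ i : Fin L, w n i * (shortfall (θ n) ed m ⊥ i : ℝ) ≤
          (2 * ((m (i + 1) : ℝ) + 2 * k * m (i + 1) / (m i - m (i + 1) : ℕ))) *
            (n / k : ℕ) := by
        intro i
        have hdpos : 0 < m i - m (i + 1) := by have := hm i i.2; omega
        have hd' : (0 : ℝ) < (m i - m (i + 1) : ℕ) := by exact_mod_cast hdpos
        have hwi : w n i = 2 * (1 + n / ((m i - m (i + 1) : ℕ) * (n / k : ℕ))) := by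
          simp only [hw, hp]
          push_cast
          field_simp
          ring
        have h2 : (n : ℝ) / ((m i - m (i + 1) : ℕ) * (n / k : ℕ)) ≤
            2 * k / (m i - m (i + 1) : ℕ) := by
          rw [div_le_div_iff₀ (by positivity) hd']
          calc (n : ℝ) * (m i - m (i + 1) : ℕ) ≤ (2 * k * (n / k : ℕ)) * (m i - m (i + 1) : ℕ) := by
                gcongr
            _ = _ := by ring
        rw [hwi]
        calc 2 * (1 + (n : ℝ) / ((m i - m (i + 1) : ℕ) * (n / k : ℕ))) *
              (shortfall (θ n) ed m ⊥ i : ℝ)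
            ≤ 2 * (1 + 2 * k / (m i - m (i + 1) : ℕ)) * (m (i + 1) * (n / k : ℕ)) := by
              gcongr
              exact hsf i
          _ = _ := by ring
      refine (Finset.sum_le_sum fun i _ => h1 i).trans ?_
      rw [← Finset.sum_mul]
      gcongr
      linarith
    have hx1 : 1 ≤ (n : ℝ) ^ (3 / 4 : ℝ) :=
      Real.one_le_rpow (by exact_mod_cast hn1) (by norm_num)
    -- by the choice of `s`, the exponential term is negligible at the start
    have hexp : Real.exp (ε * (∑ i, w n i * (shortfall (θ n) ed m ⊥ i : ℝ) -
        ((s * (n / k) : ℕ) : ℝ) + (n / k : ℕ))) ≤ 1 := by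
      rw [Real.exp_le_one_iff]
      refine mul_nonpos_of_nonneg_of_nonpos hεpos.le ?_
      push_cast
      linarith
    have hκN : κ n * (n / k : ℕ) ≤ 4 * k * s ^ 2 := by
      simp only [hκ]
      rw [div_mul_eq_mul_div, div_le_iff₀ (by positivity)]
      calc 2 * (n : ℝ) * s ^ 2 * (n / k : ℕ) ≤ 2 * (2 * k * (n / k : ℕ)) * s ^ 2 * (n / k : ℕ) := by
            gcongr
        _ = _ := by ring
    have hwaste : waste n (n / k) ≤ (8 + 8 * (2 * k)) * (n : ℝ) ^ (3 / 4 : ℝ) :=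
      waste_le hn1 hNpos hnN
    have hE : (∑ i : Fin L, (m (i + 1) : ℝ)) + Br.card ≤ H.edgeSet.ncard := by
      exact_mod_cast hedges
    have hA : ∑ i, (shortfall (θ n) ed m ⊥ i : ℝ) + ((s * (n / k) : ℕ) : ℝ) ≤
        (∑ i : Fin L, (m (i + 1) : ℝ) + s) * (n / k : ℕ) := by
      push_cast
      linarith
    exact stage_budget_le (hκ0 n) hA hκN (by positivity) hN'.le hεpos hexp hx1 (Nat.cast_nonneg _)
      hwaste hE

/-- A connected central graph that contains a complete graph on `r` vertices and whose factors are
built in asymptotically optimal time. For every initial sequence of the edges of the complete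
graph, it has cells that carry just these edges, namely `(16 L + 1) ^ (L - j)` cells with at
least `j` edges, where `L` is the number of edges of the complete graph. By the choice of
the base `16 L + 1`, the waiting times require only `k / 4` leaves, although the number `k` of
vertices exceeds the number of leaves. -/
lemma exists_optimal_central (r : ℕ) :
    ∃ (k : ℕ) (H : SimpleGraph (Fin k)), H.Connected ∧ IsCentral H ∧
      (⊤ : SimpleGraph (Fin r)).IsContained H ∧
      ∀ ω : ℕ → ℝ, Tendsto ω atTop atTop → ∃ σ : ∀ n, Strategy n, BuildsFactorWhp H σ fun n =>
        (n : ℝ) * (H.edgeSet.ncard : ℝ) / (k : ℝ) + ω n * (n : ℝ) ^ (3 / 4 : ℝ) := by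
  classical
  set L := Fintype.card {e : Sym2 (Fin r) // ¬ e.IsDiag} with hL
  set eq := Fintype.equivFin {e : Sym2 (Fin r) // ¬ e.IsDiag} with heq
  set ed : Fin L → Sym2 (Fin r) := fun i => (eq.symm i).1 with hed
  have hedd : ∀ i, ¬ (ed i).IsDiag := fun i => (eq.symm i).2
  have hedinj : Function.Injective ed := Subtype.val_injective.comp eq.symm.injective
  set M := 16 * L + 1 with hM
  set m : ℕ → ℕ := fun j => M ^ (L - j) with hm
  have hMpos : 0 < M := by omega
  have hmpos : ∀ j, 0 < m j := fun j => Nat.pow_pos hMpos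
  have hmsucc : ∀ i < L, m i = m (i + 1) + 16 * L * m (i + 1) := by
    intro i hi
    simp only [hm]
    rw [show L - i = (L - (i + 1)) + 1 by omega, pow_succ]
    nth_rewrite 2 [hM]
    ring
  set m₀ := m 0 with hm₀
  -- large enough for `2 L m₀ + k / 4 + 1 ≤ s`, where `k = s + m₀ r + 1`
  set s := 8 + r * m₀ + 8 * L * m₀ with hs
  set H := hubGraph (cellGraph s m₀ m ed) with hH
  set k := Fintype.card (Option (Fin s ⊕ (Fin m₀ × Fin r))) with hk
  have hkval : k = s + m₀ * r + 1 := by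
    rw [hk, Fintype.card_option, Fintype.card_sum, Fintype.card_prod]
    simp
  have hmle : ∀ j, m j ≤ m₀ := fun j => Nat.pow_le_pow_right hMpos (by omega)
  have hmlt : ∀ i < L, m (i + 1) < m i := by
    intro i hi
    rw [hmsucc i hi]
    have := hmpos (i + 1)
    have hLpos : 0 < L := by omega
    exact Nat.lt_add_of_pos_right (by positivity)
  have hbudget : ∑ i : Fin L, 2 * ((m (i + 1) : ℝ) + 2 * k * m (i + 1) / (m i - m (i + 1) : ℕ)) + 1
      ≤ s := by
    have h1 : ∀ i : Fin L, 2 * ((m (i + 1) : ℝ) + 2 * k * m (i + 1) / (m i - m (i + 1) : ℕ)) ≤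
        2 * m₀ + k / (4 * L) := by
      intro i
      have hLpos : 0 < L := by have := i.2; omega
      have hLR : (0 : ℝ) < L := by exact_mod_cast hLpos
      have hmR : (0 : ℝ) < m (i + 1) := by exact_mod_cast hmpos (i + 1)
      have h2 : m i - m (i + 1) = 16 * L * m (i + 1) := by rw [hmsucc i i.2]; omega
      have h3 : (m (i + 1) : ℝ) ≤ m₀ := by exact_mod_cast hmle _
      rw [h2]
      push_cast
      have h4 : 2 * (k : ℝ) * m (i + 1) / (16 * L * m (i + 1)) = k / (8 * L) := by
        field_simp
        ring
      rw [h4]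
      have h5 : (k : ℝ) / (4 * L) = 2 * (k / (8 * L)) := by field_simp; ring
      linarith
    have h6 : ∑ i : Fin L, 2 * ((m (i + 1) : ℝ) + 2 * k * m (i + 1) / (m i - m (i + 1) : ℕ)) ≤
        2 * L * m₀ + k / 4 := by
      refine (Finset.sum_le_sum fun i _ => h1 i).trans ?_
      rw [Finset.sum_const, Finset.card_univ, Fintype.card_fin, nsmul_eq_mul]
      rcases Nat.eq_zero_or_pos L with h | h
      · rw [h]; simp; positivity
      · have hLR : (0 : ℝ) < L := by exact_mod_cast h
        apply le_of_eq
        field_simp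
    have h7 : (k : ℝ) = s + m₀ * r + 1 := by exact_mod_cast hkval
    have h8 : (s : ℝ) = 8 + r * m₀ + 8 * L * m₀ := by exact_mod_cast hs
    have h9 : (0 : ℝ) ≤ L * m₀ := by positivity
    have h10 : (0 : ℝ) ≤ r * m₀ := by positivity
    nlinarith
  set f := Fintype.equivFin (Option (Fin s ⊕ (Fin m₀ × Fin r))) with hf
  set H' : SimpleGraph (Fin k) := H.map f.toEmbedding with hH'
  have iso : H ≃g H' := SimpleGraph.Iso.map f H
  refine ⟨k, H', iso.connected_iff.1 (hubGraph_connected _),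
    (hubGraph_isCentral _).of_iso iso, ?_, ?_⟩
  · have hcopy : SimpleGraph.Copy (⊤ : SimpleGraph (Fin r)) H := by
      refine ⟨⟨fun x => some (Sum.inr (⟨0, hmpos 0⟩, x)), ?_⟩, ?_⟩
      · intro x y hxy
        refine ⟨_, x, y, rfl, rfl, hxy, eq ⟨s(x, y), fun h => hxy (Sym2.mk_isDiag_iff.1 h)⟩, ?_, ?_⟩
        · simp [hed]
        · exact hmpos _
      · intro x y hxy
        simpa using hxy
    exact ⟨iso.toCopy.comp hcopy⟩
  · intro ω hω
    obtain ⟨σ, hσ⟩ := hubGraph_exists_strategy (s := s) hedd hedinj (m := m) rfl hmlt hk hbudget ω hω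
    refine ⟨σ, ?_⟩
    have hcard : H'.edgeSet.ncard = H.edgeSet.ncard :=
      (Nat.card_congr iso.mapEdgeSet).symm
    unfold BuildsFactorWhp at hσ ⊢
    rw [hcard]
    simp_rw [← containsFactor_congr iso]
    exact hσ

end USTSR

theorem mainTheorem2 :
    -- (i) factors of trees
    (∀ (V : Type*) [Fintype V] (H : SimpleGraph V), H.IsTree →
      ∀ ω : ℕ → ℝ, Tendsto ω atTop atTop →
        ∃ σ : ∀ n, USTSR.Strategy n,
          USTSR.BuildsFactorWhp H σ fun n =>
            (n : ℝ) * ((Fintype.card V : ℝ) - 1) / (Fintype.card V : ℝ)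
              + ω n * (n : ℝ) ^ (3 / 4 : ℝ)) ∧
    -- (ii) factors of central graphs
    (∀ (V : Type*) [Fintype V] (H : SimpleGraph V), USTSR.IsCentral H →
      ∃ C : ℝ, 0 < C ∧ ∃ σ : ∀ n, USTSR.Strategy n,
        USTSR.BuildsFactorWhp H σ fun n => C * (n : ℝ)) ∧
    -- (iii) central graphs with a large clique whose factors are built in optimal time,
    -- together with the deterministic lower bound
    (∀ r : ℕ, 3 ≤ r → ∃ (k : ℕ) (H : SimpleGraph (Fin k)),
      H.Connected ∧ USTSR.IsCentral H ∧ (⊤ : SimpleGraph (Fin r)).IsContained H ∧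
      (∀ ω : ℕ → ℝ, Tendsto ω atTop atTop →
        ∃ σ : ∀ n, USTSR.Strategy n,
          USTSR.BuildsFactorWhp H σ fun n =>
            (n : ℝ) * (H.edgeSet.ncard : ℝ) / (k : ℝ) + ω n * (n : ℝ) ^ (3 / 4 : ℝ)) ∧
      ∃ C : ℝ, ∀ (n : ℕ) (σ : USTSR.Strategy n) (T : ℕ → USTSR.SpanningTree n) (i : ℕ),
        USTSR.hittingTime σ (USTSR.containsFactor H n) T = i →
          (n : ℝ) * (H.edgeSet.ncard : ℝ) / (k : ℝ) - C ≤ (i : ℝ)) := by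
  refine ⟨fun V _ H hH ω hω => USTSR.exists_strategy_of_isTree H hH ω hω,
    fun V _ H hH => USTSR.exists_strategy_of_isCentral H hH, fun r _ => ?_⟩
  obtain ⟨k, H, hconn, hcen, hcont, hst⟩ := USTSR.exists_optimal_central r
  refine ⟨k, H, hconn, hcen, hcont, hst, H.edgeSet.ncard, fun n σ T i h => ?_⟩
  have hk : 0 < k := Fin.pos_iff_nonempty.2 hconn.nonempty
  have hk' : (0 : ℝ) < k := by exact_mod_cast hk
  have h1 := USTSR.le_of_hittingTime_eq h
  rw [Fintype.card_fin] at h1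
  have h2 : ((n / k : ℕ) : ℝ) * H.edgeSet.ncard ≤ i := by exact_mod_cast h1
  -- rounding `n / k` down loses at most one copy, that is, at most all edges of `H` once
  have h3 : (n : ℝ) ≤ ((n / k : ℕ) + 1) * k := by
    exact_mod_cast (Nat.lt_mul_of_div_lt (Nat.lt_succ_self (n / k)) hk).le
  have h4 : (n : ℝ) * H.edgeSet.ncard / k ≤ ((n / k : ℕ) + 1) * H.edgeSet.ncard := by
    rw [div_le_iff₀ hk']
    calc (n : ℝ) * H.edgeSet.ncard ≤ ((n / k : ℕ) + 1) * k * H.edgeSet.ncard := by gcongr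
      _ = _ := by ring
  linarith
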